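/- Let $\Sigma=\{0,1\}$. A tuple of strings $(y_1,\dots,y_n)$ is coded by a single string over $\Sigma$ in a standard polynomial-time computable and polynomial-time invertible way, and "polynomial-time computable" refers to deterministic Turing transducers whose running time is polynomial in the length of the code of the input. For functions $g_1\ge g_2$ from $\mathbb{N}^+$ to $\mathbb{N}^+$, $\mathrm{S}(g_1(n),g_2(n))$ is the class of all $L\subseteq\Sigma^*$ for which there is a polynomial-time computable function $f$, mapping tuples of strings to finite sets of strings, such that for all $n\ge1$ and all distinct strings $y_1,\dots,y_n$: 1. $f(y_1,\dots,y_n)\subseteq\{y_1,\dots,y_n\}$, and 2. if $\|L\cap\{y_1,\dots,y_n\}\|\ge g_1(n)$, then $f(y_1,\dots,y_n)\subseteq L$ and $\|f(y_1,\dots,y_n)\|\ge g_2(n)$. $\text{Fair-S}(g_1(n),g_2(n))$ is defined in the same way, except that 1 and 2 are required only for those distinct $y_1,\dots,y_n$ that all have length at most $n$. For $k\ge1$ put $\mathrm{S}(k)=\mathrm{S}(k,1)$, where the arguments denote constant functions. For a non-decreasing, polynomially bounded, polynomial-time computable $g:\mathbb{N}\to\mathbb{N}^+$, $\text{P-mc}(g)$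 is the class of all $A\subseteq\Sigma^*$ for which there is a polynomial-time computable function $f$, mapping tuples of strings to strings, such that for all $m\ge1$ and all (not necessarily distinct) strings $z_1,\dots,z_m$ with $m\ge g(\max\{|z_1|,\dots,|z_m|\})$ we have $$f(z_1,\dots,z_m)\in\{0,1\}^m\quad\text{and}\quad f(z_1,\dots,z_m)\ne\chi_A(z_1)\cdots\chi_A(z_m).$$ Here a constant stands for the constant function, and $n$ and $n-1$ stand for the functions $n\mapsto\max\{n,1\}$ and $n\mapsto\max\{n-1,1\}$ (so that their values are positive). With $\subset$ denoting strict inclusion: 1. $\text{P-mc}(2)\not\subseteq\text{Fair-S}(n-1,1)$. 2. For each $k\ge1$, $\mathrm{S}(k)\subset\text{P-mc}(k+1)$ and $\mathrm{S}(k)\not\subseteq\text{P-mc}(k)$. 3. $\mathrm{S}(n-1,1)\subset\text{P-mc}(2)$. 4. $\text{Fair-S}(n-1,1)\subset\text{P-mc}(n)$ and $\text{Fair-S}(n-1,1)\not\subseteq\text{P-mc}(n-1)$. -/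

import Mathlib

/-- Strings over the alphabet `{0,1}` (`false` is `0`, `true` is `1`). -/
abbrev Word : Type := List Bool

/-- The code of a tuple of strings as one string over `{0,1}`: every bit `b` of a component is
written `1b`, and every component is terminated by `0`. -/
def tupleCode (ys : List Word) : Word :=
  ys.flatMap fun y => (y.flatMap fun b => [true, b]) ++ [false]

/-- `f` is computed, with respect to the codings `ea` and `eb` of arguments and values by strings
over `{0,1}`, by a deterministic polynomial-time Turing transducer. This is Mathlib's notion; since
Mathlib's machines are only required to have a finite input alphabet, finiteness of all alphabets
of the machine is demanded in addition. -/
def PolyTimeComputable {α β : Type} (ea : α → Word) (eb : β → Word) (f : α → β) : Prop :=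
  ∃ M : Turing.TM2ComputableInPolyTime ea eb f, ∀ k, Finite (M.tm.Γ k)

/-- The two requirements on the value (coded as the tuple `out`, listing the elements of a set) of
an `(i, j)`-selector for `L` at the input tuple `ys`. -/
def SelectsFor (L : Set Word) (i j : ℕ) (ys out : List Word) : Prop :=
  (∀ x ∈ out, x ∈ ys) ∧
    (i ≤ (L ∩ {y | y ∈ ys}).ncard → (∀ x ∈ out, x ∈ L) ∧ j ≤ {x | x ∈ out}.ncard)

/-- The class `S(g₁(n), g₂(n))`: the selector must work on all tuples of `n ≥ 1` distinct
strings. -/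
def SelClass (g₁ g₂ : ℕ → ℕ) : Set (Set Word) :=
  {L | ∃ f : List Word → List Word, PolyTimeComputable tupleCode tupleCode f ∧
    ∀ ys : List Word, 1 ≤ ys.length → ys.Nodup →
      SelectsFor L (g₁ ys.length) (g₂ ys.length) ys (f ys)}

/-- The class `Fair-S(g₁(n), g₂(n))`: the selector must work on all tuples of `n ≥ 1` distinct
strings each of which has length at most `n`. -/
def FairSelClass (g₁ g₂ : ℕ → ℕ) : Set (Set Word) :=
  {L | ∃ f : List Word → List Word, PolyTimeComputable tupleCode tupleCode f ∧
    ∀ ys : List Word, 1 ≤ ys.length → ys.Nodup → (∀ y ∈ ys, y.length ≤ ys.length) →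
      SelectsFor L (g₁ ys.length) (g₂ ys.length) ys (f ys)}

open Classical in
/-- The bit string `χ_A(z₁) ⋯ χ_A(z_m)`. -/
noncomputable def charString (A : Set Word) (zs : List Word) : Word :=
  zs.map fun z => decide (z ∈ A)

/-- `f` is a `g`-membership-comparing function for `A`: on all tuples of `m ≥ 1` strings, not
necessarily distinct, with `m ≥ g(max |z_i|)`, it outputs a string of length `m` that is not the
characteristic string of the tuple. -/
def IsMembershipComparing (g : ℕ → ℕ) (A : Set Word) (f : List Word → Word) : Prop :=
  ∀ zs : List Word, 1 ≤ zs.length → g (zs.toFinset.sup List.length) ≤ zs.length →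
    (f zs).length = zs.length ∧ charString A zs ≠ f zs

/-- The class `P-mc(g)`. -/
def PMc (g : ℕ → ℕ) : Set (Set Word) :=
  {A | ∃ f : List Word → Word, PolyTimeComputable tupleCode id f ∧ IsMembershipComparing g A f}

/-- The class `S(k) = S(k, 1)`. -/
def SelLevel (k : ℕ) : Set (Set Word) := SelClass (fun _ => k) (fun _ => 1)

/-- The threshold function `n`, with positive values (the value at `0` is `1`). -/
def thrN (n : ℕ) : ℕ := max n 1

/-- The threshold function `n - 1`, with positive values (the values at `0` and `1` are `1`). -/
def thrPred (n : ℕ) : ℕ := max (n - 1) 1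

/-- The class `S(n - 1, 1)`. -/
def SelPred : Set (Set Word) := SelClass thrPred (fun _ => 1)

/-- The class `Fair-S(n - 1, 1)`. -/
def FairSelPred : Set (Set Word) := FairSelClass thrPred (fun _ => 1)

/-! ### A small imperative language over stacks of bits -/

namespace StackProg

open Function (update)

/-- Programs over stacks of bits indexed by `R`, with calls of the oracles indexed by `ι`. `pop`
removes the top of a stack and branches on it, `loop` does so repeatedly until the stack is
empty, and `call i r` replaces the content of the stack `r`. -/
inductive Prog (ι R : Type) : Type
  | skip : Prog ι R
  | push : R → Bool → Prog ι R
  | pop : R → Prog ι R → Prog ι R → Prog ι R → Prog ι R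
  | seq : Prog ι R → Prog ι R → Prog ι R
  | loop : R → Prog ι R → Prog ι R → Prog ι R
  | call : ι → R → Prog ι R

open Prog

variable {ι R R' : Type} [DecidableEq R] [DecidableEq R']

/-- `Run F c p s s' t`: started with the stacks `s`, the program `p` stops after exactly `t` steps
with the stacks `s'`, where the oracle `i` turns `w` into `F i w` within `c i w` steps. -/
inductive Run (F : ι → Word → Word) (c : ι → Word → ℕ) :
    Prog ι R → (R → Word) → (R → Word) → ℕ → Prop
  | skip (s) : Run F c skip s s 1
  | push (r b s) : Run F c (push r b) s (update s r (b :: s r)) 1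
  | popNil {r pn pf pt s s' t} : s r = [] → Run F c pn s s' t →
      Run F c (pop r pn pf pt) s s' (t + 1)
  | popFalse {r pn pf pt s s' t w} : s r = false :: w → Run F c pf (update s r w) s' t →
      Run F c (pop r pn pf pt) s s' (t + 1)
  | popTrue {r pn pf pt s s' t w} : s r = true :: w → Run F c pt (update s r w) s' t →
      Run F c (pop r pn pf pt) s s' (t + 1)
  | seq {p q s s' s'' t t'} : Run F c p s s' t → Run F c q s' s'' t' →
      Run F c (seq p q) s s'' (t' + t)
  | loopNil {r pf pt s} : s r = [] → Run F c (loop r pf pt) s s 1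
  | loopFalse {r pf pt s s' s'' t t' w} : s r = false :: w → Run F c pf (update s r w) s' t →
      Run F c (loop r pf pt) s' s'' t' → Run F c (loop r pf pt) s s'' (t' + (t + 1))
  | loopTrue {r pf pt s s' s'' t t' w} : s r = true :: w → Run F c pt (update s r w) s' t →
      Run F c (loop r pf pt) s' s'' t' → Run F c (loop r pf pt) s s'' (t' + (t + 1))
  | call (i r s) : Run F c (call i r) s (update s r (F i (s r))) (c i (s r))

/-! #### Compilation to stack machines -/

/-- The labels of the machine for a program. -/
def Lbl : Prog Empty R → Type
  | skip => Unit
  | push _ _ => Unit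
  | pop _ p q r => Option (Lbl p ⊕ Lbl q ⊕ Lbl r)
  | seq p q => Lbl p ⊕ Lbl q
  | loop _ p q => Option (Lbl p ⊕ Lbl q)
  | call _ _ => Unit

/-- The label at which a program starts. -/
def entry : (p : Prog Empty R) → Lbl p
  | skip => ()
  | push _ _ => ()
  | pop _ _ _ _ => none
  | seq p _ => Sum.inl (entry p)
  | loop _ _ _ => none
  | call _ _ => ()

omit [DecidableEq R] in
theorem finite_lbl : (p : Prog Empty R) → Finite (Lbl p)
  | skip => inferInstanceAs (Finite Unit)
  | push _ _ => inferInstanceAs (Finite Unit)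
  | pop _ p q r =>
    have := finite_lbl p; have := finite_lbl q; have := finite_lbl r
    inferInstanceAs (Finite (Option (Lbl p ⊕ Lbl q ⊕ Lbl r)))
  | seq p q =>
    have := finite_lbl p; have := finite_lbl q
    inferInstanceAs (Finite (Lbl p ⊕ Lbl q))
  | loop _ p q =>
    have := finite_lbl p; have := finite_lbl q
    inferInstanceAs (Finite (Option (Lbl p ⊕ Lbl q)))
  | call _ _ => inferInstanceAs (Finite Unit)

open Turing

/-- The machine statements for a program whose labels are embedded into the labels of a machine,
and which continues at the label `next`. -/
def code {Λ : Type} : (p : Prog Empty R) → (Lbl p → Λ) → Λ → Lbl p →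
    TM2.Stmt (fun _ : R => Bool) Λ (Option Bool)
  | skip, _, next, _ => .goto fun _ => next
  | push r b, _, next, _ => .push r (fun _ => b) (.goto fun _ => next)
  | pop r p q s, e, _, none => .pop r (fun _ o => o) (.goto fun v => match v with
      | none => e (some (.inl (entry p)))
      | some false => e (some (.inr (.inl (entry q))))
      | some true => e (some (.inr (.inr (entry s)))))
  | pop _ p _ _, e, next, some (.inl l) => code p (fun l => e (some (.inl l))) next l
  | pop _ _ q _, e, next, some (.inr (.inl l)) =>
    code q (fun l => e (some (.inr (.inl l)))) next l
  | pop _ _ _ s, e, next, some (.inr (.inr l)) =>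
    code s (fun l => e (some (.inr (.inr l)))) next l
  | seq p q, e, _, .inl l => code p (fun l => e (.inl l)) (e (.inr (entry q))) l
  | seq _ q, e, next, .inr l => code q (fun l => e (.inr l)) next l
  | loop r p q, e, next, none => .pop r (fun _ o => o) (.goto fun v => match v with
      | none => next
      | some false => e (some (.inl (entry p)))
      | some true => e (some (.inr (entry q))))
  | loop _ p _, e, _, some (.inl l) => code p (fun l => e (some (.inl l))) (e none) l
  | loop _ _ q, e, _, some (.inr l) => code q (fun l => e (some (.inr l))) (e none) l
  | call _ _, _, next, _ => .goto fun _ => next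

/-- A run of a program is followed step by step by the machine. -/
theorem Run.compile {F : Empty → Word → Word} {c : Empty → Word → ℕ} {p : Prog Empty R}
    {s s' : R → Word} {t : ℕ} (h : Run F c p s s' t) {Λ : Type}
    (M : Λ → TM2.Stmt (fun _ : R => Bool) Λ (Option Bool)) (e : Lbl p → Λ) (next : Λ)
    (hM : ∀ l, M (e l) = code p e next l) (v : Option Bool) :
    ∃ v', (flip bind (TM2.step M))^[t] (some ⟨some (e (entry p)), v, s⟩) =
      some ⟨some next, v', s'⟩ := by
  induction h generalizing next v with
  | skip s => exact ⟨v, by simp [flip, TM2.step, hM, code]⟩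
  | push r b s => exact ⟨v, by simp [flip, TM2.step, hM, code]⟩
  | @popNil r pn pf pt s s' t hr _ ih =>
    obtain ⟨v', hv⟩ := ih (fun l => e (some (.inl l))) next (fun l => hM _) none
    refine ⟨v', ?_⟩
    rw [Function.iterate_succ_apply, ← hv]
    have : update s r [] = s := by rw [← hr]; simp
    have h₀ : M (e none) = _ := hM none
    simp [flip, entry, TM2.step, h₀, code, hr, this]
  | @popFalse r pn pf pt s s' t w hr _ ih =>
    obtain ⟨v', hv⟩ := ih (fun l => e (some (.inr (.inl l)))) next (fun l => hM _) (some false)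
    refine ⟨v', ?_⟩
    rw [Function.iterate_succ_apply, ← hv]
    have h₀ : M (e none) = _ := hM none
    simp [flip, entry, TM2.step, h₀, code, hr]
  | @popTrue r pn pf pt s s' t w hr _ ih =>
    obtain ⟨v', hv⟩ := ih (fun l => e (some (.inr (.inr l)))) next (fun l => hM _) (some true)
    refine ⟨v', ?_⟩
    rw [Function.iterate_succ_apply, ← hv]
    have h₀ : M (e none) = _ := hM none
    simp [flip, entry, TM2.step, h₀, code, hr]
  | @seq p q s s' s'' t t' _ _ ih₁ ih₂ =>
    obtain ⟨v₁, hv₁⟩ := ih₁ (fun l => e (.inl l)) (e (.inr (entry q))) (fun l => hM _) v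
    obtain ⟨v₂, hv₂⟩ := ih₂ (fun l => e (.inr l)) next (fun l => hM _) v₁
    exact ⟨v₂, by rw [Function.iterate_add_apply, ← hv₂, ← hv₁]; rfl⟩
  | @loopNil r pf pt s hr =>
    have : update s r [] = s := by rw [← hr]; simp
    have h₀ : M (e none) = _ := hM none
    exact ⟨none, by simp [flip, entry, TM2.step, h₀, code, hr, this]⟩
  | @loopFalse r pf pt s s' s'' t t' w hr _ _ ih₁ ih₂ =>
    obtain ⟨v₁, hv₁⟩ := ih₁ (fun l => e (some (.inl l))) (e none) (fun l => hM _) (some false)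
    obtain ⟨v₂, hv₂⟩ := ih₂ e next hM v₁
    refine ⟨v₂, ?_⟩
    rw [Function.iterate_add_apply, Function.iterate_succ_apply, ← hv₂]
    congr 1
    rw [entry, ← hv₁]
    have h₀ : M (e none) = _ := hM none
    simp [flip, TM2.step, h₀, code, hr]
  | @loopTrue r pf pt s s' s'' t t' w hr _ _ ih₁ ih₂ =>
    obtain ⟨v₁, hv₁⟩ := ih₁ (fun l => e (some (.inr l))) (e none) (fun l => hM _) (some true)
    obtain ⟨v₂, hv₂⟩ := ih₂ e next hM v₁
    refine ⟨v₂, ?_⟩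
    rw [Function.iterate_add_apply, Function.iterate_succ_apply, ← hv₂]
    congr 1
    rw [entry, ← hv₁]
    have h₀ : M (e none) = _ := hM none
    simp [flip, TM2.step, h₀, code, hr]
  | call i => exact i.elim

/-! #### Renaming and linking -/

/-- Renaming of stacks. -/
def Prog.map (e : R → R') : Prog ι R → Prog ι R'
  | skip => skip
  | push r b => push (e r) b
  | pop r p q s => pop (e r) (p.map e) (q.map e) (s.map e)
  | seq p q => seq (p.map e) (q.map e)
  | loop r p q => loop (e r) (p.map e) (q.map e)
  | call i r => call i (e r)

theorem Run.map {F : ι → Word → Word} {c : ι → Word → ℕ} {p : Prog ι R}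
    {s s' : R → Word} {t : ℕ} (h : Run F c p s s' t) {e : R → R'} (he : e.Injective)
    (S : R' → Word) (hS : S ∘ e = s) :
    ∃ S', S' ∘ e = s' ∧ (∀ r, r ∉ Set.range e → S' r = S r) ∧ Run F c (p.map e) S S' t := by
  have hu : ∀ (S : R' → Word) (r : R) (w : Word) (r' : R'), r' ∉ Set.range e →
      update S (e r) w r' = S r' := fun S r w r' h =>
    Function.update_of_ne (fun h' => h ⟨r, h'.symm⟩) _ _
  have hc : ∀ (S : R' → Word) (r : R) (w : Word), update S (e r) w ∘ e = update (S ∘ e) r w :=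
    fun S r w => Function.update_comp_eq_of_injective _ he _ _
  induction h generalizing S with
  | skip s => exact ⟨S, hS, fun _ _ => rfl, .skip _⟩
  | push r b s =>
    refine ⟨_, ?_, ?_, .push (e r) b S⟩
    · rw [hc, hS, ← hS]; rfl
    · exact fun r' h => hu _ _ _ _ h
  | @popNil r pn pf pt s s' t hr _ ih =>
    obtain ⟨S', h₁, h₂, h₃⟩ := ih S hS
    exact ⟨S', h₁, h₂, .popNil (by rw [← hr, ← hS]; rfl) h₃⟩
  | @popFalse r pn pf pt s s' t w hr _ ih =>
    obtain ⟨S', h₁, h₂, h₃⟩ := ih (update S (e r) w) (by rw [hc, hS])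
    exact ⟨S', h₁, fun r' h => (h₂ r' h).trans (hu _ _ _ _ h),
      .popFalse (by rw [← hr, ← hS]; rfl) h₃⟩
  | @popTrue r pn pf pt s s' t w hr _ ih =>
    obtain ⟨S', h₁, h₂, h₃⟩ := ih (update S (e r) w) (by rw [hc, hS])
    exact ⟨S', h₁, fun r' h => (h₂ r' h).trans (hu _ _ _ _ h),
      .popTrue (by rw [← hr, ← hS]; rfl) h₃⟩
  | seq _ _ ih₁ ih₂ =>
    obtain ⟨S₁, h₁, h₂, h₃⟩ := ih₁ S hS
    obtain ⟨S₂, k₁, k₂, k₃⟩ := ih₂ S₁ h₁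
    exact ⟨S₂, k₁, fun r h => (k₂ r h).trans (h₂ r h), .seq h₃ k₃⟩
  | loopNil hr => exact ⟨S, hS, fun _ _ => rfl, .loopNil (by rw [← hr, ← hS]; rfl)⟩
  | @loopFalse r pf pt s s' s'' t t' w hr _ _ ih₁ ih₂ =>
    obtain ⟨S₁, h₁, h₂, h₃⟩ := ih₁ (update S (e r) w) (by rw [hc, hS])
    obtain ⟨S₂, k₁, k₂, k₃⟩ := ih₂ S₁ h₁
    exact ⟨S₂, k₁, fun r' h => (k₂ r' h).trans ((h₂ r' h).trans (hu _ _ _ _ h)),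
      .loopFalse (by rw [← hr, ← hS]; rfl) h₃ k₃⟩
  | @loopTrue r pf pt s s' s'' t t' w hr _ _ ih₁ ih₂ =>
    obtain ⟨S₁, h₁, h₂, h₃⟩ := ih₁ (update S (e r) w) (by rw [hc, hS])
    obtain ⟨S₂, k₁, k₂, k₃⟩ := ih₂ S₁ h₁
    exact ⟨S₂, k₁, fun r' h => (k₂ r' h).trans ((h₂ r' h).trans (hu _ _ _ _ h)),
      .loopTrue (by rw [← hr, ← hS]; rfl) h₃ k₃⟩
  | call i r s =>
    refine ⟨update S (e r) (F i (s r)), ?_, ?_, ?_⟩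
    rotate_left 2
    · have := Run.call (F := F) (c := c) i (e r) S
      rw [show S (e r) = s r by rw [← hS]; rfl] at this
      exact this
    · rw [hc, hS]
    · exact fun r' h => hu _ _ _ _ h

theorem Run.length_le {F : ι → Word → Word} {c : ι → Word → ℕ} {p : Prog ι R}
    {s s' : R → Word} {t : ℕ} (h : Run F c p s s' t)
    (hF : ∀ i w, (F i w).length ≤ w.length + c i w) (r : R) :
    (s' r).length ≤ (s r).length + t := by
  have hu : ∀ (s : R → Word) (r' : R) (b : Bool) (w : Word), s r' = b :: w →
      (update s r' w r).length ≤ (s r).length := by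
    intro s r' b w h
    by_cases hr : r = r'
    · subst hr; simp [h]
    · simp [hr]
  induction h with
  | skip | loopNil => omega
  | push r' b s =>
    by_cases hr : r = r'
    · subst hr; simp
    · simp [hr]
  | popNil _ _ ih => omega
  | popFalse hr _ ih | popTrue hr _ ih => have := hu _ _ _ _ hr; omega
  | seq _ _ ih₁ ih₂ => omega
  | loopFalse hr _ _ ih₁ ih₂ | loopTrue hr _ _ ih₁ ih₂ => have := hu _ _ _ _ hr; omega
  | call i r' s =>
    by_cases hr : r = r'
    · subst hr; simpa using hF _ _
    · simp [hr]

/-- The stacks that are empty except for `w` on the stack `r`. -/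
def single (r : R) (w : Word) : R → Word := update (fun _ => []) r w

/-- Replacing the calls in a program by programs. -/
def Prog.link {K : ι → Type} [∀ i, DecidableEq (K i)] (a : ∀ i, K i)
    (P : ∀ i, Prog Empty (K i)) : Prog ι R → Prog Empty (R ⊕ Σ i, K i)
  | skip => skip
  | push r b => push (.inl r) b
  | pop r p q s => pop (.inl r) (p.link a P) (q.link a P) (s.link a P)
  | seq p q => seq (p.link a P) (q.link a P)
  | loop r p q => loop (.inl r) (p.link a P) (q.link a P)
  | call i r => (P i).map fun k => if k = a i then .inl r else .inr ⟨i, k⟩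

/-- The stacks `s` together with empty auxiliary stacks. -/
def pad {K : Type} (s : R → Word) : R ⊕ K → Word := Sum.elim s fun _ => []

omit [DecidableEq R'] in
theorem update_pad {K : Type} [DecidableEq K] (s : R → Word) (r : R) (w : Word) :
    update (pad (K := K) s) (.inl r) w = pad (update s r w) := by
  funext x
  rcases x with x | x
  · by_cases h : x = r
    · subst h; simp [pad]
    · simp [pad, h]
  · simp [pad]

theorem Run.link [DecidableEq ι] {F : ι → Word → Word} {c : ι → Word → ℕ} {K : ι → Type}
    [∀ i, DecidableEq (K i)]
    {a : ∀ i, K i} {P : ∀ i, Prog Empty (K i)} {F₀ c₀}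
    (hP : ∀ i w, Run F₀ c₀ (P i) (single (a i) w) (single (a i) (F i w)) (c i w))
    {p : Prog ι R} {s s' : R → Word} {t : ℕ} (h : Run F c p s s' t) :
    Run F₀ c₀ (p.link a P) (pad s) (pad s') t := by
  induction h with
  | skip s => exact .skip _
  | push r b s => rw [← update_pad]; exact .push _ _ _
  | popNil hr _ ih => exact .popNil hr ih
  | popFalse hr _ ih => exact .popFalse hr (by rwa [update_pad])
  | popTrue hr _ ih => exact .popTrue hr (by rwa [update_pad])
  | seq _ _ ih₁ ih₂ => exact .seq ih₁ ih₂
  | loopNil hr => exact .loopNil hr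
  | loopFalse hr _ _ ih₁ ih₂ => exact .loopFalse hr (by rwa [update_pad]) ih₂
  | loopTrue hr _ _ ih₁ ih₂ => exact .loopTrue hr (by rwa [update_pad]) ih₂
  | call i r s =>
    set e : K i → R ⊕ Σ i, K i := fun k => if k = a i then .inl r else .inr ⟨i, k⟩ with he
    have hinj : e.Injective := by
      intro k k' h
      simp only [he] at h
      split_ifs at h with h₁ h₂ h₂
      · rw [h₁, h₂]
      · simpa using h
    obtain ⟨S', h₁, h₂, h₃⟩ := (hP i (s r)).map hinj (pad s) (by
      funext k
      by_cases hk : k = a i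
      · subst hk; simp [he, pad, single]
      · simp [he, pad, single, hk])
    have hS' : S' = pad (update s r (F i (s r))) := by
      funext x
      by_cases hx : x ∈ Set.range e
      · obtain ⟨k, rfl⟩ := hx
        rw [← Function.comp_apply (f := S') (g := e), h₁]
        by_cases hk : k = a i
        · subst hk; simp [he, pad, single]
        · simp [he, pad, single, hk]
      · rw [h₂ x hx]
        rcases x with x | x
        · have : x ≠ r := by
            rintro rfl
            exact hx ⟨a i, by simp [he]⟩
          simp [pad, this]
        · rfl
    rw [← hS']
    exact h₃

end StackProg

/-! ### Polynomial bounds -/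

/-- Functions on the natural numbers bounded by a polynomial. -/
def PolyBdd (T : ℕ → ℕ) : Prop := ∃ k, ∀ n, T n ≤ (n + 2) ^ k

namespace PolyBdd

variable {T T' : ℕ → ℕ}

theorem pow_add_two (k : ℕ) : PolyBdd fun n => (n + 2) ^ k := ⟨k, fun _ => le_rfl⟩

theorem mono (h : PolyBdd T) (h' : ∀ n, T' n ≤ T n) : PolyBdd T' :=
  h.imp fun _ hk n => (h' n).trans (hk n)

theorem const (m : ℕ) : PolyBdd fun _ => m :=
  ⟨m, fun n => Nat.lt_two_pow_self.le.trans (Nat.pow_le_pow_left (by omega) _)⟩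

theorem id : PolyBdd fun n => n := ⟨1, fun n => by simp⟩

theorem mul (h : PolyBdd T) (h' : PolyBdd T') : PolyBdd fun n => T n * T' n := by
  obtain ⟨k, hk⟩ := h
  obtain ⟨k', hk'⟩ := h'
  exact ⟨k + k', fun n => by rw [pow_add]; exact Nat.mul_le_mul (hk n) (hk' n)⟩

theorem add (h : PolyBdd T) (h' : PolyBdd T') : PolyBdd fun n => T n + T' n := by
  obtain ⟨k, hk⟩ := h
  obtain ⟨k', hk'⟩ := h'
  refine ⟨k + k' + 1, fun n => ?_⟩
  have h₁ : (n + 2) ^ k ≤ (n + 2) ^ (k + k') := Nat.pow_le_pow_right (by omega) (by omega)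
  have h₂ : (n + 2) ^ k' ≤ (n + 2) ^ (k + k') := Nat.pow_le_pow_right (by omega) (by omega)
  calc T n + T' n ≤ (n + 2) ^ (k + k') * 2 := by have := hk n; have := hk' n; omega
    _ ≤ (n + 2) ^ (k + k' + 1) := by rw [pow_succ]; exact Nat.mul_le_mul_left _ (by omega)

theorem comp (h : PolyBdd T) (h' : PolyBdd T') : PolyBdd fun n => T (T' n) := by
  obtain ⟨k, hk⟩ := h
  obtain ⟨k', hk'⟩ := h'.add (const 2)
  exact ⟨k' * k, fun n => (hk _).trans (by rw [pow_mul]; exact Nat.pow_le_pow_left (hk' n) _)⟩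

end PolyBdd

/-! ### Functions computed by programs in polynomial time -/

namespace StackProg

open Function (update)
open Prog

section Ends

variable {ι R : Type} [DecidableEq R] {F : ι → Word → Word} {c : ι → Word → ℕ}

/-- The program `p` transforms the stacks `s` into `s'` within at most `T` steps. -/
def Ends (F : ι → Word → Word) (c : ι → Word → ℕ) (p : Prog ι R) (s s' : R → Word) (T : ℕ) :
    Prop := ∃ t ≤ T, Run F c p s s' t

namespace Ends

variable {p q pn : Prog ι R} {s s' s'' : R → Word} {T T' : ℕ} {r r' r₁ r₂ : R} {w : Word}

theorem mono (h : Ends F c p s s' T) (hT : T ≤ T') : Ends F c p s s' T' := by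
  obtain ⟨t, ht, h⟩ := h
  exact ⟨t, ht.trans hT, h⟩

theorem congr (h : Ends F c p s s' T) {S S' : R → Word} (h₁ : S = s) (h₂ : s' = S')
    (hT : T ≤ T') : Ends F c p S S' T' := h₁ ▸ h₂ ▸ h.mono hT

theorem skip : Ends F c skip s s 1 := ⟨1, le_rfl, .skip _⟩

theorem push {b : Bool} (h : s' = update s r (b :: s r)) : Ends F c (push r b) s s' 1 :=
  ⟨1, le_rfl, h ▸ .push _ _ _⟩

theorem seq (h : Ends F c p s s' T) (h' : Ends F c q s' s'' T') :
    Ends F c (seq p q) s s'' (T + T') := by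
  obtain ⟨t, ht, h⟩ := h
  obtain ⟨t', ht', h'⟩ := h'
  exact ⟨t' + t, by omega, .seq h h'⟩

theorem call {i : ι} (h : s' = update s r (F i (s r))) (hT : c i (s r) ≤ T) :
    Ends F c (call i r) s s' T := ⟨_, hT, h ▸ .call _ _ _⟩

theorem popNil {pf pt : Prog ι R} (hr : s r = []) (h : Ends F c pn s s' T) :
    Ends F c (pop r pn pf pt) s s' (T + 1) := by
  obtain ⟨t, ht, h⟩ := h
  exact ⟨t + 1, by omega, .popNil hr h⟩

theorem popCons {bd : Bool → Prog ι R} {b : Bool} (hr : s r = b :: w)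
    (h : Ends F c (bd b) (update s r w) s' T) :
    Ends F c (pop r pn (bd false) (bd true)) s s' (T + 1) := by
  obtain ⟨t, ht, h⟩ := h
  cases b
  · exact ⟨t + 1, by omega, .popFalse hr h⟩
  · exact ⟨t + 1, by omega, .popTrue hr h⟩

theorem loopCons {bd : Bool → Prog ι R} {b : Bool} (hr : s r = b :: w)
    (h : Ends F c (bd b) (update s r w) s' T)
    (h' : Ends F c (loop r (bd false) (bd true)) s' s'' T') :
    Ends F c (loop r (bd false) (bd true)) s s'' (T + T' + 1) := by
  obtain ⟨t, ht, h⟩ := h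
  obtain ⟨t', ht', h'⟩ := h'
  cases b
  · exact ⟨t' + (t + 1), by omega, .loopFalse hr h h'⟩
  · exact ⟨t' + (t + 1), by omega, .loopTrue hr h h'⟩

theorem loopFold {β : Type} {bd : Bool → Prog ι R} (S : Word → β → R → Word)
    (g : β → Bool → β) (I : β → Prop) (hS : ∀ u a, S u a r = u)
    (hI : ∀ a b, I a → I (g a b))
    (h : ∀ b u a, I a → Ends F c (bd b) (update (S (b :: u) a) r u) (S u (g a b)) T) :
    ∀ u a, I a → Ends F c (loop r (bd false) (bd true)) (S u a) (S [] (u.foldl g a))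
      ((T + 1) * u.length + 1)
  | [], a, _ => ⟨1, by simp, .loopNil (hS _ _)⟩
  | b :: u, a, ha =>
    ((h b u a ha).loopCons (hS _ _) (loopFold S g I hS hI h u (g a b) (hI _ _ ha))).mono
      (by simp only [List.length_cons]; ring_nf; omega)

end Ends

/-- Emptying a stack. -/
def clear (r : R) : Prog ι R := loop r .skip .skip

/-- Moving one stack onto another one, in reversed order. -/
def moveRev (r r' : R) : Prog ι R := loop r (.push r' false) (.push r' true)

/-- Moving one stack onto two other ones, in reversed order. -/
def moveRev₂ (r r₁ r₂ : R) : Prog ι R :=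
  loop r (.seq (.push r₁ false) (.push r₂ false)) (.seq (.push r₁ true) (.push r₂ true))

/-- Copying the stack `r` onto `r'` with the help of the stack `t`. -/
def copy (r r' t : R) : Prog ι R := .seq (moveRev r t) (moveRev₂ t r r')

/-- Moving the stack `r` onto `r'` with the help of the stack `t`. -/
def move (r r' t : R) : Prog ι R := .seq (moveRev r t) (moveRev t r')

variable {s s' : R → Word} {r r' r₁ r₂ t : R} {T : ℕ}

theorem ends_clear (h : s' = update s r []) (hT : 2 * (s r).length + 1 ≤ T) :
    Ends F c (clear r) s s' T := by
  have := Ends.loopFold (F := F) (c := c) (r := r) (bd := fun _ => .skip) (T := 1)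
    (fun u (_ : Unit) => update s r u) (fun a _ => a) (fun _ => True) (by simp) (by simp)
    (by intro b u a _; exact Ends.skip.congr (by simp) rfl le_rfl) (s r) () trivial
  exact this.congr (by simp) h.symm hT

theorem ends_moveRev (hr : r ≠ r') (h : s' = update (update s r []) r' ((s r).reverse ++ s r'))
    (hT : 2 * (s r).length + 1 ≤ T) : Ends F c (moveRev r r') s s' T := by
  have := Ends.loopFold (F := F) (c := c) (r := r) (bd := fun b => .push r' b) (T := 1)
    (fun u v => update (update s r u) r' v) (fun a b => b :: a) (fun _ => True)
    (by simp [hr]) (by simp)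
    (by
      intro b u a _
      refine .push ?_
      funext x
      simp only [Function.update_apply]
      split_ifs <;> simp_all) (s r) (s r') trivial
  refine this.congr (by simp) ?_ hT
  rw [h]
  simp

theorem ends_moveRev₂ (h₁ : r ≠ r₁) (h₂ : r ≠ r₂) (h₁₂ : r₁ ≠ r₂)
    (h : s' = update (update (update s r []) r₁ ((s r).reverse ++ s r₁)) r₂
      ((s r).reverse ++ s r₂))
    (hT : 3 * (s r).length + 1 ≤ T) : Ends F c (moveRev₂ r r₁ r₂) s s' T := by
  have := Ends.loopFold (F := F) (c := c) (r := r)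
    (bd := fun b => .seq (.push r₁ b) (.push r₂ b)) (T := 2)
    (fun u v => update (update (update s r u) r₁ (v ++ s r₁)) r₂ (v ++ s r₂))
    (fun a b => b :: a) (fun _ => True) (by simp [h₁, h₂]) (by simp)
    (by
      intro b u a _
      refine (Ends.push rfl).seq (.push ?_)
      funext x
      simp only [Function.update_apply]
      split_ifs <;> simp_all) (s r) [] trivial
  refine this.congr (by simp) ?_ hT
  rw [h]
  simp

theorem ends_copy (h₁ : r ≠ t) (h₂ : r' ≠ t) (h₁₂ : r ≠ r') (ht : s t = [])
    (h : s' = update s r' (s r ++ s r')) (hT : 5 * (s r).length + 2 ≤ T) :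
    Ends F c (copy r r' t) s s' T := by
  have e := (ends_moveRev (F := F) (c := c) (s := s) h₁ rfl le_rfl).seq
    (ends_moveRev₂ h₁.symm h₂.symm h₁₂ rfl le_rfl)
  refine e.congr rfl ?_ ?_
  · rw [h]
    funext x
    simp only [Function.update_apply]
    split_ifs <;> simp_all
  · simp [ht]; omega

theorem ends_move (h₁ : r ≠ t) (h₂ : r' ≠ t) (h₁₂ : r ≠ r') (ht : s t = [])
    (h : s' = update (update s r []) r' (s r ++ s r')) (hT : 4 * (s r).length + 2 ≤ T) :
    Ends F c (move r r' t) s s' T := by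
  have e := (ends_moveRev (F := F) (c := c) (s := s) h₁ rfl le_rfl).seq
    (ends_moveRev h₂.symm rfl le_rfl)
  refine e.congr rfl ?_ ?_
  · rw [h]
    funext x
    simp only [Function.update_apply]
    split_ifs <;> simp_all
  · simp [ht]; omega

end Ends

/-- The trivial family of oracles. -/
def noOracle : Empty → Word → Word := fun i => i.elim

/-- The trivial cost function. -/
def noCost : Empty → Word → ℕ := fun i => i.elim

/-- `f` is computed by a program, on one stack and with auxiliary stacks, in polynomial time. -/
def PolyProg (f : Word → Word) : Prop :=
  ∃ (K : Type) (_ : Fintype K) (_ : DecidableEq K) (a : K) (p : Prog Empty K) (T : ℕ → ℕ),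
    PolyBdd T ∧ ∀ w, Ends noOracle noCost p (single a w) (single a (f w)) (T w.length)

theorem PolyProg.length_le {f : Word → Word} (h : PolyProg f) :
    ∃ k, ∀ w, (f w).length ≤ (w.length + 2) ^ k := by
  obtain ⟨K, _, _, a, p, T, hT, h⟩ := h
  obtain ⟨k, hk⟩ := PolyBdd.id.add hT
  refine ⟨k, fun w => ?_⟩
  obtain ⟨t, ht, hr⟩ := h w
  have := hr.length_le (fun i => i.elim) a
  simp only [single, Function.update_self] at this
  exact this.trans ((Nat.add_le_add_left ht _).trans (hk w.length))

/-- A program with calls of functions that are computed in polynomial time. -/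
theorem PolyProg.of_prog {ι R : Type} [Fintype ι] [DecidableEq ι] [Fintype R] [DecidableEq R]
    {F : ι → Word → Word} (hF : ∀ i, PolyProg (F i)) (a : R) (p : Prog ι R) (f : Word → Word)
    (h : ∀ c k, (∀ i w, c i w ≤ (w.length + 2) ^ k) → (∀ i w, (F i w).length ≤ (w.length + 2) ^ k) →
      ∃ T, PolyBdd T ∧ ∀ w, Ends F c p (single a w) (single a (f w)) (T w.length)) :
    PolyProg f := by
  choose l hl using fun i => (hF i).length_le
  choose K _ _ b P T hT hP using hF
  choose k hk using hT
  choose c hc hr using hP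
  set m := Finset.univ.sup k + Finset.univ.sup l with hm
  have hkm : ∀ i, k i ≤ m := fun i =>
    (Finset.le_sup (f := k) (Finset.mem_univ i)).trans (by omega)
  have hlm : ∀ i, l i ≤ m := fun i =>
    (Finset.le_sup (f := l) (Finset.mem_univ i)).trans (by omega)
  obtain ⟨T', hT', H⟩ := h c m
    (fun i w => (hc i w).trans ((hk i _).trans (Nat.pow_le_pow_right (by omega) (hkm i))))
    (fun i w => (hl i w).trans (Nat.pow_le_pow_right (by omega) (hlm i)))
  refine ⟨R ⊕ Σ i, K i, inferInstance, inferInstance, .inl a, p.link b P, T', hT', fun w => ?_⟩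
  obtain ⟨t, ht, hrun⟩ := H w
  refine ⟨t, ht, ?_⟩
  have := hrun.link (a := b) (P := P) hr
  simpa only [single, ← update_pad, show pad (R := R) (K := Σ i, K i) (fun _ => []) = fun _ => []
    from funext fun x => by cases x <;> rfl] using this

end StackProg

/-! ### Basic functions computed by programs -/

/-- The pairing function: `pr u v` is the code of `u` as a component of a tuple followed by `v`. -/
def pr (u v : Word) : Word := (u.flatMap fun b => [true, b]) ++ false :: v

/-- The inverse of the pairing function. -/
def unpr : Word → Word × Word
  | [] => ([], [])
  | false :: w => ([], w)
  | [true] => ([], [])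
  | true :: b :: w => (b :: (unpr w).1, (unpr w).2)

@[simp] theorem unpr_pr (u v : Word) : unpr (pr u v) = (u, v) := by
  induction u with
  | nil => simp [pr, unpr]
  | cons b u ih =>
    have : pr (b :: u) v = true :: b :: pr u v := by simp [pr]
    rw [this, unpr, ih]

theorem length_pr (u v : Word) : (pr u v).length = 2 * u.length + v.length + 1 := by
  simp [pr]; ring

theorem length_unpr (w : Word) : (unpr w).1.length ≤ w.length ∧ (unpr w).2.length ≤ w.length := by
  fun_induction unpr w <;> grind

/-- `f` iterated `|u|` times on `x` for `w = pr u (pr b x)`, with all values cut to length `|b|`. -/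
def boundedIter (f : Word → Word) (w : Word) : Word :=
  (fun x => (f x).take (unpr (unpr w).2).1.length)^[(unpr w).1.length] (unpr (unpr w).2).2

namespace StackProg

open Function (update)
open Prog

/-- The contents of five stacks. -/
def st (a b c d e : Word) : Fin 5 → Word := ![a, b, c, d, e]

section st

variable (a b c d e x : Word)

@[simp] theorem st_zero : st a b c d e 0 = a := rfl
@[simp] theorem st_one : st a b c d e 1 = b := rfl
@[simp] theorem st_two : st a b c d e 2 = c := rfl
@[simp] theorem st_three : st a b c d e 3 = d := rfl
@[simp] theorem st_four : st a b c d e 4 = e := rfl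

@[simp] theorem update_st_zero : update (st a b c d e) 0 x = st x b c d e := by
  funext i; fin_cases i <;> rfl
@[simp] theorem update_st_one : update (st a b c d e) 1 x = st a x c d e := by
  funext i; fin_cases i <;> rfl
@[simp] theorem update_st_two : update (st a b c d e) 2 x = st a b x d e := by
  funext i; fin_cases i <;> rfl
@[simp] theorem update_st_three : update (st a b c d e) 3 x = st a b c x e := by
  funext i; fin_cases i <;> rfl
@[simp] theorem update_st_four : update (st a b c d e) 4 x = st a b c d x := by
  funext i; fin_cases i <;> rfl

theorem single_zero_eq_st : single (0 : Fin 5) x = st x [] [] [] [] := by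
  funext i; fin_cases i <;> rfl

end st

/-- Programs on five stacks with calls of functions that are computed in polynomial time. -/
theorem PolyProg.of_st {ι : Type} [Fintype ι] [DecidableEq ι] {F : ι → Word → Word}
    (hF : ∀ i, PolyProg (F i)) (p : Prog ι (Fin 5)) (f : Word → Word)
    (h : ∀ c k, (∀ i w, c i w ≤ (w.length + 2) ^ k) → (∀ i w, (F i w).length ≤ (w.length + 2) ^ k) →
      ∃ T, PolyBdd T ∧
        ∀ w, Ends F c p (st w [] [] [] []) (st (f w) [] [] [] []) (T w.length)) :
    PolyProg f :=
  .of_prog hF 0 p f (by simpa only [single_zero_eq_st] using h)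

namespace PolyProg

variable {f g h : Word → Word}

theorem id : PolyProg fun w => w :=
  .of_st (F := noOracle) (fun i => i.elim) .skip _ fun _ _ _ _ => ⟨_, .const 1, fun _ => .skip⟩

theorem comp (hf : PolyProg f) (hg : PolyProg g) : PolyProg fun w => f (g w) :=
  .of_st (F := ![f, g]) (by simp [Fin.forall_fin_two, hf, hg]) (.seq (.call 1 0) (.call 0 0)) _
    fun c k hc hl => ⟨_, (PolyBdd.pow_add_two k).add ((PolyBdd.pow_add_two k).comp
      (.pow_add_two k)), fun w => by
        refine (Ends.call (by simp) (hc _ _)).seq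
          (.call (s := st (g w) [] [] [] []) (by simp) ((hc _ _).trans ?_))
        exact Nat.pow_le_pow_left (Nat.add_le_add_right (hl 1 w) _) _⟩

theorem nil : PolyProg fun _ => [] :=
  .of_st (F := noOracle) (fun i => i.elim) (clear 0) _ fun _ _ _ _ =>
    ⟨fun n => 2 * n + 1, ((PolyBdd.const 2).mul .id).add (.const 1),
      fun _ => ends_clear (by simp) (by simp)⟩

theorem cons (b : Bool) : PolyProg fun w => b :: w :=
  .of_st (F := noOracle) (fun i => i.elim) (.push 0 b) _ fun _ _ _ _ =>
    ⟨_, .const 1, fun _ => .push (by simp)⟩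

theorem tail : PolyProg fun w => w.tail :=
  .of_st (F := noOracle) (fun i => i.elim) (.pop 0 .skip .skip .skip) _ fun _ _ _ _ =>
    ⟨_, .const 2, fun w => by
      cases w with
      | nil => exact .popNil rfl .skip
      | cons b w => exact .popCons (bd := fun _ => .skip) rfl (Ends.skip.congr (by simp) rfl le_rfl)⟩

/-- `w` is mapped to `|w|` copies of `w`. -/
theorem square : PolyProg fun w => w.flatMap fun _ => w := by
  refine .of_st (F := noOracle) (fun i => i.elim) (.seq (copy 0 1 4) (.seq (loop 1 (copy 0 2 4)
    (copy 0 2 4)) (.seq (clear 0) (move 2 0 4)))) _ fun c _ _ _ =>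
    ⟨fun n => 5 * n + 2 + ((5 * n + 2 + 1) * n + 1 + (2 * n + 1 + (4 * (n * n) + 2))), ?_,
    fun w => ?_⟩
  · exact (((PolyBdd.const 5).mul .id).add (.const 2)).add ((((((PolyBdd.const 5).mul .id).add
      (.const 2)).add (.const 1)).mul .id |>.add (.const 1)).add ((((PolyBdd.const 2).mul .id).add
      (.const 1)).add (((PolyBdd.const 4).mul (PolyBdd.id.mul .id)).add (.const 2))))
  · have hfold : ∀ u a : Word, u.foldl (fun a _ => w ++ a) a = u.flatMap (fun _ => w) ++ a := by
      intro u
      induction u with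
      | nil => simp
      | cons b u ih =>
        intro a
        have hc : w ++ u.flatMap (fun _ => w) = u.flatMap (fun _ => w) ++ w := by
          clear ih
          induction u with
          | nil => simp
          | cons b u ih => rw [List.flatMap_cons, ih, List.append_assoc, ← List.append_assoc, ih,
              List.append_assoc]
        rw [List.foldl_cons, ih, List.flatMap_cons, hc, List.append_assoc]
    have h := Ends.loopFold (F := noOracle) (c := c) (r := (1 : Fin 5))
      (bd := fun _ => copy 0 2 4) (T := 5 * w.length + 2) (fun u a => st w u a [] [])
      (fun a _ => w ++ a) (fun _ => True) (by simp) (by simp)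
      (by
        intro b u a _
        exact ends_copy (by decide) (by decide) (by decide) (by simp) (by simp) (by simp))
      w [] trivial
    rw [hfold, List.append_nil] at h
    refine (ends_copy (by decide) (by decide) (by decide) (by simp) rfl (by simp)).seq
      (Ends.seq (h.congr (by simp) rfl le_rfl) ((ends_clear rfl (by simp)).seq
        (ends_move (by decide) (by decide) (by decide) (by simp) (by simp) ?_)))
    simp

theorem pair (hf : PolyProg f) (hg : PolyProg g) : PolyProg fun w => pr (f w) (g w) := by
  refine .of_st (F := ![f, g]) (by simp [Fin.forall_fin_two, hf, hg])
    (.seq (copy 0 1 4) (.seq (.call 0 0) (.seq (.call 1 1) (.seq (.push 1 false)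
      (.seq (moveRev 0 2) (.seq (loop 2 (.seq (.push 1 false) (.push 1 true))
        (.seq (.push 1 true) (.push 1 true))) (move 1 0 4))))))) _ fun c k hc hl =>
    ⟨fun n => 5 * n + 2 + ((n + 2) ^ k + ((n + 2) ^ k + (1 + ((2 * (n + 2) ^ k + 1) +
      ((2 + 1) * (n + 2) ^ k + 1 + (4 * (2 * (n + 2) ^ k + (n + 2) ^ k + 1) + 2)))))), ?_,
    fun w => ?_⟩
  · have hk := PolyBdd.pow_add_two k
    exact (((PolyBdd.const 5).mul .id).add (.const 2)).add (hk.add (hk.add ((PolyBdd.const 1).add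
      ((((PolyBdd.const 2).mul hk).add (.const 1)).add (((((PolyBdd.const (2 + 1)).mul hk).add
        (.const 1))).add (((PolyBdd.const 4).mul ((((PolyBdd.const 2).mul hk).add hk).add
          (.const 1))).add (.const 2)))))))
  · have hfold : ∀ u a : Word, u.reverse.foldl (fun a x => true :: x :: a) a =
        u.flatMap (fun b => [true, b]) ++ a := by
      intro u a
      rw [List.foldl_reverse]
      induction u with
      | nil => simp
      | cons b u ih => simp [ih]
    have h := Ends.loopFold (F := ![f, g]) (c := c) (r := (2 : Fin 5))
      (bd := fun b => .seq (.push 1 b) (.push 1 true)) (T := 2) (fun u a => st [] a u [] [])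
      (fun a x => true :: x :: a) (fun _ => True) (by simp) (by simp)
      (by
        intro b u a _
        exact (Ends.push rfl).seq (.push (by simp)))
      (f w).reverse (false :: g w) trivial
    rw [hfold] at h
    have h₀ := hl 0 w
    have h₁ := hl 1 w
    simp only [Matrix.cons_val_zero, Matrix.cons_val_one] at h₀ h₁
    refine (ends_copy (by decide) (by decide) (by decide) (by simp) rfl (by simp)).seq
      ((Ends.call rfl ((hc _ _).trans (by simp))).seq ((Ends.call rfl ((hc _ _).trans
        (by simp))).seq ((Ends.push rfl).seq ((ends_moveRev (by decide) rfl ?_).seq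
          ((h.congr (by simp) rfl ?_).seq (ends_move (by decide) (by decide) (by decide)
            (by simp) (by simp [pr]) ?_))))))
    · simpa using h₀
    · simpa using h₀
    · simp only [st_one, List.length_append, List.length_flatMap, List.length_cons]
      simp
      omega

/-- A program that splits a pair on the stack `0` into its second component on the stack `0` and
the reverse of its first component on the stack `1`. -/
def split : Prog Empty (Fin 5) :=
  .seq (.push 2 true) (.loop 2 .skip (.pop 0 .skip .skip (.pop 0 .skip
    (.seq (.push 1 false) (.push 2 true)) (.seq (.push 1 true) (.push 2 true)))))

theorem ends_split_loop {c : Empty → Word → ℕ} : ∀ w v : Word, Ends noOracle c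
    (.loop 2 .skip (.pop 0 .skip .skip (.pop 0 .skip
      (.seq (.push 1 false) (.push 2 true)) (.seq (.push 1 true) (.push 2 true)))))
    (st w v [true] [] []) (st (unpr w).2 ((unpr w).1.reverse ++ v) [] [] []) (5 * w.length + 5)
  | [], v => by
    obtain ⟨t, ht, h⟩ : Ends noOracle c (.pop (0 : Fin 5) .skip .skip (.pop 0 .skip
      (.seq (.push 1 false) (.push 2 true)) (.seq (.push 1 true) (.push 2 true))))
      (st [] v [] [] []) (st [] v [] [] []) 2 := .popNil rfl .skip
    refine ⟨_, ?_, .loopTrue rfl (by simpa [unpr] using h) (.loopNil rfl)⟩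
    grind
  | false :: w, v => by
    obtain ⟨t, ht, h⟩ : Ends noOracle c (.pop (0 : Fin 5) .skip .skip (.pop 0 .skip
      (.seq (.push 1 false) (.push 2 true)) (.seq (.push 1 true) (.push 2 true))))
      (st (false :: w) v [] [] []) (st w v [] [] []) 2 :=
      ⟨2, le_rfl, .popFalse rfl (by simpa using .skip _)⟩
    refine ⟨_, ?_, .loopTrue rfl (by simpa [unpr] using h) (.loopNil rfl)⟩
    grind
  | [true], v => by
    obtain ⟨t, ht, h⟩ : Ends noOracle c (.pop (0 : Fin 5) .skip .skip (.pop 0 .skip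
      (.seq (.push 1 false) (.push 2 true)) (.seq (.push 1 true) (.push 2 true))))
      (st [true] v [] [] []) (st [] v [] [] []) 3 :=
      ⟨3, le_rfl, .popTrue rfl (.popNil (by simp) (by simpa using .skip _))⟩
    refine ⟨_, ?_, .loopTrue rfl (by simpa [unpr] using h) (.loopNil rfl)⟩
    grind
  | true :: b :: w, v => by
    obtain ⟨t, ht, h⟩ : Ends noOracle c (.pop (0 : Fin 5) .skip .skip (.pop 0 .skip
      (.seq (.push 1 false) (.push 2 true)) (.seq (.push 1 true) (.push 2 true))))
      (st (true :: b :: w) v [] [] []) (st w (b :: v) [true] [] []) 4 := by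
      obtain ⟨t, ht, h⟩ := Ends.popCons (F := noOracle) (c := c) (r := (0 : Fin 5)) (pn := .skip)
        (bd := fun b => .seq (.push 1 b) (.push 2 true)) (s := st (b :: w) v [] [] []) (b := b)
        (w := w) (T := 2) (s' := st w (b :: v) [true] [] []) rfl
        ((Ends.push rfl).seq (.push (by simp)))
      exact ⟨t + 1, by omega, .popTrue rfl (by simpa using h)⟩
    obtain ⟨t', ht', h'⟩ := ends_split_loop (c := c) w (b :: v)
    refine ⟨_, ?_, .loopTrue rfl (by simpa using h) (by simpa [unpr] using h')⟩
    simp only [List.length_cons]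
    omega

theorem ends_split {c : Empty → Word → ℕ} (w : Word) : Ends noOracle c split
    (st w [] [] [] []) (st (unpr w).2 (unpr w).1.reverse [] [] []) (5 * w.length + 6) :=
  ((Ends.push rfl).seq ((ends_split_loop w []).congr (by simp) rfl le_rfl)).congr rfl (by simp)
    (by omega)

theorem fst : PolyProg fun w => (unpr w).1 := by
  refine .of_st (F := noOracle) (fun i => i.elim) (.seq split (.seq (clear 0) (moveRev 1 0))) _
    fun c _ _ _ => ⟨fun n => 5 * n + 6 + (2 * n + 1 + (2 * n + 1)), ?_, fun w => ?_⟩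
  · exact (((PolyBdd.const 5).mul .id).add (.const 6)).add ((((PolyBdd.const 2).mul .id).add
      (.const 1)).add (((PolyBdd.const 2).mul .id).add (.const 1)))
  · have := length_unpr w
    exact (ends_split w).seq ((ends_clear rfl (by simpa using this.2)).seq
      (ends_moveRev (by decide) (by simp) (by simpa using this.1)))

theorem snd : PolyProg fun w => (unpr w).2 := by
  refine .of_st (F := noOracle) (fun i => i.elim) (.seq split (clear 1)) _
    fun c _ _ _ => ⟨fun n => 5 * n + 6 + (2 * n + 1), ?_, fun w => ?_⟩
  · exact (((PolyBdd.const 5).mul .id).add (.const 6)).add (((PolyBdd.const 2).mul .id).add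
      (.const 1))
  · have := length_unpr w
    exact (ends_split w).seq (ends_clear (by simp) (by simpa using this.1))

end PolyProg

end StackProg

namespace StackProg

open Function (update)
open Prog

namespace PolyProg

variable {f g h : Word → Word}

/-- Case distinction on the first bit of a computed word. -/
theorem branch {c : Word → Word} (hc : PolyProg c) (hf : PolyProg f) (hg : PolyProg g)
    (hh : PolyProg h) : PolyProg fun w =>
      match c w with
      | [] => f w
      | false :: _ => g w
      | true :: _ => h w := by
  refine .of_st (F := ![c, f, g, h]) (by simp [Fin.forall_fin_succ, hf, hg, hh, hc])
    (.seq (copy 0 1 4) (.seq (.call 0 1) (.pop 1 (.call 1 0) (.seq (clear 1) (.call 2 0))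
      (.seq (clear 1) (.call 3 0))))) _ fun c' k hc hl =>
    ⟨fun n => 5 * n + 2 + ((n + 2) ^ k + (2 * (n + 2) ^ k + 1 + (n + 2) ^ k + 1)), ?_,
    fun w => ?_⟩
  · have hk := PolyBdd.pow_add_two k
    exact (((PolyBdd.const 5).mul .id).add (.const 2)).add (hk.add (((((PolyBdd.const 2).mul
      hk).add (.const 1)).add hk).add (.const 1)))
  · refine (ends_copy (by decide) (by decide) (by decide) (by simp) rfl (by simp)).seq
      ((Ends.call (s' := st w (c w) [] [] []) (by simp) ((hc _ _).trans (by simp))).seq ?_)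
    have h₀ := hl 0 w
    simp only [Matrix.cons_val_zero] at h₀
    cases hw : c w with
    | nil =>
      refine Ends.mono (.popNil (T := (w.length + 2) ^ k) rfl (.call (by simp)
        ((hc _ _).trans (by simp)))) (by omega)
    | cons b u =>
      rw [hw] at h₀
      simp only [List.length_cons] at h₀
      cases b
      · refine (Ends.popCons (bd := fun b => .seq (clear 1) (bif b then .call 3 0 else .call 2 0))
          rfl (.seq (ends_clear rfl (T := 2 * (w.length + 2) ^ k + 1) ?_)
            (.call (T := (w.length + 2) ^ k) ?_ ((hc _ _).trans ?_))))
        · simp; omega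
        · simp
        · simp
      · refine (Ends.popCons (bd := fun b => .seq (clear 1) (bif b then .call 3 0 else .call 2 0))
          rfl (.seq (ends_clear rfl (T := 2 * (w.length + 2) ^ k + 1) ?_)
            (.call (T := (w.length + 2) ^ k) ?_ ((hc _ _).trans ?_))))
        · simp; omega
        · simp
        · simp

/-- A program applying the oracle `3` to the stack `0` and cutting the result to the length of the
stack `2`. -/
def cutStep : Prog (Fin 4) (Fin 5) :=
  .seq (.call 3 0) (.seq (.loop 2
    (.seq (.pop 0 .skip (.push 3 false) (.push 3 true)) (.push 4 false))
    (.seq (.pop 0 .skip (.push 3 false) (.push 3 true)) (.push 4 true)))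
    (.seq (clear 0) (.seq (moveRev 3 0) (moveRev 4 2))))

theorem ends_cutStep {F : Fin 4 → Word → Word} {c : Fin 4 → Word → ℕ} (x u b : Word) {T T' : ℕ}
    (hT : c 3 x ≤ T) (hT' : (F 3 x).length ≤ T') :
    Ends F c cutStep (st x u b [] []) (st ((F 3 x).take b.length) u b [] [])
      (T + (9 * b.length + 2 * T' + 5)) := by
  have hfold : ∀ y a d e : Word, y.foldl (fun (p : Word × Word × Word) z =>
      (p.1.tail, (p.1.take 1) ++ p.2.1, z :: p.2.2)) (a, d, e) =
      (a.drop y.length, (a.take y.length).reverse ++ d, y.reverse ++ e) := by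
    intro y
    induction y with
    | nil => simp
    | cons z y ih =>
      intro a d e
      rw [List.foldl_cons, ih]
      cases a <;> simp
  have h := Ends.loopFold (F := F) (c := c) (r := (2 : Fin 5))
    (bd := fun b => .seq (.pop 0 .skip (.push 3 false) (.push 3 true)) (.push 4 b)) (T := 3)
    (fun y p => st p.1 u y p.2.1 p.2.2) (fun (p : Word × Word × Word) z =>
      (p.1.tail, (p.1.take 1) ++ p.2.1, z :: p.2.2)) (fun _ => True) (by simp) (by simp)
    (by
      rintro z y ⟨a, d, e⟩ _
      simp only [update_st_two]
      have : Ends F c (.pop 0 .skip (.push 3 false) (.push 3 true)) (st a u y d e)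
          (st a.tail u y (a.take 1 ++ d) e) 2 := by
        cases a with
        | nil => exact .popNil rfl .skip
        | cons b a => exact Ends.popCons (bd := fun b => .push 3 b) rfl (.push (by simp))
      exact this.seq (.push (by simp)))
    b (F 3 x, [], []) trivial
  rw [hfold] at h
  unfold cutStep
  refine ((Ends.call (s' := st (F 3 x) u b [] []) (by simp) (by simpa using hT)).seq
    (h.seq ((ends_clear (by simp; rfl) le_rfl).seq ((ends_moveRev (by decide) (by simp; rfl)
      le_rfl).seq (ends_moveRev (by decide) (by simp) le_rfl))))).mono ?_
  simp
  omega

theorem iter (hf : PolyProg f) : PolyProg (boundedIter f) := by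
  refine .of_st (F := ![fun w => (unpr w).1, fun w => (unpr (unpr w).2).1,
    fun w => (unpr (unpr w).2).2, f])
    (by
      simp only [Fin.forall_fin_succ, Fin.isValue, Matrix.cons_val_zero, Matrix.cons_val_succ,
        IsEmpty.forall_iff, and_true]
      exact ⟨fst, fst.comp snd, snd.comp snd, hf⟩)
    (.seq (copy 0 1 4) (.seq (copy 0 2 4) (.seq (.call 0 1) (.seq (.call 1 2) (.seq (.call 2 0)
      (.seq (.loop 1 cutStep cutStep) (clear 2))))))) _ fun c k hc hl =>
    ⟨fun n => 5 * n + 2 + (5 * n + 2 + ((n + 2) ^ k + ((n + 2) ^ k + ((n + 2) ^ k +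
      (((n + 2) ^ k + (9 * n + 2 * (n + 2) ^ k + 5) + 1) * n + 1 + (2 * n + 1)))))), ?_,
    fun w => ?_⟩
  · have hk := PolyBdd.pow_add_two k
    have h5 := ((PolyBdd.const 5).mul .id).add (.const 2)
    exact h5.add (h5.add (hk.add (hk.add (hk.add (((((hk.add ((((PolyBdd.const 9).mul .id).add
      ((PolyBdd.const 2).mul hk)).add (.const 5))).add (.const 1)).mul .id).add (.const 1)).add
        (((PolyBdd.const 2).mul .id).add (.const 1)))))))
  · set u := (unpr w).1 with hu
    set b := (unpr (unpr w).2).1 with hb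
    set x := (unpr (unpr w).2).2 with hx
    have hul : u.length ≤ w.length := (length_unpr w).1
    have hbl : b.length ≤ w.length := (length_unpr _).1.trans (length_unpr w).2
    have hxl : x.length ≤ w.length := (length_unpr _).2.trans (length_unpr w).2
    have hfold : ∀ (v : Word) (y : Word),
        v.foldl (fun y _ => (f y).take b.length) y =
          (fun y => (f y).take b.length)^[v.length] y := by
      intro v
      induction v with
      | nil => simp
      | cons z v ih => intro y; rw [List.foldl_cons, ih]; rfl
    have h := Ends.loopFold (F := ![fun w => (unpr w).1, fun w => (unpr (unpr w).2).1,
      fun w => (unpr (unpr w).2).2, f]) (c := c) (r := (1 : Fin 5)) (bd := fun _ => cutStep)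
      (T := (w.length + 2) ^ k + (9 * w.length + 2 * (w.length + 2) ^ k + 5))
      (fun v y => st y v b [] []) (fun y _ => (f y).take b.length)
      (fun y => y.length ≤ w.length) (by simp)
      (by intro a _ _; exact (List.length_take_le _ _).trans hbl)
      (by
        intro z v y hy
        have hp : (y.length + 2) ^ k ≤ (w.length + 2) ^ k := Nat.pow_le_pow_left (by omega) _
        refine (ends_cutStep y v b ((hc _ _).trans hp) ((hl _ _).trans hp)).congr (by simp) rfl ?_
        omega)
      u x hxl
    rw [hfold] at h
    refine (ends_copy (by decide) (by decide) (by decide) (by simp) rfl (by simp)).seq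
      ((ends_copy (by decide) (by decide) (by decide) (by simp) rfl (by simp)).seq
        ((Ends.call rfl ((hc _ _).trans (by simp))).seq ((Ends.call rfl ((hc _ _).trans
          (by simp))).seq ((Ends.call (s' := st x u b [] []) (by simp [hx, hu, hb])
            ((hc _ _).trans (by simp))).seq ((h.mono ?_).seq (ends_clear ?_ ?_))))))
    · exact Nat.add_le_add_right (Nat.mul_le_mul_left _ hul) _
    · simp [boundedIter, hx, hu, hb]
    · simpa using hbl

/-- A function computed by a program in polynomial time is computed by a stack machine in
polynomial time. -/
theorem polyTimeComputable {F : Word → Word} (hF : PolyProg F) {α β : Type} {ea : α → Word}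
    {eb : β → Word} {f : α → β} (hf : ∀ a, F (ea a) = eb (f a)) : PolyTimeComputable ea eb f := by
  obtain ⟨K, _, _, r, p, T, ⟨k, hk⟩, h⟩ := hF
  have := finite_lbl p
  have := Fintype.ofFinite (Lbl p)
  let M : Option (Lbl p) → Turing.TM2.Stmt (fun _ : K => Bool) (Option (Lbl p)) (Option Bool) :=
    fun l => match l with
      | none => .load (fun _ => none) .halt
      | some l => code p some none l
  choose t ht hr using h
  choose v hv using fun w => (hr w).compile M some none (fun _ => rfl) none
  refine ⟨{
    tm := { K := K, k₀ := r, k₁ := r, Γ := fun _ => Bool, Λ := Option (Lbl p),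
            main := some (entry p), σ := Option Bool, initialState := none, m := M }
    inputAlphabet := Equiv.refl _
    outputAlphabet := Equiv.refl _
    time := (Polynomial.X + 2) ^ k + 1
    outputsFun := fun a =>
      { steps := t (ea a) + 1
        evals_in_steps := ?_
        steps_le_m := ?_ } }, fun _ => Finite.of_fintype Bool⟩
  · have h₁ : ∀ w : Word, single r w = fun k : K => if h : k = r then w else [] := by
      intro w
      funext k
      by_cases hk : k = r
      · subst hk; simp [single]
      · simp [single, hk]
    have h₂ := hv (ea a)
    rw [hf, h₁, h₁] at h₂
    simp only [Function.iterate_succ_apply', Equiv.invFun_as_coe, Equiv.refl_symm, Equiv.coe_refl,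
      List.map_id]
    refine (congrArg (flip bind (Turing.TM2.step M)) h₂).trans ?_
    simp only [flip, Option.bind_eq_bind, Option.bind_some, Turing.TM2.step, Turing.TM2.stepAux, M]
    rfl
  · have := (ht (ea a)).trans (hk _)
    simpa using this

end PolyProg

end StackProg

/-! ### An algebra of polynomial-time functions on words -/

/-- The functions obtained from a few basic ones by composition, pairing, case distinction and
length-bounded iteration. -/
inductive FP : (Word → Word) → Prop
  | id : FP fun w => w
  | comp {f g} : FP f → FP g → FP fun w => f (g w)
  | nil : FP fun _ => []
  | cons (b) : FP fun w => b :: w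
  | tail : FP fun w => w.tail
  | fst : FP fun w => (unpr w).1
  | snd : FP fun w => (unpr w).2
  | pair {f g} : FP f → FP g → FP fun w => pr (f w) (g w)
  | branch {c f g h} : FP c → FP f → FP g → FP h → FP fun w =>
      match c w with
      | [] => f w
      | false :: _ => g w
      | true :: _ => h w
  | square : FP fun w => w.flatMap fun _ => w
  | iter {f} : FP f → FP (boundedIter f)

namespace FP

variable {f : Word → Word}

theorem polyProg (hf : FP f) : StackProg.PolyProg f := by
  induction hf with
  | id => exact .id
  | comp _ _ h₁ h₂ => exact h₁.comp h₂
  | nil => exact .nil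
  | cons b => exact .cons b
  | tail => exact .tail
  | fst => exact .fst
  | snd => exact .snd
  | pair _ _ h₁ h₂ => exact h₁.pair h₂
  | branch _ _ _ _ h₁ h₂ h₃ h₄ => exact h₁.branch h₂ h₃ h₄
  | square => exact .square
  | iter _ h => exact h.iter

theorem length_le (hf : FP f) : ∃ k, ∀ w, (f w).length ≤ (w.length + 2) ^ k :=
  hf.polyProg.length_le

theorem polyTimeComputable (hF : FP f) {α β : Type} {ea : α → Word} {eb : β → Word} {g : α → β}
    (hf : ∀ a, f (ea a) = eb (g a)) : PolyTimeComputable ea eb g :=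
  hF.polyProg.polyTimeComputable hf

end FP

theorem primrec_pr : Primrec₂ pr := by
  have h : Primrec₂ fun u v : Word => (u.flatMap fun b => [true, b]) ++ false :: v :=
    Primrec.list_append.comp
      (Primrec.list_flatMap (g := fun _ b => [true, b]) Primrec.fst
        (Primrec.list_cons.comp (Primrec.const true)
          (Primrec.list_cons.comp Primrec.snd (Primrec.const []))).to₂)
      (Primrec.list_cons.comp (Primrec.const false) Primrec.snd)
  exact h

/-- The split of a pair in the middle of a block. -/
def unprBit : Word → Word × Word
  | [] => ([], [])
  | b :: w => (b :: (unpr w).1, (unpr w).2)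

theorem primrec_unpr : Primrec unpr := by
  let F : Bool × ((Word × Word) × (Word × Word) × Word) → ((Word × Word) × (Word × Word) × Word) :=
    fun p => (bif p.1 then p.2.2.1 else ([], p.2.2.2), (p.1 :: p.2.1.1, p.2.1.2), p.1 :: p.2.2.2)
  have hF : Primrec F := by
    have h₁ : Primrec fun p : Bool × ((Word × Word) × (Word × Word) × Word) => p.1 := Primrec.fst
    have h₂ : Primrec fun p : Bool × ((Word × Word) × (Word × Word) × Word) => p.2 := Primrec.snd
    exact (Primrec.cond h₁ (Primrec.fst.comp (Primrec.snd.comp h₂)) ((Primrec.const []).pair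
      (Primrec.snd.comp (Primrec.snd.comp h₂)))).pair (((Primrec.list_cons.comp h₁
        (Primrec.fst.comp (Primrec.fst.comp h₂))).pair (Primrec.snd.comp
          (Primrec.fst.comp h₂))).pair
            (Primrec.list_cons.comp h₁ (Primrec.snd.comp (Primrec.snd.comp h₂))))
  have h := Primrec.list_foldr (f := fun w : Word => w) (g := fun _ => (([], []), ([], []), []))
    (h := fun _ => F) Primrec.id (Primrec.const _) (hF.comp Primrec.snd).to₂
  refine (Primrec.fst.comp h).of_eq fun w => ?_
  suffices w.foldr (fun b s => F (b, s)) (([], []), ([], []), []) = (unpr w, unprBit w, w) by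
    rw [this]
  induction w with
  | nil => simp [unpr, unprBit]
  | cons b w ih =>
    rw [List.foldr_cons, ih]
    cases b
    · simp [F, unpr, unprBit]
    · cases w <;> simp [F, unpr, unprBit]

theorem FP.primrec {f : Word → Word} (hf : FP f) : Primrec f := by
  induction hf with
  | id => exact Primrec.id
  | comp _ _ h₁ h₂ => exact h₁.comp h₂
  | nil => exact Primrec.const _
  | cons b => exact Primrec.list_cons.comp (Primrec.const b) Primrec.id
  | tail => exact Primrec.list_tail
  | fst => exact Primrec.fst.comp primrec_unpr
  | snd => exact Primrec.snd.comp primrec_unpr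
  | pair _ _ h₁ h₂ => exact primrec_pr.comp h₁ h₂
  | @branch c f g h _ _ _ _ h₁ h₂ h₃ h₄ =>
    refine (Primrec.list_casesOn (h := fun w p => bif p.1 then h w else g w) h₁ h₂
      (Primrec.cond (Primrec.fst.comp Primrec.snd) (h₄.comp Primrec.fst)
        (h₃.comp Primrec.fst)).to₂).of_eq fun w => ?_
    rcases c w with _ | ⟨_ | _, u⟩ <;> rfl
  | square => exact Primrec.list_flatMap Primrec.id Primrec.fst.to₂
  | @iter f _ h =>
    have h₁ : Primrec fun w => (unpr (unpr w).2).1.length := Primrec.list_length.comp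
      (Primrec.fst.comp (primrec_unpr.comp (Primrec.snd.comp primrec_unpr)))
    exact Primrec.nat_iterate (Primrec.list_length.comp (Primrec.fst.comp primrec_unpr))
      (Primrec.snd.comp (primrec_unpr.comp (Primrec.snd.comp primrec_unpr)))
      (Primrec.list_take.comp (h₁.comp Primrec.fst) (h.comp Primrec.snd)).to₂

/-! ### Polynomial-time functions between encoded types -/

/-- Types whose elements are coded by words. -/
class Enc (α : Type) where
  /-- The code of an element. -/
  enc : α → Word

open Enc (enc)

instance : Enc Word := ⟨fun w => w⟩

instance : Enc ℕ := ⟨fun n => List.replicate n true⟩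

instance {α β : Type} [Enc α] [Enc β] : Enc (α × β) := ⟨fun p => pr (enc p.1) (enc p.2)⟩

instance {α : Type} [Enc α] : Enc (List α) := ⟨fun l => l.foldr (fun a w => pr (enc a) w) []⟩

section

variable {α β : Type} [Enc α] [Enc β]

theorem enc_word (w : Word) : enc w = w := rfl

theorem enc_nat (n : ℕ) : enc n = List.replicate n true := rfl

@[simp] theorem length_enc_nat (n : ℕ) : (enc n).length = n := by simp [enc_nat]

theorem enc_prod (p : α × β) : enc p = pr (enc p.1) (enc p.2) := rfl

@[simp] theorem length_enc_prod (a : α) (b : β) :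
    (enc (a, b)).length = 2 * (enc a).length + (enc b).length + 1 := length_pr _ _

@[simp] theorem enc_nil : enc ([] : List α) = [] := rfl

theorem enc_cons (a : α) (l : List α) : enc (a :: l) = pr (enc a) (enc l) := rfl

@[simp] theorem length_enc_nil : (enc ([] : List α)).length = 0 := rfl

@[simp] theorem length_enc_cons (a : α) (l : List α) :
    (enc (a :: l)).length = 2 * (enc a).length + (enc l).length + 1 := length_pr _ _

theorem length_enc_list (l : List α) :
    (enc l).length = (l.map fun a => 2 * (enc a).length + 1).sum := by
  induction l with
  | nil => rfl
  | cons a l ih => simp [ih]; ring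

theorem length_le_length_enc (l : List α) : l.length ≤ (enc l).length := by
  induction l with
  | nil => simp
  | cons a l ih => simp; omega

theorem length_enc_le_of_mem {a : α} {l : List α} (h : a ∈ l) :
    (enc a).length ≤ (enc l).length := by
  induction l with
  | nil => simp at h
  | cons b l ih =>
    rcases List.mem_cons.1 h with rfl | h
    · simp; omega
    · have := ih h; simp; omega

theorem length_enc_append (l l' : List α) :
    (enc (l ++ l')).length = (enc l).length + (enc l').length := by
  simp [length_enc_list]

theorem length_enc_le_of_sublist {l l' : List α} (h : l.Sublist l') :
    (enc l).length ≤ (enc l').length := by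
  induction h with
  | slnil => simp
  | cons a _ ih => simp; omega
  | cons_cons a _ ih => simp; omega

theorem length_enc_reverse (l : List α) : (enc l.reverse).length = (enc l).length := by
  simp [length_enc_list]

theorem length_enc_le_mul {l : List α} {m : ℕ} (h : ∀ a ∈ l, (enc a).length ≤ m) :
    (enc l).length ≤ l.length * (2 * m + 1) := by
  induction l with
  | nil => simp
  | cons a l ih =>
    have := ih fun b hb => h b (List.mem_cons_of_mem _ hb)
    have := h a List.mem_cons_self
    simp only [length_enc_cons, List.length_cons, add_one_mul l.length]
    omega

theorem tupleCode_eq_enc (ys : List Word) : tupleCode ys = enc ys := by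
  induction ys with
  | nil => rfl
  | cons y ys ih =>
    rw [enc_cons, ← ih]
    simp [tupleCode, pr, enc_word]

end

/-- Polynomial-time functions with respect to the codings. -/
def PT {α β : Type} [Enc α] [Enc β] (f : α → β) : Prop :=
  ∃ F, FP F ∧ ∀ a, F (enc a) = enc (f a)

/-- Predicates decidable in polynomial time with respect to the coding. -/
def PTB {α : Type} [Enc α] (c : α → Bool) : Prop := PT fun a => ([c a] : Word)

theorem FP.const : ∀ w, FP fun _ => w
  | [] => .nil
  | b :: w => .comp (.cons b) (FP.const w)

/-- The length of a word in unary. -/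
theorem FP.ones : FP fun w => List.replicate w.length true := by
  have h : FP fun w => boundedIter (fun w => true :: w) (pr w (pr w [])) :=
    .comp (.iter (.cons true)) (.pair .id (.pair .id .nil))
  convert h using 2 with w
  simp only [boundedIter, unpr_pr]
  have : ∀ i ≤ w.length, (fun x : Word => (true :: x).take w.length)^[i] [] =
      List.replicate i true := by
    intro i
    induction i with
    | zero => simp
    | succ i ih =>
      intro hi
      rw [Function.iterate_succ_apply', ih (by omega), ← List.replicate_succ,
        List.take_of_length_le (by simpa using hi)]
  exact (this _ le_rfl).symm

theorem FP.exists_long (k : ℕ) : ∃ B, FP B ∧ ∀ w, (w.length + 2) ^ k ≤ (B w).length := by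
  suffices ∃ B, FP B ∧ ∀ w, (w.length + 2) ^ 2 ^ k ≤ (B w).length by
    obtain ⟨B, h, hB⟩ := this
    exact ⟨B, h, fun w => (Nat.pow_le_pow_right (by omega) Nat.lt_two_pow_self.le).trans (hB w)⟩
  induction k with
  | zero => exact ⟨_, .comp (.cons true) (.cons true), by simp⟩
  | succ k ih =>
    obtain ⟨B, h, hB⟩ := ih
    refine ⟨_, .comp .square h, fun w => ?_⟩
    rw [pow_succ, pow_mul, pow_two]
    simpa using Nat.mul_le_mul (hB w) (hB w)

namespace PT

variable {α β γ σ : Type} [Enc α] [Enc β] [Enc γ] [Enc σ]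

theorem length_le {f : α → β} (hf : PT f) :
    ∃ k, ∀ a, (enc (f a)).length ≤ ((enc a).length + 2) ^ k := by
  obtain ⟨F, hF, h⟩ := hf
  obtain ⟨k, hk⟩ := hF.length_le
  exact ⟨k, fun a => h a ▸ hk _⟩

theorem id : PT fun a : α => a := ⟨_, .id, fun _ => rfl⟩

theorem comp {f : β → γ} {g : α → β} (hf : PT f) (hg : PT g) : PT fun a => f (g a) := by
  obtain ⟨F, hF, hf⟩ := hf
  obtain ⟨G, hG, hg⟩ := hg
  exact ⟨_, .comp hF hG, fun a => by rw [hg, hf]⟩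

theorem congr {f g : α → β} (hf : PT f) (h : ∀ a, f a = g a) : PT g := funext h ▸ hf

theorem const (b : β) : PT fun _ : α => b := ⟨_, .const (enc b), fun _ => rfl⟩

theorem pair {f : α → β} {g : α → γ} (hf : PT f) (hg : PT g) : PT fun a => (f a, g a) := by
  obtain ⟨F, hF, hf⟩ := hf
  obtain ⟨G, hG, hg⟩ := hg
  exact ⟨_, .pair hF hG, fun a => by rw [hg, hf]; rfl⟩

theorem fst : PT fun p : α × β => p.1 := ⟨_, .fst, fun p => by rw [enc_prod, unpr_pr]⟩

theorem snd : PT fun p : α × β => p.2 := ⟨_, .snd, fun p => by rw [enc_prod, unpr_pr]⟩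

theorem fst' {f : α → β × γ} (hf : PT f) : PT fun a => (f a).1 := fst.comp hf

theorem snd' {f : α → β × γ} (hf : PT f) : PT fun a => (f a).2 := snd.comp hf

theorem cond {c : α → Bool} {f g : α → β} (hc : PTB c) (hf : PT f) (hg : PT g) :
    PT fun a => bif c a then f a else g a := by
  obtain ⟨C, hC, hc⟩ := hc
  obtain ⟨F, hF, hf⟩ := hf
  obtain ⟨G, hG, hg⟩ := hg
  refine ⟨_, .branch hC hC hG hF, fun a => ?_⟩
  rw [hc]
  cases h : c a
  · simpa [enc_word, h] using hg a
  · simpa [enc_word, h] using hf a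

/-- Case distinction on a list. -/
theorem listCases {l : α → List β} {g : α → σ} {h : α × β × List β → σ} (hl : PT l) (hg : PT g)
    (hh : PT h) : PT fun a =>
      match l a with
      | [] => g a
      | b :: t => h (a, b, t) := by
  obtain ⟨L, hL, hl⟩ := hl
  obtain ⟨G, hG, hg⟩ := hg
  obtain ⟨H, hH, hh⟩ := hh
  refine ⟨_, .branch hL hG (.comp hH (.pair .id hL)) (.comp hH (.pair .id hL)), fun a => ?_⟩
  simp only [hl]
  generalize l a = x
  cases x with
  | nil => exact hg a
  | cons b t =>
    have : H (pr (enc a) (enc (b :: t))) = enc (h (a, b, t)) := hh (a, b, t)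
    rcases henc : enc (b :: t) with _ | ⟨_ | _, _⟩
    · have := length_enc_cons b t
      rw [henc] at this
      simp at this
    · rw [henc] at this
      exact this
    · rw [henc] at this
      exact this

/-- Case distinction on a word. -/
theorem wordCases {l : α → Word} {f g h : α → σ} (hl : PT l) (hf : PT f)
    (hg : PT g) (hh : PT h) : PT fun a =>
      match l a with
      | [] => f a
      | false :: _ => g a
      | true :: _ => h a := by
  obtain ⟨L, hL, hl⟩ := hl
  obtain ⟨F, hF, hf⟩ := hf
  obtain ⟨G, hG, hg⟩ := hg
  obtain ⟨H, hH, hh⟩ := hh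
  refine ⟨_, .branch hL hF hG hH, fun a => ?_⟩
  rw [hl, enc_word]
  beta_reduce
  generalize l a = x
  rcases x with _ | ⟨_ | _, _⟩
  · exact hf a
  · exact hg a
  · exact hh a

theorem wordCons (b : Bool) {f : α → Word} (hf : PT f) : PT fun a => b :: f a := by
  obtain ⟨F, hF, hf⟩ := hf
  exact ⟨_, .comp (.cons b) hF, fun a => by rw [hf]; rfl⟩

theorem wordConsB {c : α → Bool} {f : α → Word} (hc : PTB c) (hf : PT f) :
    PT fun a => c a :: f a :=
  (cond hc (wordCons true hf) (wordCons false hf)).congr fun a => by cases c a <;> rfl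

theorem wordTail {f : α → Word} (hf : PT f) : PT fun a => (f a).tail := by
  obtain ⟨F, hF, hf⟩ := hf
  exact ⟨_, .comp .tail hF, fun a => by rw [hf]; rfl⟩

theorem cons {f : α → β} {g : α → List β} (hf : PT f) (hg : PT g) : PT fun a => f a :: g a := by
  obtain ⟨F, hF, h⟩ := hf.pair hg
  exact ⟨F, hF, h⟩

theorem listTail {f : α → List β} (hf : PT f) : PT fun a => (f a).tail :=
  (listCases hf (const []) (snd' (snd' id))).congr fun a => by cases f a <;> rfl

theorem succ {f : α → ℕ} (hf : PT f) : PT fun a => f a + 1 := by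
  obtain ⟨F, hF, hf⟩ := hf
  exact ⟨_, .comp (.cons true) hF, fun a => by rw [hf]; rfl⟩

theorem pred {f : α → ℕ} (hf : PT f) : PT fun a => f a - 1 := by
  obtain ⟨F, hF, hf⟩ := hf
  exact ⟨_, .comp .tail hF, fun a => by rw [hf]; simp [enc_nat]⟩

/-- The length of the code. -/
theorem size {f : α → β} (hf : PT f) : PT fun a => (enc (f a)).length := by
  obtain ⟨F, hF, hf⟩ := hf
  exact ⟨_, .comp .ones hF, fun a => by rw [hf]; rfl⟩

theorem iterate {n : α → ℕ} {init : α → σ} {step : α → σ → σ} (hn : PT n) (hi : PT init)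
    (hs : PT fun p : α × σ => step p.1 p.2)
    (hb : ∃ T, PolyBdd T ∧
      ∀ a, ∀ i ≤ n a, (enc ((step a)^[i] (init a))).length ≤ T (enc a).length) :
    PT fun a => (step a)^[n a] (init a) := by
  obtain ⟨T, hT, hb⟩ := hb
  obtain ⟨N, hN, hn⟩ := hn
  obtain ⟨I, hI, hi⟩ := hi
  obtain ⟨S, hS, hs⟩ := hs
  obtain ⟨k, hk⟩ := (((PolyBdd.const 2).mul .id).add hT).add (.const 1)
  obtain ⟨B, hB, hBk⟩ := FP.exists_long k
  refine ⟨_, .comp .snd (.comp (.iter (.pair .fst hS)) (.pair hN (.pair hB (.pair .id hI)))),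
    fun a => ?_⟩
  simp only [boundedIter, unpr_pr]
  have key : ∀ i ≤ n a, (fun x => (pr (unpr x).1 (S x)).take (B (enc a)).length)^[i]
      (pr (enc a) (I (enc a))) = enc (a, (step a)^[i] (init a)) := by
    intro i
    induction i with
    | zero => intro _; rw [hi]; rfl
    | succ i ih =>
      intro h
      rw [Function.iterate_succ_apply', ih (by omega), hs, enc_prod, unpr_pr]
      simp only
      rw [← Function.iterate_succ_apply' (step a), List.take_of_length_le]
      · rfl
      · rw [length_pr]
        refine le_trans ?_ ((hk _).trans (hBk _))
        have := hb a (i + 1) h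
        simp only [Nat.succ_eq_add_one] at this ⊢
        omega
  rw [hn, length_enc_nat, key _ le_rfl, enc_prod, unpr_pr]

end PT

namespace PT

variable {α β γ σ : Type} [Enc α] [Enc β] [Enc γ] [Enc σ]

/-! #### Lists -/

theorem foldl {l : α → List β} {init : α → σ} {f : α → σ → β → σ} (hl : PT l) (hi : PT init)
    (hf : PT fun p : α × σ × β => f p.1 p.2.1 p.2.2)
    (hb : ∃ T, PolyBdd T ∧ ∀ a i,
      (enc (((l a).take i).foldl (f a) (init a))).length ≤ T (enc a).length) :
    PT fun a => (l a).foldl (f a) (init a) := by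
  obtain ⟨T, hT, hb⟩ := hb
  obtain ⟨k, hk⟩ := hl.length_le
  let step : α → List β × σ → List β × σ := fun a p =>
    match p.1 with
    | [] => p
    | b :: t => (t, f a p.2 b)
  have hs : PT fun p : α × List β × σ => step p.1 p.2 := by
    have h : PT fun q : (α × List β × σ) × β × List β => (q.2.2, f q.1.1 q.1.2.2 q.2.1) :=
      pair (snd' (snd' id)) (hf.comp (pair (fst' (fst' id)) (pair (snd' (snd' (fst' id)))
        (fst' (snd' id)))))
    refine (listCases (fst' (snd' id)) (snd' id) h).congr fun p => ?_
    obtain ⟨a, _ | _, s⟩ := p <;> rfl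
  have key : ∀ a i, (step a)^[i] (l a, init a) =
      ((l a).drop i, ((l a).take i).foldl (f a) (init a)) := by
    intro a i
    induction i with
    | zero => simp
    | succ i ih =>
      rw [Function.iterate_succ_apply', ih]
      simp only [step]
      cases h : (l a).drop i with
      | nil =>
        have := List.drop_eq_nil_iff.1 h
        rw [List.drop_of_length_le (by omega), List.take_of_length_le (by omega),
          List.take_of_length_le (by omega)]
      | cons b t =>
        have hi : i < (l a).length := by
          by_contra hc
          rw [List.drop_of_length_le (by omega)] at h
          simp at h
        rw [List.drop_eq_getElem_cons hi] at h
        obtain ⟨rfl, rfl⟩ := List.cons.inj h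
        rw [List.take_succ_eq_append_getElem hi, List.foldl_append]
        rfl
  have hit := iterate (n := fun a => (enc (l a)).length) (init := fun a => (l a, init a))
    (step := step) hl.size (hl.pair hi) hs
    ⟨fun n => 2 * (n + 2) ^ k + T n + 1, (((PolyBdd.const 2).mul (.pow_add_two k)).add hT).add
      (.const 1), fun a i _ => by
        rw [key, length_enc_prod]
        have h₁ := length_enc_le_of_sublist (List.drop_sublist i (l a))
        have h₂ := hk a
        have h₃ := hb a i
        beta_reduce
        omega⟩
  refine hit.snd'.congr fun a => ?_
  rw [key, List.take_of_length_le (length_le_length_enc _)]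

theorem reverse {l : α → List β} (hl : PT l) : PT fun a => (l a).reverse := by
  obtain ⟨k, hk⟩ := hl.length_le
  have hr : ∀ l : List β, l.foldl (fun s b => b :: s) [] = l.reverse := by simp
  refine (foldl (f := fun _ s b => b :: s) hl (const []) (cons (snd' (snd' id))
    (fst' (snd' id))) ⟨_, .pow_add_two k, fun a i => ?_⟩).congr fun a => hr _
  rw [hr, length_enc_reverse]
  exact (length_enc_le_of_sublist (List.take_sublist _ _)).trans (hk a)

theorem foldr {l : α → List β} {init : α → σ} {f : α → β → σ → σ} (hl : PT l) (hi : PT init)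
    (hf : PT fun p : α × β × σ => f p.1 p.2.1 p.2.2)
    (hb : ∃ T, PolyBdd T ∧ ∀ a (t : List β), t.Sublist (l a) →
      (enc (t.foldr (f a) (init a))).length ≤ T (enc a).length) :
    PT fun a => (l a).foldr (f a) (init a) := by
  obtain ⟨T, hT, hb⟩ := hb
  refine (foldl (f := fun a s b => f a b s) hl.reverse hi
    (hf.comp (pair (fst' id) (pair (snd' (snd' id)) (fst' (snd' id)))))
    ⟨T, hT, fun a i => ?_⟩).congr fun a => List.foldl_reverse
  rw [List.take_reverse, List.foldl_reverse]
  exact hb a _ (List.drop_sublist _ _)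

/-- A bound for the codes of the values of a function at the elements of a list. -/
theorem length_le_list {l : α → List β} {f : α → β → γ} (hl : PT l)
    (hf : PT fun p : α × β => f p.1 p.2) :
    ∃ T, PolyBdd T ∧ ∀ a, (l a).length ≤ T (enc a).length ∧
      ∀ b ∈ l a, (enc (f a b)).length ≤ T (enc a).length := by
  obtain ⟨k, hk⟩ := hl.length_le
  obtain ⟨m, hm⟩ := hf.length_le
  refine ⟨fun n => (n + 2) ^ k + (2 * n + (n + 2) ^ k + 1 + 2) ^ m, (PolyBdd.pow_add_two k).add
    ((PolyBdd.pow_add_two m).comp ((((PolyBdd.const 2).mul .id).add (.pow_add_two k)).add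
      (.const 1))), fun a => ⟨?_, fun b hb => ?_⟩⟩
  · have := length_le_length_enc (l a)
    have := hk a
    beta_reduce
    omega
  · refine (hm (a, b)).trans (le_trans (Nat.pow_le_pow_left ?_ _) (Nat.le_add_left _ _))
    rw [length_enc_prod]
    have := (length_enc_le_of_mem hb).trans (hk a)
    omega

theorem map {l : α → List β} {f : α → β → γ} (hl : PT l) (hf : PT fun p : α × β => f p.1 p.2) :
    PT fun a => (l a).map (f a) := by
  obtain ⟨T, hT, hb⟩ := length_le_list hl hf
  have hr : ∀ a (l : List β), l.foldr (fun b s => f a b :: s) [] = l.map (f a) := by simp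
  refine (foldr (f := fun a b s => f a b :: s) hl (const [])
    (cons (hf.comp (pair (fst' id) (fst' (snd' id)))) (snd' (snd' id)))
    ⟨_, hT.mul (((PolyBdd.const 2).mul hT).add (.const 1)), fun a t ht => ?_⟩).congr
    fun a => hr a _
  rw [hr]
  refine (length_enc_le_mul (m := T (enc a).length) ?_).trans ?_
  · intro c hc
    obtain ⟨b, hbt, rfl⟩ := List.mem_map.1 hc
    exact (hb a).2 b (ht.subset hbt)
  · rw [List.length_map]
    exact Nat.mul_le_mul_right _ (ht.length_le.trans (hb a).1)

theorem filter {l : α → List β} {c : α → β → Bool} (hl : PT l)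
    (hc : PTB fun p : α × β => c p.1 p.2) : PT fun a => (l a).filter (c a) := by
  obtain ⟨k, hk⟩ := hl.length_le
  have hr : ∀ a (l : List β), l.foldr (fun b s => bif c a b then b :: s else s) [] =
      l.filter (c a) := by
    intro a l
    induction l with
    | nil => rfl
    | cons b l ih => rw [List.foldr_cons, ih]; cases h : c a b <;> simp [h]
  refine (foldr (f := fun a b s => bif c a b then b :: s else s) hl (const [])
    (cond (hc.comp (pair (fst' id) (fst' (snd' id)))) (cons (fst' (snd' id)) (snd' (snd' id)))
      (snd' (snd' id))) ⟨_, .pow_add_two k, fun a t ht => ?_⟩).congr fun a => hr a _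
  rw [hr]
  exact (length_enc_le_of_sublist (List.filter_sublist.trans ht)).trans (hk a)

/-- The word of the values of a predicate at the elements of a list. -/
theorem wordMap {l : α → List β} {c : α → β → Bool} (hl : PT l)
    (hc : PTB fun p : α × β => c p.1 p.2) : PT fun a => ((l a).map (c a) : Word) := by
  obtain ⟨k, hk⟩ := hl.length_le
  have hr : ∀ a (l : List β), l.foldr (fun b s => c a b :: s) ([] : Word) = l.map (c a) := by simp
  refine (foldr (f := fun a b (s : Word) => c a b :: s) hl (const ([] : Word))
    (wordConsB (hc.comp (pair (fst' id) (fst' (snd' id)))) (snd' (snd' id)))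
    ⟨_, .pow_add_two k, fun a t ht => ?_⟩).congr fun a => hr a _
  rw [hr, enc_word, List.length_map]
  exact ht.length_le.trans ((length_le_length_enc _).trans (hk a))

theorem append {l l' : α → List β} (hl : PT l) (hl' : PT l') : PT fun a => l a ++ l' a := by
  obtain ⟨k, hk⟩ := hl.length_le
  obtain ⟨k', hk'⟩ := hl'.length_le
  have hr : ∀ l l' : List β, l.foldr (fun b s => b :: s) l' = l ++ l' := by simp
  refine (foldr (f := fun _ b s => b :: s) hl hl' (snd.comp id)
    ⟨_, (PolyBdd.pow_add_two k).add (.pow_add_two k'), fun a t ht => ?_⟩).congr fun a => hr _ _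
  rw [hr, length_enc_append]
  exact Nat.add_le_add ((length_enc_le_of_sublist ht).trans (hk a)) (hk' a)

/-! #### Predicates -/

theorem _root_.PTB.comp {c : β → Bool} {g : α → β} (hc : PTB c) (hg : PT g) :
    PTB fun a => c (g a) := PT.comp hc hg

theorem _root_.PTB.congr {c d : α → Bool} (hc : PTB c) (h : ∀ a, c a = d a) : PTB d := funext h ▸ hc

theorem _root_.PTB.const (b : Bool) : PTB fun _ : α => b := PT.const ([b] : Word)

theorem _root_.PTB.cond {c d e : α → Bool} (hc : PTB c) (hd : PTB d) (he : PTB e) :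
    PTB fun a => bif c a then d a else e a :=
  (PT.cond hc hd he).congr fun a => by beta_reduce; cases c a <;> rfl

theorem _root_.PTB.not {c : α → Bool} (hc : PTB c) : PTB fun a => !c a :=
  (hc.cond (.const false) (.const true)).congr fun a => by cases c a <;> rfl

theorem _root_.PTB.and {c d : α → Bool} (hc : PTB c) (hd : PTB d) : PTB fun a => c a && d a :=
  (hc.cond hd (.const false)).congr fun a => by cases c a <;> rfl

theorem _root_.PTB.isEmpty {l : α → List β} (hl : PT l) : PTB fun a => (l a).isEmpty :=
  (listCases (h := fun _ => ([false] : Word)) hl (const ([true] : Word)) (const _)).congr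
    fun a => by beta_reduce; cases l a <;> rfl

theorem _root_.PTB.wordIsEmpty {l : α → Word} (hl : PT l) : PTB fun a => (l a).isEmpty :=
  (wordCases hl (const ([true] : Word)) (const ([false] : Word)) (const ([false] : Word))).congr
    fun a => by beta_reduce; rcases l a with _ | ⟨_ | _, _⟩ <;> rfl

theorem natToWord {n : α → ℕ} (hn : PT n) : PT fun a => List.replicate (n a) true := hn

theorem _root_.PTB.wordEq {v w : α → Word} (hv : PT v) (hw : PT w) : PTB fun a => v a == w a := by
  obtain ⟨k, hk⟩ := hv.length_le
  obtain ⟨k', hk'⟩ := hw.length_le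
  let step : Word × Word → Word × Word := fun p =>
    match p.1 with
    | [] => p
    | false :: _ =>
      match p.2 with
      | [] => p
      | false :: _ => (p.1.tail, p.2.tail)
      | true :: _ => p
    | true :: _ =>
      match p.2 with
      | [] => p
      | false :: _ => p
      | true :: _ => (p.1.tail, p.2.tail)
  have hs : PT step :=
    wordCases (fst' id) id
      (wordCases (snd' id) id (pair (wordTail (fst' id)) (wordTail (snd' id))) id)
      (wordCases (snd' id) id id (pair (wordTail (fst' id)) (wordTail (snd' id))))
  have hlen : ∀ i (p : Word × Word), ((step^[i]) p).1.length ≤ p.1.length ∧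
      ((step^[i]) p).2.length ≤ p.2.length := by
    intro i
    induction i with
    | zero => simp
    | succ i ih =>
      intro p
      rw [Function.iterate_succ_apply]
      refine ⟨(ih _).1.trans ?_, (ih _).2.trans ?_⟩ <;>
      · simp only [step]
        split <;> (try split) <;> simp
  have key : ∀ v w : Word, (((step^[v.length]) (v, w)).1.isEmpty &&
      ((step^[v.length]) (v, w)).2.isEmpty) = (v == w) := by
    have hfix : ∀ i (b b' : Bool) (v w : Word), b ≠ b' →
        (step^[i]) (b :: v, b' :: w) = (b :: v, b' :: w) := by
      intro i b b' v w h
      refine Function.iterate_fixed ?_ i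
      cases b <;> cases b' <;> simp_all [step]
    have hfix' : ∀ i (b : Bool) (v : Word), (step^[i]) (b :: v, []) = (b :: v, []) := by
      intro i b v
      refine Function.iterate_fixed ?_ i
      cases b <;> simp [step]
    intro v
    induction v with
    | nil => intro w; cases w <;> simp
    | cons b v ih =>
      intro w
      cases w with
      | nil => rw [hfix']; simp
      | cons b' w =>
        by_cases h : b = b'
        · subst h
          rw [List.length_cons, Function.iterate_succ_apply,
            show step (b :: v, b :: w) = (v, w) by cases b <;> simp [step], ih]
          simp
        · rw [hfix _ _ _ _ _ h]
          simp [h]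
  have hit := iterate (n := fun a => (v a).length) (init := fun a => (v a, w a))
    (step := fun _ => step) hv.size (hv.pair hw) (hs.comp (snd' id))
    ⟨fun n => 2 * (n + 2) ^ k + (n + 2) ^ k' + 1, (((PolyBdd.const 2).mul (.pow_add_two k)).add
      (.pow_add_two k')).add (.const 1), fun a i _ => by
        obtain ⟨h₁, h₂⟩ := hlen i (v a, w a)
        have h₃ := hk a
        have h₄ := hk' a
        simp only [enc_word] at h₃ h₄
        change _ ≤ (v a).length at h₁
        change _ ≤ (w a).length at h₂
        rw [enc_prod, length_pr, enc_word, enc_word]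
        beta_reduce
        omega⟩
  exact ((PTB.wordIsEmpty hit.fst').and (.wordIsEmpty hit.snd')).congr fun a => key _ _

theorem _root_.PTB.mem {x : α → Word} {l : α → List Word} (hx : PT x) (hl : PT l) :
    PTB fun a => decide (x a ∈ l a) := by
  have h := filter (c := fun a y => x a == y) hl (.wordEq (hx.comp (fst' id)) (snd' id))
  refine (PTB.not (.isEmpty h)).congr fun a => ?_
  rw [Bool.eq_iff_iff]
  simp [List.filter_eq_nil_iff]

/-! #### Natural numbers -/

theorem sub {m n : α → ℕ} (hm : PT m) (hn : PT n) : PT fun a => m a - n a := by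
  obtain ⟨k, hk⟩ := hm.length_le
  have hr : ∀ i (x : ℕ), (fun x => x - 1)^[i] x = x - i := by
    intro i
    induction i with
    | zero => simp
    | succ i ih => intro x; rw [Function.iterate_succ_apply, ih]; omega
  refine (iterate (step := fun _ x => x - 1) hn hm (pred (snd' id))
    ⟨_, .pow_add_two k, fun a i hi => ?_⟩).congr fun a => by rw [hr]
  have := hk a
  simp only [length_enc_nat] at this
  rw [hr, length_enc_nat]
  omega

theorem range {n : α → ℕ} (hn : PT n) : PT fun a => List.range (n a) := by
  obtain ⟨k, hk⟩ := hn.length_le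
  have key : ∀ i, (fun p : ℕ × List ℕ => (p.1 + 1, p.1 :: p.2))^[i] (0, []) =
      (i, (List.range i).reverse) := by
    intro i
    induction i with
    | zero => simp
    | succ i ih => rw [Function.iterate_succ_apply', ih, List.range_succ]; simp
  have hit := iterate (step := fun _ (p : ℕ × List ℕ) => (p.1 + 1, p.1 :: p.2)) hn
    (const ((0, []) : ℕ × List ℕ))
    (pair (succ (fst' (snd' id))) (cons (fst' (snd' id)) (snd' (snd' id))))
    ⟨fun n => 2 * (n + 2) ^ k + (n + 2) ^ k * (2 * (n + 2) ^ k + 1) + 1,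
      (((PolyBdd.const 2).mul (.pow_add_two k)).add ((PolyBdd.pow_add_two k).mul
        (((PolyBdd.const 2).mul (.pow_add_two k)).add (.const 1)))).add (.const 1),
      fun a i hi => by
        have h := hk a
        rw [length_enc_nat] at h
        have hi' := hi.trans h
        rw [key, length_enc_prod, length_enc_nat, length_enc_reverse]
        have h₁ : (enc (List.range i)).length ≤ i * (2 * i + 1) := by
          have := length_enc_le_mul (l := List.range i) (m := i) (by
            intro b hb; rw [List.mem_range] at hb; rw [length_enc_nat]; omega)
          rwa [List.length_range] at this
        have h₂ : i * (2 * i + 1) ≤ ((enc a).length + 2) ^ k * (2 * ((enc a).length + 2) ^ k + 1) :=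
          Nat.mul_le_mul hi' (by omega)
        beta_reduce
        omega⟩
  refine hit.snd'.reverse.congr fun a => ?_
  rw [key, List.reverse_reverse]

theorem drop {n : α → ℕ} {l : α → List β} (hn : PT n) (hl : PT l) :
    PT fun a => (l a).drop (n a) := by
  obtain ⟨k, hk⟩ := hl.length_le
  have hr : ∀ i (l : List β), List.tail^[i] l = l.drop i := by
    intro i
    induction i with
    | zero => simp
    | succ i ih => intro x; rw [Function.iterate_succ_apply, ih]; simp
  refine (iterate (step := fun _ => List.tail) hn hl (listTail (snd' id))
    ⟨_, .pow_add_two k, fun a i hi => ?_⟩).congr fun a => by rw [hr]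
  rw [hr]
  exact (length_enc_le_of_sublist (List.drop_sublist _ _)).trans (hk a)

end PT

/-! ### Simulation of stack machines -/

theorem PolyBdd.polynomial (p : Polynomial ℕ) : PolyBdd fun n => p.eval n := by
  induction p using Polynomial.induction_on' with
  | add p q hp hq => exact (hp.add hq).mono fun n => by simp
  | monomial m a =>
    exact ((PolyBdd.const a).mul (PolyBdd.pow_add_two m)).mono fun n => by
      simp only [Polynomial.eval_monomial]
      exact Nat.mul_le_mul_left _ (Nat.pow_le_pow_left (by omega) _)

/-- Finite types with injective codes. -/
class FinEnc (α : Type) extends Enc α where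
  /-- The type is finite. -/
  finite : Finite α
  /-- The code is injective. -/
  inj : Function.Injective (enc : α → Word)

/-- A code for a finite type. -/
@[reducible] noncomputable def FinEnc.ofFinite (α : Type) [Finite α] : FinEnc α where
  enc a := enc (Finite.equivFin α a : ℕ)
  finite := inferInstance
  inj a b h := (Finite.equivFin α).injective <| Fin.ext <| by
    simpa using congrArg List.length h

namespace PT

variable {α β ι : Type} [Enc α] [Enc β] [FinEnc ι]

theorem encode {f : α → β} (hf : PT f) : PT fun a => (enc (f a) : Word) := hf

/-- Case distinction on a value in a finite type. -/
theorem finCases {x : α → ι} {g : ι → α → β} (hx : PT x) (hg : ∀ i, PT (g i)) :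
    PT fun a => g (x a) a := by
  classical
  have := FinEnc.finite (α := ι)
  have := Fintype.ofFinite ι
  by_cases hα : Nonempty α
  swap
  · exact ⟨_, .id, fun a => (hα ⟨a⟩).elim⟩
  obtain ⟨a₀⟩ := hα
  suffices ∀ l : List ι, ∃ h : α → β, PT h ∧ ∀ a, x a ∈ l → h a = g (x a) a by
    obtain ⟨h, hh, hl⟩ := this Finset.univ.toList
    exact hh.congr fun a => hl a (by simp)
  intro l
  induction l with
  | nil => exact ⟨g (x a₀), hg _, by simp⟩
  | cons i l ih =>
    obtain ⟨h, hh, hl⟩ := ih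
    refine ⟨_, cond (PTB.wordEq hx.encode (const (enc i : Word))) (hg i) hh, fun a ha => ?_⟩
    by_cases hi : x a = i
    · simp [hi]
    · have : enc (x a) ≠ enc i := fun h => hi (FinEnc.inj h)
      simp only [beq_eq_false_iff_ne.2 this, cond_false]
      exact hl a ((List.mem_cons.1 ha).resolve_left hi)

theorem ofFinite (f : ι → β) : PT f := finCases (g := fun i _ => f i) id fun i => const (f i)

theorem ofFinite₂ {κ : Type} [FinEnc κ] (f : ι → κ → β) {x : α → ι} {y : α → κ} (hx : PT x)
    (hy : PT y) : PT fun a => f (x a) (y a) :=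
  finCases (g := fun i a => f i (y a)) hx fun i => (ofFinite (f i)).comp hy

/-- Applying a function to all bits of a word. -/
theorem wordToList (g : Bool → β) {w : α → Word} (hw : PT w) : PT fun a => (w a).map g := by
  let step : Word × List β → Word × List β := fun p =>
    match p.1 with
    | [] => p
    | false :: _ => (p.1.tail, g false :: p.2)
    | true :: _ => (p.1.tail, g true :: p.2)
  have hs : PT step := wordCases (fst' id) id
    (pair (wordTail (fst' id)) (cons (const _) (snd' id)))
    (pair (wordTail (fst' id)) (cons (const _) (snd' id)))
  have key : ∀ (w : Word) (acc : List β) i, (step^[i]) (w, acc) =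
      (w.drop i, ((w.take i).map g).reverse ++ acc) := by
    intro w acc i
    induction i generalizing w acc with
    | zero => simp
    | succ i ih =>
      rw [Function.iterate_succ_apply]
      rcases w with _ | ⟨_ | _, w⟩
      · rw [show step ([], acc) = ([], acc) from rfl, ih]; simp
      · rw [show step (false :: w, acc) = (w, g false :: acc) from rfl, ih]; simp
      · rw [show step (true :: w, acc) = (w, g true :: acc) from rfl, ih]; simp
  obtain ⟨k, hk⟩ := hw.length_le
  set m := (enc (g false)).length + (enc (g true)).length with hm
  have hit := iterate (step := fun _ => step) hw.size (hw.pair (const ([] : List β)))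
    (hs.comp (snd' id)) ⟨fun n => 2 * (n + 2) ^ k + (n + 2) ^ k * (2 * m + 1) + 1,
      (((PolyBdd.const 2).mul (.pow_add_two k)).add ((PolyBdd.pow_add_two k).mul
        (.const _))).add (.const 1), fun a i _ => by
      have h := hk a
      rw [enc_word] at h
      have h₁ := length_enc_le_mul (l := ((w a).take i).map g) (m := m) (by
        intro b hb
        obtain ⟨c, _, rfl⟩ := List.mem_map.1 hb
        cases c <;> omega)
      have h₂ : (((w a).take i).map g).length * (2 * m + 1) ≤
          ((enc a).length + 2) ^ k * (2 * m + 1) := by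
        refine Nat.mul_le_mul_right _ (le_trans ?_ h)
        simp
      have h₃ : ((w a).drop i).length ≤ (w a).length := by simp
      rw [key, length_enc_prod, List.append_nil, length_enc_reverse, enc_word]
      beta_reduce
      omega⟩
  refine hit.snd'.reverse.congr fun a => ?_
  rw [key]
  simp [enc_word]

end PT

section Machine

open Turing

variable {K : Type} [DecidableEq K] [Fintype K] {Γ : K → Type} {Λ σ : Type} [FinEnc (Option Λ)]
  [FinEnc σ] [∀ k, FinEnc (Γ k)]

noncomputable instance : Enc (TM2.Cfg Γ Λ σ) :=
  ⟨fun c => enc (c.l, c.var, (Finset.univ : Finset K).toList.map fun k => (enc (c.stk k) : Word))⟩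

namespace PT

variable {α : Type} [Enc α]

omit [DecidableEq K] in
theorem cfgMk {l : α → Option Λ} {v : α → σ} {S : ∀ k, α → List (Γ k)} (hl : PT l) (hv : PT v)
    (hS : ∀ k, PT (S k)) : PT fun a => (⟨l a, v a, fun k => S k a⟩ : TM2.Cfg Γ Λ σ) := by
  have h : ∀ l : List K, PT fun a => l.map fun k => (enc (S k a) : Word) := by
    intro l
    induction l with
    | nil => exact const _
    | cons k l ih => exact cons (hS k).encode ih
  obtain ⟨F, hF, h⟩ := pair hl (pair hv (h Finset.univ.toList))
  exact ⟨F, hF, h⟩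

omit [DecidableEq K] in
theorem cfgTriple : PT fun c : TM2.Cfg Γ Λ σ =>
    (c.l, c.var, (Finset.univ : Finset K).toList.map fun k => (enc (c.stk k) : Word)) :=
  ⟨_, .id, fun _ => rfl⟩

omit [DecidableEq K] in
theorem cfgLabel : PT fun c : TM2.Cfg Γ Λ σ => c.l := cfgTriple.fst'

omit [DecidableEq K] in
theorem cfgVar : PT fun c : TM2.Cfg Γ Λ σ => c.var := cfgTriple.snd'.fst'

theorem cfgStk (k : K) : PT fun c : TM2.Cfg Γ Λ σ => c.stk k := by
  have h := cfgTriple (Γ := Γ) (Λ := Λ) (σ := σ) |>.snd'.snd'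
  suffices ∀ l : List K, k ∈ l → ∀ f : TM2.Cfg Γ Λ σ → List Word, PT f →
      (∀ c, f c = l.map fun k => (enc (c.stk k) : Word)) →
      PT fun c : TM2.Cfg Γ Λ σ => (enc (c.stk k) : Word) by
    obtain ⟨F, hF, hf⟩ := this _ (by simp) _ h fun _ => rfl
    exact ⟨F, hF, hf⟩
  intro l
  induction l with
  | nil => simp
  | cons k' l ih =>
    intro hk f hf hfl
    by_cases h : k = k'
    · subst h
      exact (listCases (h := fun p => p.2.1) hf (const ([] : Word)) (fst' (snd' id))).congr
        fun c => by simp [hfl]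
    · exact ih ((List.mem_cons.1 hk).resolve_left h) _ (listTail hf) fun c => by simp [hfl]

theorem stepAux (q : TM2.Stmt Γ Λ σ) {v : α → σ} {S : ∀ k, α → List (Γ k)} (hv : PT v)
    (hS : ∀ k, PT (S k)) : PT fun a => TM2.stepAux q (v a) fun k => S k a := by
  have hupd : ∀ (S : ∀ k, α → List (Γ k)), (∀ k, PT (S k)) → ∀ k (x : α → List (Γ k)), PT x →
      ∀ k', PT fun a => Function.update (fun k => S k a) k (x a) k' := by
    intro S hS k x hx k'
    by_cases h : k' = k
    · subst h; simpa using hx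
    · simpa [h] using hS k'
  have hhead : ∀ (S : ∀ k, α → List (Γ k)), (∀ k, PT (S k)) → ∀ {v : α → σ}, PT v →
      ∀ k (f : σ → Option (Γ k) → σ), PT fun a => f (v a) (S k a).head? := by
    intro S hS v hv k f
    have hx : PT fun p : α × Γ k × List (Γ k) => f (v p.1) (some p.2.1) :=
      ofFinite₂ (fun s g => f s (some g)) (hv.comp (fst' id)) (fst' (snd' id))
    refine (listCases (hS k) ((ofFinite fun s => f s none).comp hv) hx).congr fun a => ?_
    cases S k a <;> rfl
  induction q generalizing v S with
  | push k f q ih =>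
    exact ih (S := fun k' a => Function.update (fun k => S k a) k (f (v a) :: S k a) k') hv
      (hupd S hS k _ (cons ((ofFinite f).comp hv) (hS k)))
  | peek k f q ih => exact ih (hhead S hS hv k f) hS
  | pop k f q ih =>
    exact ih (S := fun k' a => Function.update (fun k => S k a) k (S k a).tail k')
      (hhead S hS hv k f) (hupd S hS k _ (listTail (hS k)))
  | load f q ih => exact ih ((ofFinite f).comp hv) hS
  | branch f q₁ q₂ ih₁ ih₂ =>
    have hf : PTB f := ofFinite fun s => ([f s] : Word)
    exact cond (hf.comp hv) (ih₁ hv hS) (ih₂ hv hS)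
  | goto f => exact cfgMk ((ofFinite fun s => some (f s)).comp hv) hv hS
  | halt => exact cfgMk (const none) hv hS

end PT

/-- One step of a machine, where halted configurations do not change. -/
def machineStep (M : Λ → TM2.Stmt Γ Λ σ) (c : TM2.Cfg Γ Λ σ) : TM2.Cfg Γ Λ σ :=
  (TM2.step M c).getD c

theorem PT.machineStep (M : Λ → TM2.Stmt Γ Λ σ) : PT (machineStep M) := by
  let g : Option Λ → TM2.Cfg Γ Λ σ → TM2.Cfg Γ Λ σ := fun o c =>
    o.elim c fun l => TM2.stepAux (M l) c.var c.stk
  refine (finCases (g := g) cfgLabel fun o => ?_).congr fun c => ?_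
  · cases o with
    | none => exact id
    | some l => exact stepAux (M l) cfgVar cfgStk
  · rcases c with ⟨_ | l, v, S⟩ <;> rfl

omit [Fintype K] [FinEnc (Option Λ)] [FinEnc σ] [∀ k, FinEnc (Γ k)] in
theorem machineStep_iterate {M : Λ → TM2.Stmt Γ Λ σ} {c c' : TM2.Cfg Γ Λ σ} {n m : ℕ}
    (h : (flip bind (TM2.step M))^[n] (some c) = some c') (hc' : TM2.step M c' = none)
    (hm : n ≤ m) : (_root_.machineStep M)^[m] c = c' := by
  have hfix : ∀ m, (_root_.machineStep M)^[m] c' = c' := fun m =>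
    Function.iterate_fixed (by simp [_root_.machineStep, hc']) m
  induction n generalizing c m with
  | zero =>
    obtain rfl : c = c' := by simpa using h
    exact hfix m
  | succ n ih =>
    cases m with
    | zero => omega
    | succ m =>
      rw [Function.iterate_succ_apply] at h
      cases hs : TM2.step M c with
      | none =>
        have hn : (flip bind (TM2.step M))^[n] none = none := Function.iterate_fixed rfl n
        rw [show flip bind (TM2.step M) (some c) = TM2.step M c from rfl, hs, hn] at h
        cases h
      | some d =>
        rw [Function.iterate_succ_apply, show _root_.machineStep M c = d by
          simp [_root_.machineStep, hs]]
        exact ih (by simpa [flip, hs] using h) (by omega)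

/-- The number of pushes in a statement. -/
def pushes : TM2.Stmt Γ Λ σ → ℕ
  | .push _ _ q => pushes q + 1
  | .peek _ _ q => pushes q
  | .pop _ _ q => pushes q
  | .load _ q => pushes q
  | .branch _ q₁ q₂ => pushes q₁ + pushes q₂
  | .goto _ => 0
  | .halt => 0

omit [Fintype K] [FinEnc (Option Λ)] [FinEnc σ] [∀ k, FinEnc (Γ k)] in
theorem length_stepAux_le (q : TM2.Stmt Γ Λ σ) (v : σ) (S : ∀ k, List (Γ k)) {m : ℕ}
    (hS : ∀ k, (S k).length ≤ m) (k : K) :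
    ((TM2.stepAux q v S).stk k).length ≤ m + pushes q := by
  induction q generalizing v S m with
  | push k' f q ih =>
    refine (ih (m := m + 1) v _ fun k'' => ?_).trans (by simp [pushes]; omega)
    by_cases h : k'' = k'
    · subst h; simpa using hS k''
    · simpa [h] using (hS k'').trans (Nat.le_succ _)
  | peek k' f q ih => exact ih _ _ hS
  | pop k' f q ih =>
    refine ih _ _ fun k'' => ?_
    by_cases h : k'' = k'
    · subst h; simpa using (Nat.sub_le _ _).trans (hS k'')
    · simpa [h] using hS k''
  | load f q ih => exact ih _ _ hS
  | branch f q₁ q₂ ih₁ ih₂ =>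
    rw [TM2.stepAux]
    cases f v
    · exact (ih₂ v S hS).trans (by simp [pushes])
    · exact (ih₁ v S hS).trans (by simp [pushes])
  | goto f => simpa [pushes] using hS k
  | halt => simpa [pushes] using hS k

omit [Fintype K] [FinEnc σ] [∀ k, FinEnc (Γ k)] in
theorem exists_length_machineStep_le (M : Λ → TM2.Stmt Γ Λ σ) :
    ∃ D, ∀ c m i, (∀ k, (c.stk k).length ≤ m) →
      ∀ k, (((machineStep M)^[i] c).stk k).length ≤ m + i * D := by
  have := FinEnc.finite (α := Option Λ)
  have : Finite Λ := Finite.of_injective (some : Λ → Option Λ) (Option.some_injective _)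
  have := Fintype.ofFinite Λ
  refine ⟨Finset.univ.sup fun l => pushes (M l), fun c m i hc => ?_⟩
  induction i with
  | zero => simpa using hc
  | succ i ih =>
    intro k
    rw [Function.iterate_succ_apply', Nat.succ_mul, ← Nat.add_assoc]
    rcases hci : (machineStep M)^[i] c with ⟨_ | l, v, S⟩
    · have := ih k
      rw [hci] at this
      exact this.trans (Nat.le_add_right _ _)
    · rw [hci] at ih
      refine (length_stepAux_le (M l) v S ih k).trans ?_
      exact Nat.add_le_add_left (Finset.le_sup (f := fun l => pushes (M l)) (Finset.mem_univ l)) _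

theorem FinEnc.exists_bound (ι : Type) [FinEnc ι] : ∃ B, ∀ i : ι, (enc i).length ≤ B := by
  have := FinEnc.finite (α := ι)
  have := Fintype.ofFinite ι
  exact ⟨Finset.univ.sup fun i : ι => (enc i).length, fun i =>
    Finset.le_sup (f := fun i : ι => (enc i).length) (Finset.mem_univ i)⟩

omit [DecidableEq K] in
theorem exists_length_enc_cfg_le : ∃ T, PolyBdd T ∧ (Monotone T) ∧
    ∀ (c : TM2.Cfg Γ Λ σ) m, (∀ k, (c.stk k).length ≤ m) → (enc c).length ≤ T m := by
  obtain ⟨B₁, h₁⟩ := FinEnc.exists_bound (Option Λ)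
  obtain ⟨B₂, h₂⟩ := FinEnc.exists_bound σ
  choose G hG using fun k => FinEnc.exists_bound (Γ k)
  set B := Finset.univ.sup G with hB
  set N := (Finset.univ : Finset K).toList.length with hN
  refine ⟨fun m => 2 * B₁ + 2 * B₂ + 2 + N * (2 * (m * (2 * B + 1)) + 1), (PolyBdd.const _).add
    ((PolyBdd.const _).mul (((PolyBdd.const 2).mul (PolyBdd.id.mul (.const _))).add (.const 1))),
    ?_, fun c m hc => ?_⟩
  · intro m m' h
    have : m * (2 * B + 1) ≤ m' * (2 * B + 1) := Nat.mul_le_mul_right _ h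
    have := Nat.mul_le_mul_left N (show 2 * (m * (2 * B + 1)) + 1 ≤ 2 * (m' * (2 * B + 1)) + 1 by
      omega)
    beta_reduce
    omega
  · have hl := h₁ c.l
    have hv := h₂ c.var
    have hS := length_enc_le_mul (l := (Finset.univ : Finset K).toList.map
      fun k => (enc (c.stk k) : Word)) (m := m * (2 * B + 1)) (by
      intro w hw
      obtain ⟨k, _, rfl⟩ := List.mem_map.1 hw
      rw [enc_word]
      refine (length_enc_le_mul (m := B) fun g _ => (hG k g).trans
        (Finset.le_sup (f := G) (Finset.mem_univ k))).trans ?_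
      exact Nat.mul_le_mul_right _ (hc k))
    rw [List.length_map, ← hN] at hS
    have : (enc c).length = (enc (c.l, c.var, (Finset.univ : Finset K).toList.map
      fun k => (enc (c.stk k) : Word))).length := rfl
    rw [this, length_enc_prod, length_enc_prod]
    beta_reduce
    omega

/-- Polynomially many steps of a machine. -/
theorem PT.machineIterate {α : Type} [Enc α] (M : Λ → TM2.Stmt Γ Λ σ) {n : α → ℕ}
    {init : α → TM2.Cfg Γ Λ σ} (hn : PT n) (hi : PT init)
    (hb : ∃ T, PolyBdd T ∧ ∀ a k, ((init a).stk k).length ≤ T (enc a).length) :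
    PT fun a => (_root_.machineStep M)^[n a] (init a) := by
  obtain ⟨T, hT, hb⟩ := hb
  obtain ⟨D, hD⟩ := exists_length_machineStep_le M
  obtain ⟨T', hT', hmono, hl⟩ := exists_length_enc_cfg_le (Γ := Γ) (Λ := Λ) (σ := σ)
  obtain ⟨k, hk⟩ := hn.length_le
  refine iterate (step := fun _ => _root_.machineStep M) hn hi ((PT.machineStep M).comp (snd' id))
    ⟨_, hT'.comp (hT.add ((PolyBdd.pow_add_two k).mul (.const D))), fun a i h => ?_⟩
  refine (hl _ _ (hD _ _ i (hb a))).trans (hmono ?_)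
  have := hk a
  rw [length_enc_nat] at this
  exact Nat.add_le_add_left (Nat.mul_le_mul_right _ (h.trans this)) _

end Machine

/-- A function computed by a stack machine in polynomial time belongs to the algebra. -/
theorem PolyTimeComputable.exists_fp {α β : Type} {ea : α → Word} {eb : β → Word} {f : α → β}
    (h : PolyTimeComputable ea eb f) : ∃ F, FP F ∧ ∀ a, F (ea a) = eb (f a) := by
  obtain ⟨M, hΓ⟩ := h
  let tm := M.tm
  let := tm.kFin
  let := tm.ΛFin
  let := tm.σFin
  let : FinEnc (Option tm.Λ) := .ofFinite _
  let : FinEnc tm.σ := .ofFinite _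
  have hΓ' : ∀ k, Finite (tm.Γ k) := hΓ
  let : ∀ k, FinEnc (tm.Γ k) := fun k => .ofFinite _
  let : Enc tm.Cfg := (inferInstance : Enc (Turing.TM2.Cfg tm.Γ tm.Λ tm.σ))
  obtain ⟨k, hk⟩ := PolyBdd.polynomial M.time
  obtain ⟨B, hB, hBk⟩ := FP.exists_long k
  have hi : PT fun w : Word => Turing.initList tm (w.map M.inputAlphabet.invFun) := by
    refine PT.cfgMk (l := fun _ => some tm.main) (v := fun _ => tm.initialState)
      (S := fun k (w : Word) => (Turing.initList tm (w.map M.inputAlphabet.invFun)).stk k) (PT.const _)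
      (PT.const _) fun k => ?_
    by_cases h : k = tm.k₀
    · subst h
      refine (PT.wordToList M.inputAlphabet.invFun PT.id).congr fun w => ?_
      simp [Turing.initList]
    · refine (PT.const []).congr fun w => ?_
      simp [Turing.initList, h]
  have hn : PT fun w : Word => (B w).length :=
    PT.size (f := fun w : Word => (B w : Word)) ⟨B, hB, fun _ => rfl⟩
  have hrun := PT.machineIterate tm.m hn hi ⟨fun n => n, .id, fun w k => by
    by_cases h : k = tm.k₀
    · subst h; simp [Turing.initList, enc_word]
    · simp [Turing.initList, h]⟩
  obtain ⟨F, hF, hFw⟩ := PT.wordMap (c := fun _ g => M.outputAlphabet g)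
    ((PT.cfgStk tm.k₁).comp hrun)
    ((PT.ofFinite fun g => ([M.outputAlphabet g] : Word)).comp (PT.snd' PT.id))
  refine ⟨F, hF, fun a => (hFw (ea a)).trans ?_⟩
  have ho := M.outputsFun a
  have hst : (machineStep tm.m)^[(B (ea a)).length]
      (Turing.initList tm ((ea a).map M.inputAlphabet.invFun)) =
      Turing.haltList tm ((eb (f a)).map M.outputAlphabet.invFun) :=
    machineStep_iterate ho.evals_in_steps rfl
      (ho.steps_le_m.trans ((hk _).trans (hBk _)))
  refine (congrArg (fun c : Turing.TM2.Cfg tm.Γ tm.Λ tm.σ =>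
    (enc ((c.stk tm.k₁).map fun g => M.outputAlphabet g) : Word)) hst).trans ?_
  rw [enc_word]
  simp [Turing.haltList, tm]

theorem PT.of_polyTimeComputable {f : List Word → List Word}
    (h : PolyTimeComputable tupleCode tupleCode f) : PT f := by
  obtain ⟨F, hF, hf⟩ := h.exists_fp
  exact ⟨F, hF, fun ys => by rw [← tupleCode_eq_enc, ← tupleCode_eq_enc, hf]⟩

theorem PT.polyTimeComputable {f : List Word → List Word} (h : PT f) :
    PolyTimeComputable tupleCode tupleCode f := by
  obtain ⟨F, hF, hf⟩ := h
  exact hF.polyTimeComputable fun ys => by rw [tupleCode_eq_enc, tupleCode_eq_enc, hf]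

theorem PT.polyTimeComputable_word {f : List Word → Word} (h : PT f) :
    PolyTimeComputable tupleCode _root_.id f := by
  obtain ⟨F, hF, hf⟩ := h
  exact hF.polyTimeComputable fun ys => by rw [tupleCode_eq_enc, hf]; rfl

theorem PT.of_polyTimeComputable_word {f : List Word → Word}
    (h : PolyTimeComputable tupleCode _root_.id f) : PT f := by
  obtain ⟨F, hF, hf⟩ := h.exists_fp
  exact ⟨F, hF, fun ys => by rw [← tupleCode_eq_enc, hf]; rfl⟩

/-! ### A universal family of total functions -/

namespace Nat.Partrec.Code

/-- Replaces all minimizations in a code by the constant zero, which makes it total. -/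
def strip (c : Code) : Code :=
  Code.recOn c zero succ left right (fun _ _ c d => pair c d) (fun _ _ c d => comp c d)
    (fun _ _ c d => prec c d) fun _ _ => zero

theorem primrec_strip : Primrec strip :=
  primrec_recOn (α := Code) .id (.const _) (.const _) (.const _) (.const _)
    (pr := fun _ _ _ c d => pair c d) (co := fun _ _ _ c d => comp c d)
    (pc := fun _ _ _ c d => prec c d) (rf := fun _ _ _ => zero)
    (primrec₂_pair.comp (Primrec.fst.comp (.comp .snd (.comp .snd .snd)))
      (Primrec.snd.comp (.comp .snd (.comp .snd .snd))))
    (primrec₂_comp.comp (Primrec.fst.comp (.comp .snd (.comp .snd .snd)))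
      (Primrec.snd.comp (.comp .snd (.comp .snd .snd))))
    (primrec₂_prec.comp (Primrec.fst.comp (.comp .snd (.comp .snd .snd)))
      (Primrec.snd.comp (.comp .snd (.comp .snd .snd))))
    (.const _)

theorem eval_strip_dom (c : Code) (n : ℕ) : (eval (strip c) n).Dom := by
  induction c generalizing n with
  | zero | rfind' => trivial
  | succ | left | right => trivial
  | pair c d hc hd =>
    obtain ⟨x, hx⟩ := Part.dom_iff_mem.1 (hc n)
    obtain ⟨y, hy⟩ := Part.dom_iff_mem.1 (hd n)
    rw [Part.dom_iff_mem]
    refine ⟨Nat.pair x y, ?_⟩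
    simp only [strip, eval, Seq.seq, Part.map_eq_map]
    simp only [strip] at hx hy
    simp [Part.mem_bind_iff, Part.mem_map_iff, hx, hy]
  | comp c d hc hd =>
    exact ⟨hd n, hc _⟩
  | prec c d hc hd =>
    rw [← Nat.pair_unpair n]
    induction n.unpair.2 with
    | zero => exact (eval_prec_zero (strip c) (strip d) _).symm ▸ hc _
    | succ k ih =>
      exact (eval_prec_succ (strip c) (strip d) _ _).symm ▸ ⟨ih, hd _⟩

theorem exists_strip_eq {f : ℕ → ℕ} (hf : Nat.Primrec f) : ∃ c, eval (strip c) = f := by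
  suffices ∃ c, strip c = c ∧ eval c = f by
    obtain ⟨c, hc, h⟩ := this
    exact ⟨c, by rw [hc, h]⟩
  induction hf with
  | zero => exact ⟨zero, rfl, rfl⟩
  | succ => exact ⟨succ, rfl, rfl⟩
  | left => exact ⟨left, rfl, rfl⟩
  | right => exact ⟨right, rfl, rfl⟩
  | pair hf hg ihf ihg =>
    obtain ⟨c, hc, hcf⟩ := ihf
    obtain ⟨d, hd, hdg⟩ := ihg
    refine ⟨pair c d, congrArg₂ pair hc hd, ?_⟩
    funext n
    simp [eval, hcf, hdg, Seq.seq]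
  | comp hf hg ihf ihg =>
    obtain ⟨c, hc, hcf⟩ := ihf
    obtain ⟨d, hd, hdg⟩ := ihg
    refine ⟨comp c d, congrArg₂ comp hc hd, ?_⟩
    funext n
    simp only [eval, hcf, hdg, PFun.coe_val]
    exact Part.bind_some _ _
  | @prec f g hf hg ihf ihg =>
    obtain ⟨c, hc, hcf⟩ := ihf
    obtain ⟨d, hd, hdg⟩ := ihg
    refine ⟨prec c d, congrArg₂ prec hc hd, ?_⟩
    funext n
    rw [← Nat.pair_unpair n]
    induction n.unpair.2 with
    | zero => simp [eval_prec_zero, hcf]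
    | succ k ih =>
      rw [eval_prec_succ, ih]
      simp [hdg]

end Nat.Partrec.Code

open Nat.Partrec (Code)

/-- A universal function for the primitive recursive functions. -/
def universal (j n : ℕ) : ℕ :=
  (Code.eval (Code.strip (Denumerable.ofNat Code j)) n).get (Code.eval_strip_dom _ _)

theorem computable_universal : Computable₂ universal :=
  Partrec.of_eq (Code.eval_part.comp ((Code.primrec_strip.to_comp.comp
    (Computable.ofNat Code)).comp .fst) .snd) fun _ => (Part.some_get _).symm

theorem exists_universal_eq {f : ℕ → ℕ} (hf : Primrec f) : ∃ j, universal j = f := by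
  obtain ⟨c, hc⟩ := Code.exists_strip_eq (Primrec.nat_iff.1 hf)
  refine ⟨Encodable.encode c, funext fun n => ?_⟩
  simp [universal, hc]

/-! ### Machines with finitely many labels -/

section Relabel

open Turing

variable {K : Type} [DecidableEq K] {Γ : K → Type} {Λ Λ' σ : Type}

/-- Applies a function to all labels of a statement. -/
def relabel (r : Λ → Λ') : TM2.Stmt Γ Λ σ → TM2.Stmt Γ Λ' σ
  | .push k f q => .push k f (relabel r q)
  | .peek k f q => .peek k f (relabel r q)
  | .pop k f q => .pop k f (relabel r q)
  | .load f q => .load f (relabel r q)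
  | .branch f q₁ q₂ => .branch f (relabel r q₁) (relabel r q₂)
  | .goto f => .goto fun v => r (f v)
  | .halt => .halt

/-- Applies a function to the label of a configuration. -/
def relabelCfg (r : Λ → Λ') (c : TM2.Cfg Γ Λ σ) : TM2.Cfg Γ Λ' σ := ⟨c.l.map r, c.var, c.stk⟩

theorem stepAux_relabel {S : Finset Λ} {r : Λ → S} (hr : ∀ l ∈ S, (r l : Λ) = l)
    (q : TM2.Stmt Γ Λ σ) (hq : TM2.SupportsStmt S q) (v : σ) (T : ∀ k, List (Γ k)) :
    relabelCfg Subtype.val (TM2.stepAux (relabel r q) v T) = TM2.stepAux q v T := by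
  induction q generalizing v T with
  | push k f q ih | peek k f q ih | pop k f q ih | load f q ih => exact ih hq _ _
  | branch f q₁ q₂ ih₁ ih₂ =>
    simp only [relabel, TM2.stepAux]
    cases f v
    · exact ih₂ hq.2 _ _
    · exact ih₁ hq.1 _ _
  | goto f => simp [relabel, relabelCfg, TM2.stepAux, hr _ (hq v)]
  | halt => rfl

theorem exists_iterate_relabel {M : Λ → TM2.Stmt Γ Λ σ} {S : Finset Λ} {r : Λ → S}
    (hr : ∀ l ∈ S, (r l : Λ) = l) (hM : ∀ l ∈ S, TM2.SupportsStmt S (M l))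
    {c d : TM2.Cfg Γ Λ σ} (h : StateTransition.Reaches (TM2.step M) c d) (c' : TM2.Cfg Γ S σ)
    (hc : relabelCfg Subtype.val c' = c) :
    ∃ i, relabelCfg Subtype.val ((machineStep fun l : S => relabel r (M l))^[i] c') = d := by
  induction h using Relation.ReflTransGen.head_induction_on generalizing c' with
  | refl => exact ⟨0, hc⟩
  | @head c e hce _ ih =>
    subst hc
    obtain ⟨_ | l, v, T⟩ := c'
    · cases hce
    · have : TM2.stepAux (M l) v T = e := by simpa [TM2.step, relabelCfg] using hce
      obtain ⟨i, hi⟩ := ih (TM2.stepAux (relabel r (M l)) v T)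
        ((stepAux_relabel hr _ (hM _ l.2) v T).trans this)
      exact ⟨i + 1, hi⟩

end Relabel

/-! ### Stack machines for computable functions -/

open Turing.PartrecToTM2 (Γ' K' trNat trNum trPosNum trList)

theorem trNat_bit (b : Bool) {n : ℕ} (h : b = true) :
    trNat (Nat.bit b n) = Γ'.bit1 :: trNat n := by
  subst h
  rw [trNat, ← Num.ofNat'_eq, Num.ofNat'_bit, trNat, ← Num.ofNat'_eq]
  cases Num.ofNat' n <;> rfl

theorem trNat_two_pow_sub_one (n : ℕ) : trNat (2 ^ n - 1) = List.replicate n Γ'.bit1 := by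
  induction n with
  | zero => simp
  | succ n ih =>
    have h : 2 ^ (n + 1) - 1 = Nat.bit true (2 ^ n - 1) := by
      have := Nat.one_le_two_pow (n := n)
      simp only [Nat.bit, cond_true]
      omega
    rw [h, trNat_bit true rfl, ih, List.replicate_succ]

theorem getElem?_trNat (n i : ℕ) : (trNat n)[i]? = some Γ'.bit1 ↔ n.testBit i = true := by
  have hp : ∀ (p : PosNum) i, (trPosNum p)[i]? = some Γ'.bit1 ↔ p.testBit i = true := by
    intro p
    induction p with
    | one => intro i; cases i <;> simp [trPosNum, PosNum.testBit]
    | bit0 p ih | bit1 p ih =>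
      intro i
      cases i
      · simp [trPosNum, PosNum.testBit]
      · simpa [trPosNum, PosNum.testBit] using ih _
  have h := Num.castNum_testBit (n : Num) i
  rw [Num.to_of_nat] at h
  rw [← h, trNat]
  cases (n : Num) with
  | zero => simp [trNum, Num.testBit]
  | pos p => exact hp p i

theorem primrec_two_pow : Primrec fun n : ℕ => 2 ^ n :=
  (Primrec.nat_iterate .id (.const 1) (Primrec.nat_mul.comp (.const 2) .snd).to₂).of_eq fun n => by
    simp

/-- The number of digits of a number all of whose binary digits are one. -/
def onesLength (m : ℕ) : ℕ := m.findGreatest fun i => 2 ^ i ≤ m + 1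

theorem primrec_onesLength : Primrec onesLength :=
  Primrec.nat_findGreatest .id
    (Primrec.nat_le.comp (primrec_two_pow.comp .snd) (Primrec.succ.comp .fst))

theorem onesLength_two_pow_sub_one (n : ℕ) : onesLength (2 ^ n - 1) = n := by
  have h := n.lt_two_pow_self
  rw [onesLength, Nat.findGreatest_eq_iff]
  refine ⟨by omega, fun _ => by omega, fun m hm _ hle => ?_⟩
  have := Nat.pow_lt_pow_right one_lt_two hm
  omega

theorem exists_toPartrec_code {E : ℕ → ℕ → ℕ} (hE : Computable₂ E) :
    ∃ c : Turing.ToPartrec.Code, ∀ j n, c.eval [2 ^ j - 1, 2 ^ n - 1] = pure [E j n] := by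
  have h : Partrec₂ fun a b : ℕ => (E (onesLength a) (onesLength b) : Part ℕ) :=
    (hE.comp (primrec_onesLength.to_comp.comp .fst) (primrec_onesLength.to_comp.comp .snd))
  obtain ⟨c, hc⟩ := Turing.ToPartrec.Code.exists_code (Nat.Partrec'.part_iff₂.2 h)
  refine ⟨c, fun j n => ?_⟩
  have := hc ((2 ^ j - 1) ::ᵥ (2 ^ n - 1) ::ᵥ .nil)
  simp only [List.Vector.head_cons, List.Vector.tail_cons, onesLength_two_pow_sub_one] at this
  exact this.trans (Part.map_some _ _)

instance : Fintype K' := ⟨{.main, .rev, .aux, .stack}, fun k => by cases k <;> simp⟩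

/-- An evaluation of `E` by iterating a polynomial-time step function. -/
structure StepwiseEvaluation (E : ℕ → ℕ → ℕ) where
  /-- The configurations. -/
  C : Type
  /-- The coding of the configurations. -/
  [coding : Enc C]
  /-- The step function. -/
  step : C → C
  /-- The initial configuration. -/
  init : ℕ × ℕ → C
  /-- Whether the evaluation has ended. -/
  done : C → Bool
  /-- The binary digits of the result. -/
  bit : C × ℕ → Bool
  pt_step : PT step
  pt_init : PT init
  ptb_done : PTB done
  ptb_bit : PTB bit
  step_of_done : ∀ c, done c = true → step c = c
  length_le : ∃ k, ∀ p i, (Enc.enc (step^[i] (init p))).length ≤ ((Enc.enc p).length + i + 2) ^ k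
  exists_done : ∀ p, ∃ i, done (step^[i] (init p)) = true
  bit_eq : ∀ p i, done (step^[i] (init p)) = true → ∀ x,
    bit (step^[i] (init p), x) = (E p.1 p.2).testBit x

/-- A computable function can be evaluated by iterating a polynomial-time step function. -/
theorem nonempty_stepwiseEvaluation {E : ℕ → ℕ → ℕ} (hE : Computable₂ E) :
    Nonempty (StepwiseEvaluation E) := by
  classical
  obtain ⟨c, hc⟩ := exists_toPartrec_code hE
  let S := Turing.PartrecToTM2.codeSupp c .halt
  obtain ⟨h₀, hS⟩ := Turing.PartrecToTM2.tr_supports c .halt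
  let l₀ : S := ⟨Turing.PartrecToTM2.trNormal c .halt, h₀⟩
  let r : Turing.PartrecToTM2.Λ' → S := fun l => if h : l ∈ S then ⟨l, h⟩ else l₀
  have hr : ∀ l ∈ S, (r l : Turing.PartrecToTM2.Λ') = l := fun l h => by simp [r, h]
  let : FinEnc (Option S) := .ofFinite _
  let : FinEnc Γ' := .ofFinite _
  let : FinEnc (Option Γ') := .ofFinite _
  let M := fun l : S => relabel r (Turing.PartrecToTM2.tr l)
  let C := Turing.TM2.Cfg (fun _ : K' => Γ') S (Option Γ')
  let stk : ℕ × ℕ → List Γ' := fun p => List.replicate p.1 Γ'.bit1 ++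
    ([Γ'.cons] ++ (List.replicate p.2 Γ'.bit1 ++ [Γ'.cons]))
  let init : ℕ × ℕ → C := fun p => ⟨some l₀, none, K'.elim (stk p) [] [] []⟩
  let done : C → Bool := fun c => c.l.elim true fun _ => false
  let isOne : Γ' → Bool := fun g => g = .bit1
  let bit : C × ℕ → Bool := fun p =>
    match (p.1.stk .main).drop p.2 with
    | [] => false
    | g :: _ => isOne g
  have hrep : ∀ f : ℕ × ℕ → ℕ, PT f → PT fun p => List.replicate (f p) Γ'.bit1 := fun f hf =>
    (PT.wordToList (fun _ => Γ'.bit1) (PT.natToWord hf)).congr fun p => by simp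
  have hstk : PT stk := (hrep _ PT.fst).append ((PT.const [Γ'.cons]).append
    ((hrep _ PT.snd).append (PT.const [Γ'.cons])))
  have hinit : PT init := PT.cfgMk (S := fun k p => K'.elim (stk p) [] [] [] k) (PT.const _)
    (PT.const _) fun k => by
      cases k
      · exact hstk
      all_goals exact PT.const _
  have hdone : PTB done :=
    (PT.ofFinite fun o : Option S => ([o.elim true fun _ => false] : Word)).comp PT.cfgLabel
  have hbit : PTB bit := by
    have hone : PTB isOne := PT.ofFinite fun g => ([isOne g] : Word)
    refine PT.congr (PT.listCases (h := fun p => ([isOne p.2.1] : Word))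
      (PT.drop PT.snd ((PT.cfgStk K'.main).comp PT.fst)) (PT.const ([false] : Word))
      (hone.comp (PT.fst' (PT.snd' PT.id)))) fun p => ?_
    simp only [bit]
    cases (p.1.stk K'.main).drop p.2 <;> rfl
  have hstep : ∀ d : C, done d = true → machineStep M d = d := by
    rintro ⟨_ | l, v, T⟩ hd
    · rfl
    · cases hd
  have hfix : ∀ d : C, done d = true → ∀ n, (machineStep M)^[n] d = d := fun d hd n =>
    Function.iterate_fixed (hstep d hd) n
  suffices h : (∃ k, ∀ p i,
      (enc ((machineStep M)^[i] (init p))).length ≤ ((enc p).length + i + 2) ^ k) ∧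
      ∀ p, (∃ i, done ((machineStep M)^[i] (init p)) = true) ∧
        ∀ i, done ((machineStep M)^[i] (init p)) = true → ∀ x,
          bit ((machineStep M)^[i] (init p), x) = (E p.1 p.2).testBit x from
    ⟨⟨C, machineStep M, init, done, bit, PT.machineStep M, hinit, hdone, hbit, hstep, h.1,
      fun p => (h.2 p).1, fun p => (h.2 p).2⟩⟩
  refine ⟨?_, fun p => ?_⟩
  · obtain ⟨D, hD⟩ := exists_length_machineStep_le M
    obtain ⟨T, hT, hmono, hl⟩ := exists_length_enc_cfg_le (Γ := fun _ : K' => Γ') (Λ := S)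
      (σ := Option Γ')
    obtain ⟨k, hk⟩ := hT.comp ((PolyBdd.const 2).add (PolyBdd.id.mul (.const (D + 1))))
    refine ⟨k, fun p i => ((hl _ _ (hD (init p) ((enc p).length + 2) i fun k => ?_)).trans
      (hmono ?_)).trans (hk _)⟩
    · have : (stk p).length ≤ (enc p).length + 2 := by
        have : (enc p).length = _ := length_enc_prod p.1 p.2
        rw [length_enc_nat, length_enc_nat] at this
        simp only [stk, List.length_append, List.length_replicate, List.length_singleton]
        omega
      cases k <;> simp [init, this]
    · nlinarith
  · have hstart : relabelCfg Subtype.val (init p) =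
        Turing.PartrecToTM2.init c [2 ^ p.1 - 1, 2 ^ p.2 - 1] := by
      simp [init, stk, l₀, relabelCfg, Turing.PartrecToTM2.init, trList, trNat_two_pow_sub_one]
    have hev := Turing.PartrecToTM2.tr_eval c [2 ^ p.1 - 1, 2 ^ p.2 - 1]
    have hmem : Turing.PartrecToTM2.halt [E p.1 p.2] ∈ StateTransition.eval
        (Turing.TM2.step Turing.PartrecToTM2.tr)
        (Turing.PartrecToTM2.init c [2 ^ p.1 - 1, 2 ^ p.2 - 1]) := by
      rw [hev, hc]
      exact Part.mem_map _ (Part.mem_some _)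
    obtain ⟨hreach, -⟩ := StateTransition.mem_eval.1 hmem
    obtain ⟨i, hi⟩ := exists_iterate_relabel hr hS hreach (init p) hstart
    have hd : done ((machineStep M)^[i] (init p)) = true := by
      have : ((machineStep M)^[i] (init p)).l = none :=
        Option.map_eq_none_iff.1 (congrArg Turing.TM2.Cfg.l hi)
      simp [done, this]
    refine ⟨⟨i, hd⟩, fun i' hd' x => ?_⟩
    have heq : (machineStep M)^[i'] (init p) = (machineStep M)^[i] (init p) := by
      rw [← hfix _ hd i', ← Function.iterate_add_apply, Nat.add_comm,
        Function.iterate_add_apply, hfix _ hd']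
    rw [heq, Bool.eq_iff_iff, ← getElem?_trNat]
    have hmain : ((machineStep M)^[i] (init p)).stk K'.main = trNat (E p.1 p.2) ++ [Γ'.cons] :=
      (congrArg (fun c => Turing.TM2.Cfg.stk c K'.main) hi).trans (by
        simp [Turing.PartrecToTM2.halt])
    simp only [bit, hmain]
    rcases lt_or_ge x (trNat (E p.1 p.2)).length with h | h
    · rw [List.drop_eq_getElem_cons (by simp; omega)]
      simp [isOne, h, List.getElem_append_left]
    · rw [List.getElem?_eq_none h]
      rcases h.eq_or_lt with h | h
      · simp [← h, isOne]
      · rw [List.drop_eq_nil_of_le (by simp; omega)]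
        simp

/-! ### Sparse languages built by a slow diagonalization -/

/-- The word of length `n + 1` with exactly one zero, at position `i`. -/
def oneZero (n i : ℕ) : Word := (List.cons true)^[i] (false :: List.replicate (n - i) true)

theorem oneZero_eq (n i : ℕ) :
    oneZero n i = List.replicate i true ++ false :: List.replicate (n - i) true := by
  have h : ∀ w : Word, (List.cons true)^[i] w = List.replicate i true ++ w := by
    intro w
    induction i with
    | zero => rfl
    | succ i ih => rw [Function.iterate_succ_apply', ih]; rfl
  exact h _

theorem length_oneZero {n i : ℕ} (h : i ≤ n) : (oneZero n i).length = n + 1 := by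
  simp [oneZero_eq]
  omega

theorem oneZero_injective (n : ℕ) : Function.Injective (oneZero n) := by
  intro i j h
  have hi : ∀ i, (oneZero n i).idxOf false = i := by
    intro i
    rw [oneZero_eq, List.idxOf_append_of_notMem (by simp)]
    simp
  rw [← hi i, h, hi j]

theorem PT.oneZero {α : Type} [Enc α] {n i : α → ℕ} (hn : PT n) (hi : PT i) :
    PT fun a => _root_.oneZero (n a) (i a) := by
  obtain ⟨k, hk⟩ := hn.length_le
  obtain ⟨k', hk'⟩ := hi.length_le
  refine iterate (step := fun _ => List.cons true) hi (wordCons false (natToWord (sub hn hi)))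
    (wordCons true (snd' id))
    ⟨_, ((PolyBdd.pow_add_two k).add (.pow_add_two k')).add (.const 1), fun a j hj => ?_⟩
  have h := hk a
  have h' := hk' a
  have hl : ∀ (w : Word), ((List.cons true)^[j] w).length = j + w.length := by
    intro w
    clear hj
    induction j with
    | zero => simp
    | succ j ih => rw [Function.iterate_succ_apply', List.length_cons, ih]; omega
  rw [length_enc_nat] at h h'
  rw [enc_word, hl]
  simp only [List.length_cons, List.length_replicate]
  omega

/-- The first `κ n` words of length `n + 1` with exactly one zero. -/
def level (κ : ℕ → ℕ) (n : ℕ) : List Word := (List.range (κ n)).map (oneZero n)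

theorem PT.level {κ : ℕ → ℕ} (hκ : PT κ) : PT (level κ) :=
  map (range hκ) (oneZero fst snd)

theorem nodup_level (κ : ℕ → ℕ) (n : ℕ) : (level κ n).Nodup :=
  List.nodup_range.map (oneZero_injective n)

theorem length_level (κ : ℕ → ℕ) (n : ℕ) : (level κ n).length = κ n := by simp [level]

theorem length_of_mem_level {κ : ℕ → ℕ} {n : ℕ} (hκ : κ n ≤ n + 1) {x : Word}
    (hx : x ∈ level κ n) : x.length = n + 1 := by
  simp only [level, List.mem_map, List.mem_range] at hx
  obtain ⟨i, hi, rfl⟩ := hx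
  exact length_oneZero (by omega)

namespace StepwiseEvaluation

variable {E : ℕ → ℕ → ℕ} (M : StepwiseEvaluation E) (κ : ℕ → ℕ) (s : ℕ)

instance : Enc M.C := M.coding

/-- A state of the construction: the clock, the requirement, its level, the state of the evaluation
of `E`, and the words enumerated so far. -/
abbrev Stage : Type := ℕ × ℕ × ℕ × M.C × List Word

/-- The words of a level that join the language at the end of an evaluation. -/
def newWords (c : M.C) (n : ℕ) : List Word :=
  ((List.range (κ n)).filter fun i => !M.bit (c, i)).map (oneZero n)

/-- One tick of the construction. -/
def tick (p : M.Stage) : M.Stage :=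
  bif M.done p.2.2.2.1 then
    (p.1 + 1, p.2.1 + 1, p.1 + 1, M.init (p.2.1 + 1, p.1 + 1),
      p.2.2.2.2 ++ M.newWords κ p.2.2.2.1 p.2.2.1)
  else (p.1 + 1, p.2.1, p.2.2.1, M.step p.2.2.2.1, p.2.2.2.2)

/-- The state of the construction at time `t`. -/
def stage (t : ℕ) : M.Stage := (M.tick κ)^[t] (s, 0, s, M.init (0, s), [])

/-- The requirement treated at time `t`. -/
def req (t : ℕ) : ℕ := (M.stage κ s t).2.1

/-- The level treated at time `t`. -/
def lev (t : ℕ) : ℕ := (M.stage κ s t).2.2.1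

/-- The configuration at time `t`. -/
def conf (t : ℕ) : M.C := (M.stage κ s t).2.2.2.1

/-- The words enumerated before time `t`. -/
def words (t : ℕ) : List Word := (M.stage κ s t).2.2.2.2

theorem clock_eq (t : ℕ) : (M.stage κ s t).1 = s + t := by
  induction t with
  | zero => rfl
  | succ t ih =>
    rw [stage, Function.iterate_succ_apply', ← stage, tick]
    cases M.done (M.stage κ s t).2.2.2.1 <;> simp [ih, Nat.add_assoc]

variable {κ s} {t : ℕ}

theorem step_of_not_done (h : M.done (M.conf κ s t) = false) :
    M.req κ s (t + 1) = M.req κ s t ∧ M.lev κ s (t + 1) = M.lev κ s t ∧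
      M.conf κ s (t + 1) = M.step (M.conf κ s t) ∧ M.words κ s (t + 1) = M.words κ s t := by
  simp only [req, lev, conf, words] at h ⊢
  rw [show M.stage κ s (t + 1) = M.tick κ (M.stage κ s t) from Function.iterate_succ_apply' _ _ _,
    tick, h]
  exact ⟨rfl, rfl, rfl, rfl⟩

theorem step_done (h : M.done (M.conf κ s t) = true) :
    M.req κ s (t + 1) = M.req κ s t + 1 ∧ M.lev κ s (t + 1) = s + t + 1 ∧
      M.conf κ s (t + 1) = M.init (M.req κ s t + 1, s + t + 1) ∧
      M.words κ s (t + 1) =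
        M.words κ s t ++ M.newWords κ (M.conf κ s t) (M.lev κ s t) := by
  simp only [req, lev, conf, words] at h ⊢
  rw [show M.stage κ s (t + 1) = M.tick κ (M.stage κ s t) from Function.iterate_succ_apply' _ _ _,
    tick, h, M.clock_eq]
  exact ⟨rfl, rfl, rfl, rfl⟩

theorem lev_le (t : ℕ) : M.lev κ s t ≤ s + t := by
  induction t with
  | zero => exact le_rfl
  | succ t ih =>
    cases h : M.done (M.conf κ s t)
    · have := (M.step_of_not_done h).2.1
      omega
    · have := (M.step_done h).2.1
      omega

theorem le_lev (t : ℕ) : s ≤ M.lev κ s t := by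
  induction t with
  | zero => exact le_rfl
  | succ t ih =>
    cases h : M.done (M.conf κ s t)
    · have := (M.step_of_not_done h).2.1
      omega
    · have := (M.step_done h).2.1
      omega

theorem req_le (t : ℕ) : M.req κ s t ≤ M.lev κ s t := by
  induction t with
  | zero => exact Nat.zero_le _
  | succ t ih =>
    cases h : M.done (M.conf κ s t)
    · have := M.step_of_not_done h
      omega
    · have := M.step_done h
      have := M.lev_le (κ := κ) (s := s) t
      omega

theorem exists_conf_eq (t : ℕ) :
    ∃ i ≤ t, M.conf κ s t = M.step^[i] (M.init (M.req κ s t, M.lev κ s t)) := by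
  induction t with
  | zero => exact ⟨0, le_rfl, rfl⟩
  | succ t ih =>
    cases h : M.done (M.conf κ s t)
    · obtain ⟨i, hi, h'⟩ := ih
      obtain ⟨h₁, h₂, h₃, -⟩ := M.step_of_not_done h
      exact ⟨i + 1, by omega, by rw [h₃, h₁, h₂, h', Function.iterate_succ_apply']⟩
    · obtain ⟨h₁, h₂, h₃, -⟩ := M.step_done h
      exact ⟨0, Nat.zero_le _, by rw [h₃, h₁, h₂]; rfl⟩

theorem mem_newWords {c : M.C} {n : ℕ} {x : Word} :
    x ∈ M.newWords κ c n ↔ ∃ i < κ n, M.bit (c, i) = false ∧ oneZero n i = x := by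
  simp [newWords, and_assoc]

theorem newWords_subset {c : M.C} {n : ℕ} : M.newWords κ c n ⊆ level κ n :=
  List.map_subset _ (List.filter_subset_self _)

section

variable (hκ : ∀ n, s ≤ n → κ n ≤ n + 1)
include hκ

theorem length_of_mem_words {x : Word} (hx : x ∈ M.words κ s t) :
    s < x.length ∧ x.length ≤ M.lev κ s t := by
  induction t with
  | zero => cases hx
  | succ t ih =>
    cases h : M.done (M.conf κ s t)
    · obtain ⟨-, h₂, -, h₄⟩ := M.step_of_not_done h
      rw [h₂]
      exact ih (h₄ ▸ hx)
    · obtain ⟨-, h₂, -, h₄⟩ := M.step_done h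
      have hle := M.lev_le (κ := κ) (s := s) t
      have hge := M.le_lev (κ := κ) (s := s) t
      rw [h₄, List.mem_append] at hx
      rcases hx with hx | hx
      · have := ih hx
        omega
      · have := length_of_mem_level (hκ _ hge) (M.newWords_subset hx)
        omega

theorem length_words_le (t : ℕ) : (M.words κ s t).length ≤ t * (s + t + 1) := by
  induction t with
  | zero => exact Nat.zero_le _
  | succ t ih =>
    have h₀ : (M.words κ s (t + 1)).length ≤ (M.words κ s t).length + (s + t + 1) := by
      cases h : M.done (M.conf κ s t)
      · rw [(M.step_of_not_done h).2.2.2]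
        omega
      · have h₁ : (M.newWords κ (M.conf κ s t) (M.lev κ s t)).length ≤ κ (M.lev κ s t) := by
          rw [newWords, List.length_map]
          exact (List.length_filter_le _ _).trans (by simp)
        have := hκ _ (M.le_lev (κ := κ) (s := s) t)
        have := M.lev_le (κ := κ) (s := s) t
        rw [(M.step_done h).2.2.2, List.length_append]
        omega
    nlinarith

theorem pt_stage (hpt : PT κ) : PT (M.stage κ s) := by
  have hnew : PT fun p : M.C × ℕ => M.newWords κ p.1 p.2 := by
    refine PT.map (f := fun p : M.C × ℕ => oneZero p.2) (PT.filter (PT.range (hpt.comp PT.snd))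
      (M.ptb_bit.comp ?_).not) (PT.oneZero (PT.snd' PT.fst) PT.snd)
    exact PT.pair (PT.fst' PT.fst) PT.snd
  have hclk : PT fun p : M.Stage => p.1 := PT.fst
  have hreq : PT fun p : M.Stage => p.2.1 := PT.fst' PT.snd
  have hlev : PT fun p : M.Stage => p.2.2.1 := PT.fst' (PT.snd' PT.snd)
  have hconf : PT fun p : M.Stage => p.2.2.2.1 := PT.fst' (PT.snd' (PT.snd' PT.snd))
  have hwords : PT fun p : M.Stage => p.2.2.2.2 := PT.snd' (PT.snd' (PT.snd' PT.snd))
  have htick : PT (M.tick κ) := PT.cond (M.ptb_done.comp hconf)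
    (hclk.succ.pair (hreq.succ.pair (hclk.succ.pair
      ((M.pt_init.comp (hreq.succ.pair hclk.succ)).pair
        (hwords.append (hnew.comp (hconf.pair hlev)))))))
    (hclk.succ.pair (hreq.pair (hlev.pair ((M.pt_step.comp hconf).pair hwords))))
  obtain ⟨k, hk⟩ := M.length_le
  have hst : PolyBdd fun t => s + t := (PolyBdd.const s).add .id
  refine PT.iterate (step := fun _ => M.tick κ) PT.id (PT.const _) (htick.comp PT.snd)
    ⟨fun t => 6 * (s + t) + 4 + (2 * (3 * (s + t) + 1 + t + 2) ^ k +
        t * (s + t + 1) * (2 * (s + t) + 1)),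
      (((PolyBdd.const 6).mul hst).add (.const 4)).add (((PolyBdd.const 2).mul
        ((PolyBdd.pow_add_two k).comp ((((PolyBdd.const 3).mul hst).add (.const 1)).add .id))).add
        ((PolyBdd.id.mul (hst.add (.const 1))).mul
          (((PolyBdd.const 2).mul hst).add (.const 1)))), fun t i hi => ?_⟩
  have h₁ := M.clock_eq κ s i
  have h₂ := M.lev_le (κ := κ) (s := s) i
  have h₃ := M.req_le (κ := κ) (s := s) i
  have h₄ : (enc (M.conf κ s i)).length ≤ (3 * (s + t) + 1 + t + 2) ^ k := by
    obtain ⟨i', hi', h⟩ := M.exists_conf_eq (κ := κ) (s := s) i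
    rw [h]
    refine (hk _ _).trans (Nat.pow_le_pow_left ?_ k)
    rw [length_enc_prod, length_enc_nat, length_enc_nat]
    omega
  have h₅ : (enc (M.words κ s i)).length ≤ t * (s + t + 1) * (2 * (s + t) + 1) := by
    refine (length_enc_le_mul (m := s + t) fun x hx => ?_).trans (Nat.mul_le_mul_right _ ?_)
    · have := (M.length_of_mem_words hκ hx).2
      rw [enc_word]
      omega
    · exact (M.length_words_le hκ i).trans (Nat.mul_le_mul hi (by omega))
  have h₆ : (enc (M.stage κ s i)).length = 2 * (M.stage κ s i).1 + (2 * M.req κ s i +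
      (2 * M.lev κ s i + (2 * (enc (M.conf κ s i)).length +
        (enc (M.words κ s i)).length + 1) + 1) + 1) + 1 := by
    obtain ⟨a, b, c, d, e, h⟩ : ∃ a b c d e, M.stage κ s i = (a, b, c, d, e) :=
      ⟨_, _, _, _, _, rfl⟩
    simp [req, lev, conf, words, h]
  change (enc (M.stage κ s i)).length ≤ _
  rw [length_enc_nat]
  beta_reduce
  omega

theorem mem_words_add {x : Word} (d : ℕ) (hx : x ∈ M.words κ s (t + d)) :
    x ∈ M.words κ s t ∨ x ∈ level κ (M.lev κ s t) ∨ s + t + 1 < x.length := by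
  suffices (M.lev κ s (t + d) = M.lev κ s t ∨ s + t < M.lev κ s (t + d)) ∧
      (x ∈ M.words κ s (t + d) →
        x ∈ M.words κ s t ∨ x ∈ level κ (M.lev κ s t) ∨ s + t + 1 < x.length) from this.2 hx
  clear hx
  induction d with
  | zero => exact ⟨.inl rfl, .inl⟩
  | succ d ih =>
    rw [← Nat.add_assoc]
    cases h : M.done (M.conf κ s (t + d))
    · obtain ⟨-, h₂, -, h₄⟩ := M.step_of_not_done h
      rwa [h₂, h₄]
    · obtain ⟨-, h₂, -, h₄⟩ := M.step_done h
      rw [h₂, h₄]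
      refine ⟨.inr (by omega), fun hx => (List.mem_append.1 hx).elim ih.2 fun hx => ?_⟩
      replace hx := M.newWords_subset hx
      rcases ih.1 with h | h
      · rw [h] at hx
        exact .inr (.inl hx)
      · have := length_of_mem_level (hκ _ (M.le_lev _)) hx
        exact .inr (.inr (by omega))

end

theorem words_subset_add (d : ℕ) : M.words κ s t ⊆ M.words κ s (t + d) := by
  induction d with
  | zero => exact List.Subset.refl _
  | succ d ih =>
    rw [← Nat.add_assoc]
    cases h : M.done (M.conf κ s (t + d))
    · rwa [(M.step_of_not_done h).2.2.2]
    · rw [(M.step_done h).2.2.2]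
      exact List.subset_append_of_subset_left _ ih

theorem exists_done_conf (t : ℕ) : ∃ t', M.done (M.conf κ s t') = true ∧
    M.req κ s t' = M.req κ s t ∧ M.lev κ s t' = M.lev κ s t := by
  by_contra! hno
  have hrun : ∀ d, M.req κ s (t + d) = M.req κ s t ∧ M.lev κ s (t + d) = M.lev κ s t ∧
      M.conf κ s (t + d) = M.step^[d] (M.conf κ s t) := by
    intro d
    induction d with
    | zero => exact ⟨rfl, rfl, rfl⟩
    | succ d ih =>
      obtain ⟨h₁, h₂, h₃⟩ := ih
      have h : M.done (M.conf κ s (t + d)) = false := by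
        by_contra h
        exact hno _ (by simpa using h) h₁ h₂
      obtain ⟨h₁', h₂', h₃', -⟩ := M.step_of_not_done h
      rw [Nat.add_assoc] at h₁' h₂' h₃'
      rw [h₁', h₂', h₃', h₃, Function.iterate_succ_apply']
      exact ⟨h₁, h₂, rfl⟩
  obtain ⟨i, -, hi⟩ := M.exists_conf_eq (κ := κ) (s := s) t
  obtain ⟨d, hd⟩ := M.exists_done (M.req κ s t, M.lev κ s t)
  obtain ⟨h₁, h₂, h₃⟩ := hrun d
  refine hno _ ?_ h₁ h₂
  rw [h₃, hi, ← Function.iterate_add_apply, Nat.add_comm, Function.iterate_add_apply,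
    Function.iterate_fixed (M.step_of_done _ hd), hd]

theorem exists_req_eq (j : ℕ) : ∃ t, M.req κ s t = j := by
  induction j with
  | zero => exact ⟨0, rfl⟩
  | succ j ih =>
    obtain ⟨t, ht⟩ := ih
    obtain ⟨t', hd, h, -⟩ := M.exists_done_conf (κ := κ) (s := s) t
    exact ⟨t' + 1, by rw [(M.step_done hd).1, h, ht]⟩

variable (κ s) in
/-- The language enumerated by the construction. -/
def language : Set Word := {x | ∃ t, x ∈ M.words κ s t}

theorem mem_language_cases (hκ : ∀ n, s ≤ n → κ n ≤ n + 1) {x : Word}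
    (hx : x ∈ M.language κ s) (t : ℕ) :
    x ∈ M.words κ s t ∨ x ∈ level κ (M.lev κ s t) ∨ s + t + 1 < x.length := by
  obtain ⟨t', hx⟩ := hx
  rcases le_total t t' with h | h
  · obtain ⟨d, rfl⟩ := Nat.exists_eq_add_of_le h
    exact M.mem_words_add hκ d hx
  · obtain ⟨d, rfl⟩ := Nat.exists_eq_add_of_le h
    exact .inl (M.words_subset_add d hx)

theorem oneZero_mem_language (hκ : ∀ n, s ≤ n → κ n ≤ n + 1) (t : ℕ) {i : ℕ}
    (hi : i < κ (M.lev κ s t)) : oneZero (M.lev κ s t) i ∈ M.language κ s ↔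
      (E (M.req κ s t) (M.lev κ s t)).testBit i = false := by
  obtain ⟨t', hd, h₁, h₂⟩ := M.exists_done_conf (κ := κ) (s := s) t
  rw [← h₂] at hi
  rw [← h₁, ← h₂]
  obtain ⟨-, h₂', -, h₄'⟩ := M.step_done hd
  obtain ⟨i', -, hi'⟩ := M.exists_conf_eq (κ := κ) (s := s) t'
  have hb := M.bit_eq (M.req κ s t', M.lev κ s t') i' (hi' ▸ hd) i
  rw [← hi'] at hb
  rw [← hb]
  have hlt := hκ _ (M.le_lev (κ := κ) (s := s) t')
  have hlen := length_oneZero (show i ≤ M.lev κ s t' by omega)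
  have hle := M.lev_le (κ := κ) (s := s) t'
  constructor
  · intro hx
    have hx' : oneZero (M.lev κ s t') i ∈ M.words κ s (t' + 1) := by
      rcases M.mem_language_cases hκ hx (t' + 1) with hx | hx | hx
      · exact hx
      · have := length_of_mem_level (hκ _ (M.le_lev _)) hx
        omega
      · omega
    rw [h₄', List.mem_append] at hx'
    rcases hx' with hx' | hx'
    · have := (M.length_of_mem_words hκ hx').2
      omega
    · obtain ⟨i₁, -, h, he⟩ := M.mem_newWords.1 hx'
      rwa [← oneZero_injective _ he]
  · intro h
    exact ⟨t' + 1, h₄' ▸ List.mem_append_right _ (M.mem_newWords.2 ⟨i, hi, h, rfl⟩)⟩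

end StepwiseEvaluation

/-- Given levels of one-zero words, of which `κ n` are used at length `n + 1`, and a computable `E`,
there is a language of such words which agrees with the complement of the binary digits of `E` on
the levels that it treats, and which, up to words longer than `t` and words of one level `N t`, is
listed in time polynomial in `t`. -/
theorem exists_sparse_language {κ : ℕ → ℕ} (hpt : PT κ) {s : ℕ} (hκ : ∀ n, s ≤ n → κ n ≤ n + 1)
    {E : ℕ → ℕ → ℕ} (hE : Computable₂ E) :
    ∃ (L : Set Word) (A : ℕ → List Word) (J N : ℕ → ℕ), PT A ∧ PT N ∧ (∀ t, ∀ x ∈ A t, x ∈ L) ∧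
      (∀ x ∈ L, s < x.length) ∧ (∀ t, s ≤ N t) ∧
      (∀ x ∈ L, ∀ t, x.length ≤ t → x ∈ A t ∨ x ∈ level κ (N t)) ∧
      (∀ t, ∀ i < κ (N t), oneZero (N t) i ∈ L ↔ (E (J t) (N t)).testBit i = false) ∧
      ∀ j, ∃ t, J t = j ∧ j ≤ N t := by
  obtain ⟨M⟩ := nonempty_stepwiseEvaluation hE
  have h := M.pt_stage hκ hpt
  refine ⟨M.language κ s, M.words κ s, M.req κ s, M.lev κ s,
    PT.snd' (PT.snd' (PT.snd' (PT.snd' h))), PT.fst' (PT.snd' (PT.snd' h)),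
    fun t x hx => ⟨t, hx⟩, fun x ⟨t, hx⟩ => (M.length_of_mem_words hκ hx).1, M.le_lev,
    fun x hx t ht => ?_, fun t i hi => M.oneZero_mem_language hκ t hi, fun j => ?_⟩
  · rcases M.mem_language_cases hκ hx t with h | h | h
    · exact .inl h
    · exact .inr h
    · omega
  · obtain ⟨t, rfl⟩ := M.exists_req_eq (κ := κ) (s := s) j
    exact ⟨t, rfl, M.req_le t⟩

/-! ### Diagonalization against polynomial-time functions -/

theorem PT.primrec {f : ℕ → Word} (hf : PT f) : Primrec f := by
  obtain ⟨F, hF, h⟩ := hf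
  have hrep : Primrec fun n : ℕ => List.replicate n true :=
    (Primrec.list_map (g := fun _ _ => true) Primrec.list_range (.const true)).of_eq fun n => by
      simp
  exact (hF.primrec.comp hrep).of_eq fun n => h n

/-- The number whose binary digits are the complements of the bits of a word. -/
def complBits (w : Word) : ℕ := w.foldr (fun b a => bif b then 2 * a else 2 * a + 1) 0

theorem primrec_complBits : Primrec complBits := by
  have h : Primrec fun p : Word × Bool × ℕ => 2 * p.2.2 :=
    Primrec.nat_mul.comp (.const 2) (.comp .snd .snd)
  exact Primrec.list_foldr (h := fun _ p => bif p.1 then 2 * p.2 else 2 * p.2 + 1) .id (.const 0)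
    (Primrec.cond (.comp .fst .snd) h (.comp .succ h))

theorem testBit_complBits (w : Word) {i : ℕ} (h : i < w.length) :
    (complBits w).testBit i = !w[i] := by
  induction w generalizing i with
  | nil => cases h
  | cons b w ih =>
    have hb : complBits (b :: w) = Nat.bit (!b) (complBits w) := by
      cases b <;> rfl
    rw [hb]
    cases i with
    | zero => simp
    | succ i => rw [Nat.testBit_bit_succ, ih (by simpa using h)]; rfl

theorem getElem_level {κ : ℕ → ℕ} {n i : ℕ} (h : i < (level κ n).length) :
    (level κ n)[i] = oneZero n i := by simp [level]

theorem charString_level_eq {κ : ℕ → ℕ} {L : Set Word} {n : ℕ} {w : Word} (hw : w.length = κ n)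
    (h : ∀ i (hi : i < w.length), oneZero n i ∈ L ↔ w[i] = true) :
    charString L (level κ n) = w := by
  refine List.ext_getElem (by simp [charString, length_level, hw]) fun i h₁ h₂ => ?_
  simp only [charString, List.getElem_map, getElem_level, h i h₂, Bool.decide_eq_true]

/-- A language with the properties of `exists_sparse_language` in which, on infinitely many levels,
the missing words are given by the digits of `ρ (h n)`, for each primitive recursive `h`. -/
theorem exists_diagonal_language {κ : ℕ → ℕ} (hpt : PT κ) {s : ℕ}
    (hκ : ∀ n, s ≤ n → κ n ≤ n + 1) {ρ : ℕ → ℕ} (hρ : Primrec ρ) :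
    ∃ (L : Set Word) (A : ℕ → List Word) (N : ℕ → ℕ), PT A ∧ PT N ∧ (∀ t, ∀ x ∈ A t, x ∈ L) ∧
      (∀ x ∈ L, s < x.length) ∧ (∀ t, s ≤ N t) ∧
      (∀ x ∈ L, ∀ t, x.length ≤ t → x ∈ A t ∨ x ∈ level κ (N t)) ∧
      (∀ t, ∃ e, ∀ i < κ (N t), oneZero (N t) i ∈ L ↔ (ρ e).testBit i = false) ∧
      ∀ h : ℕ → ℕ, Primrec h → ∀ n₀, ∃ n, n₀ ≤ n ∧ s ≤ n ∧
        ∀ i < κ n, oneZero n i ∈ L ↔ (ρ (h n)).testBit i = false := by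
  obtain ⟨L, A, J, N, h₁, h₂, h₃, h₄, h₅, h₆, h₇, h₈⟩ := exists_sparse_language hpt hκ
    (E := fun j n => ρ (universal j.unpair.1 n)) (hρ.to_comp.comp (computable_universal.comp
      ((Computable.fst.comp (Primrec.unpair.to_comp)).comp .fst) .snd))
  refine ⟨L, A, N, h₁, h₂, h₃, h₄, h₅, h₆, fun t => ⟨_, h₇ t⟩, fun h hh n₀ => ?_⟩
  obtain ⟨c, rfl⟩ := exists_universal_eq hh
  obtain ⟨t, ht, hle⟩ := h₈ (Nat.pair c n₀)
  refine ⟨N t, (Nat.right_le_pair c n₀).trans hle, h₅ t, fun i hi => ?_⟩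
  rw [h₇ t i hi, ht, Nat.unpair_pair]

/-! ### Membership comparison from selection -/

namespace PT

variable {α : Type} [Enc α]

theorem take_one {l : α → List Word} (hl : PT l) : PT fun a => (l a).take 1 :=
  (listCases (h := fun p => [p.2.1]) hl (const ([] : List Word))
    (cons (fst' (snd' id)) (const []))).congr fun a => by cases l a <;> rfl

end PT

/-- For each entry of a list, whether it occurs again later. -/
def laterBits : List Word → Word
  | [] => []
  | z :: zs => decide (z ∈ zs) :: laterBits zs

theorem length_laterBits (zs : List Word) : (laterBits zs).length = zs.length := by
  induction zs with
  | nil => rfl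
  | cons z zs ih => simp [laterBits, ih]

theorem PT.laterBits : PT laterBits := by
  have hr : ∀ zs : List Word, zs.foldr (fun z (p : List Word × Word) =>
      (z :: p.1, decide (z ∈ p.1) :: p.2)) ([], []) = (zs, _root_.laterBits zs) := by
    intro zs
    induction zs with
    | nil => rfl
    | cons z zs ih => rw [List.foldr_cons, ih]; rfl
  have h := PT.foldr (α := List Word) (f := fun _ z (p : List Word × Word) =>
    (z :: p.1, decide (z ∈ p.1) :: p.2)) PT.id (PT.const ([], []))
    (PT.pair (PT.cons (fst' (snd' id)) (fst' (snd' (snd' id))))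
      (PT.wordConsB (PTB.mem (fst' (snd' id)) (fst' (snd' (snd' id)))) (snd' (snd' (snd' id)))))
    ⟨fun n => 2 * n + n + 1, ((PolyBdd.const 2).mul .id).add .id |>.add (.const 1),
      fun zs t ht => ?_⟩
  · exact (snd' h).congr fun zs => by rw [hr]
  · have h₁ := length_enc_le_of_sublist ht
    have h₂ := length_le_length_enc t
    rw [hr, length_enc_prod, enc_word, length_laterBits]
    beta_reduce
    omega

theorem laterBits_eq_of_nodup {zs : List Word} (h : zs.Nodup) :
    laterBits zs = zs.map fun _ => false := by
  induction zs with
  | nil => rfl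
  | cons z zs ih =>
    rw [List.nodup_cons] at h
    simp [laterBits, h.1, ih h.2]

theorem nodup_of_charString_eq_laterBits {A : Set Word} {zs : List Word}
    (h : charString A zs = laterBits zs) : zs.Nodup := by
  induction zs with
  | nil => exact List.nodup_nil
  | cons z zs ih =>
    simp only [charString, List.map_cons, laterBits, List.cons.injEq] at h
    have hn := ih h.2
    refine List.nodup_cons.2 ⟨fun hz => ?_, hn⟩
    have h₂ : zs.map (fun z => @decide (z ∈ A) (Classical.propDecidable _)) =
        zs.map fun _ => false := h.2.trans (laterBits_eq_of_nodup hn)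
    have := List.map_inj_left.1 h₂ z hz
    simp_all

/-- The membership comparison for a selector: a tuple with a repetition is treated as if exactly the
last occurrences were not in the language; otherwise the guess is that the language contains all
strings except the first one that is selected. -/
def comparison (f : List Word → List Word) (zs : List Word) : Word :=
  bif laterBits zs == zs.map fun _ => false then zs.map fun z => !decide (z ∈ (f zs).take 1)
  else laterBits zs

theorem PT.comparison {f : List Word → List Word} (hf : PT f) : PT (comparison f) :=
  PT.cond (PTB.wordEq PT.laterBits (PT.wordMap (c := fun _ _ => false) PT.id (PTB.const false)))
    (PT.wordMap (c := fun zs z => !decide (z ∈ (f zs).take 1)) PT.id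
      (PTB.mem PT.snd (take_one (hf.comp PT.fst))).not)
    PT.laterBits

theorem length_comparison (f : List Word → List Word) (zs : List Word) :
    (comparison f zs).length = zs.length := by
  rw [comparison]
  cases laterBits zs == zs.map fun _ => false <;> simp [length_laterBits]

theorem comparison_eq_of_nodup (f : List Word → List Word) {zs : List Word} (h : zs.Nodup) :
    comparison f zs = zs.map fun z => !decide (z ∈ (f zs).take 1) := by
  simp [comparison, laterBits_eq_of_nodup h]

theorem SelectsFor.charString_ne {L : Set Word} {i j : ℕ} {zs out : List Word}
    (h : SelectsFor L i j zs out) (hj : 1 ≤ j) (hi : i + 1 ≤ zs.length) (hz : zs.Nodup) :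
    charString L zs ≠ zs.map fun z => !decide (z ∈ out.take 1) := by
  classical
  intro heq
  have hL : ∀ z ∈ zs, z ∈ L ↔ z ∉ out.take 1 := fun z hz => by
    have := List.map_inj_left.1 heq z hz
    by_cases hzL : z ∈ L <;> simp_all
  have hcard : i ≤ (L ∩ {y | y ∈ zs}).ncard := by
    have hfin : (L ∩ {y | y ∈ zs}).Finite := (List.finite_toSet zs).inter_of_right L
    have hsub : ((zs.toFinset \ (out.take 1).toFinset : Finset Word) : Set Word) ⊆
        L ∩ {y | y ∈ zs} := by
      intro z hz
      simp only [Finset.coe_sdiff, List.coe_toFinset, Set.mem_sdiff, Set.mem_ofPred_eq] at hz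
      exact ⟨(hL z hz.1).2 hz.2, hz.1⟩
    have h₁ := Set.ncard_le_ncard hsub hfin
    rw [Set.ncard_coe_finset] at h₁
    have h₂ := Finset.le_card_sdiff (out.take 1).toFinset zs.toFinset
    have h₃ := (out.take 1).toFinset_card_le
    rw [List.toFinset_card_of_nodup hz] at h₂
    have h₄ : (out.take 1).length ≤ 1 := by simp
    omega
  obtain ⟨hout, hn⟩ := h.2 hcard
  rcases out with _ | ⟨x, out⟩
  · simp at hn; omega
  · exact (hL x (h.1 x (by simp))).1 (hout x (by simp)) (by simp)

theorem charString_ne_comparison {L : Set Word} {f : List Word → List Word} {zs : List Word}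
    (h : zs.Nodup → ∃ i j, SelectsFor L i j zs (f zs) ∧ 1 ≤ j ∧ i + 1 ≤ zs.length) :
    charString L zs ≠ comparison f zs := by
  by_cases hz : zs.Nodup
  · obtain ⟨i, j, h, hj, hi⟩ := h hz
    rw [comparison_eq_of_nodup f hz]
    exact h.charString_ne hj hi hz
  · have hne : (laterBits zs == zs.map fun _ => false) = false := by
      rw [beq_eq_false_iff_ne]
      intro h
      apply hz
      exact nodup_of_charString_eq_laterBits (A := ∅) (by rw [h]; simp [charString])
    rw [comparison, hne]
    exact fun h => hz (nodup_of_charString_eq_laterBits h)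

theorem selClass_subset_PMc {g₁ g₂ g : ℕ → ℕ} (h₁ : ∀ n, 1 ≤ g₂ n)
    (h₂ : ∀ m n, g n ≤ m → g₁ m + 1 ≤ m) : SelClass g₁ g₂ ⊆ PMc g := by
  rintro L ⟨f, hf, hs⟩
  refine ⟨comparison f, (PT.of_polyTimeComputable hf).comparison.polyTimeComputable_word,
    fun zs h1 hg => ⟨length_comparison f zs, charString_ne_comparison fun hz =>
      ⟨_, _, hs zs h1 hz, h₁ _, h₂ _ _ hg⟩⟩⟩

theorem fairSelPred_subset_PMc : FairSelPred ⊆ PMc thrN := by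
  classical
  rintro L ⟨f, hf, hs⟩
  let T : List Word := [[], [false], [true]].filter fun z => decide (z ∈ L)
  have hT : ∀ z : Word, z.length ≤ 1 → (z ∈ T ↔ z ∈ L) := by
    intro z hz
    rcases z with _ | ⟨_ | _, _ | ⟨_, z⟩⟩
    all_goals first | (exfalso; simp at hz; done) | simp [T]
  refine ⟨fun zs => bif zs.tail.isEmpty then zs.map fun z => !decide (z ∈ T)
    else comparison f zs, (PT.cond (PTB.isEmpty (PT.listTail PT.id))
      (PT.wordMap (c := fun _ z => !decide (z ∈ T)) PT.id (PTB.mem PT.snd (PT.const T)).not)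
      (PT.of_polyTimeComputable hf).comparison).polyTimeComputable_word, fun zs h1 hg => ?_⟩
  have hsup : ∀ z ∈ zs, z.length ≤ zs.length := fun z hz =>
    (Finset.le_sup (f := List.length) (List.mem_toFinset.2 hz)).trans
      ((le_max_left _ _).trans hg)
  rcases zs with _ | ⟨z, _ | ⟨z', zs⟩⟩
  · cases h1
  · have := hT z (hsup z (by simp))
    by_cases hz : z ∈ L <;> simp [charString, this, hz]
  · simp only [List.tail_cons, List.isEmpty_cons, cond_false]
    refine ⟨length_comparison f _, charString_ne_comparison fun hz =>
      ⟨_, _, hs _ h1 hz hsup, le_rfl, ?_⟩⟩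
    simp only [thrPred, List.length_cons]
    omega

/-! ### Selectors for sparse languages -/

/-- Selects the members of `A`, or those of `B` if there are none. -/
def sparseSelect (A B ys : List Word) : List Word :=
  bif (ys.filter fun y => decide (y ∈ A)).isEmpty then ys.filter fun y => decide (y ∈ B)
  else ys.filter fun y => decide (y ∈ A)

theorem PT.sparseSelect {α : Type} [Enc α] {A B ys : α → List Word} (hA : PT A) (hB : PT B)
    (hy : PT ys) : PT fun a => _root_.sparseSelect (A a) (B a) (ys a) :=
  have h : ∀ A : α → List Word, PT A → PT fun a => (ys a).filter fun y => decide (y ∈ A a) :=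
    fun A hA => filter (c := fun a y => decide (y ∈ A a)) hy (PTB.mem snd (hA.comp fst))
  cond (PTB.isEmpty (h A hA)) (h B hB) (h A hA)

theorem selectsFor_sparseSelect {L : Set Word} {A B ys : List Word} {i : ℕ}
    (hA : ∀ x ∈ A, x ∈ L) (hL : ∀ x ∈ L, x ∈ ys → x ∈ A ∨ x ∈ B) (hi : 1 ≤ i)
    (hB : ∀ x ∈ ys, x ∈ B → B.length ≤ i) : SelectsFor L i 1 ys (sparseSelect A B ys) := by
  classical
  have hpos : ∀ {x : Word} {l : List Word}, x ∈ l → 1 ≤ {x | x ∈ l}.ncard := fun {x l} hx =>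
    (Set.ncard_pos (List.finite_toSet l)).2 ⟨x, hx⟩
  rw [sparseSelect]
  cases h : (ys.filter fun y => decide (y ∈ A)).isEmpty
  · rw [cond_false]
    refine ⟨fun x hx => (List.mem_filter.1 hx).1, fun _ => ⟨fun x hx => hA x ?_, ?_⟩⟩
    · simpa using (List.mem_filter.1 hx).2
    · obtain ⟨x, hx⟩ := List.isEmpty_eq_false_iff_exists_mem.1 h
      exact hpos hx
  · rw [cond_true]
    refine ⟨fun x hx => (List.mem_filter.1 hx).1, fun hc => ?_⟩
    have hnA : ∀ x ∈ ys, x ∉ A := by simpa using h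
    have hsub : L ∩ {y | y ∈ ys} ⊆ (B.toFinset : Set Word) := fun x hx => by
      simpa using (hL x hx.1 hx.2).resolve_left (hnA x hx.2)
    obtain ⟨x, hx⟩ : (L ∩ {y | y ∈ ys}).Nonempty := by
      rw [Set.nonempty_iff_ne_empty]
      intro h0
      rw [h0, Set.ncard_empty] at hc
      omega
    have hxB : x ∈ B := by simpa using hsub hx
    have hle : (B.toFinset : Set Word).ncard ≤ (L ∩ {y | y ∈ ys}).ncard := by
      rw [Set.ncard_coe_finset]
      exact (B.toFinset_card_le.trans (hB x hx.2 hxB)).trans hc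
    have heq := Set.eq_of_subset_of_ncard_le hsub hle (Finset.finite_toSet _)
    refine ⟨fun y hy => ?_, hpos (List.mem_filter.2 ⟨hx.2, by simpa using hxB⟩)⟩
    have hyB : y ∈ (B.toFinset : Set Word) := by simpa using (List.mem_filter.1 hy).2
    rw [← heq] at hyB
    exact hyB.1

/-! ### Separations -/

theorem length_le_of_mem {ys : List Word} {x : Word} (h : x ∈ ys) : x.length ≤ (enc ys).length :=
  length_enc_le_of_mem h

theorem not_mem_PMc {L : Set Word} {κ g : ℕ → ℕ} {s : ℕ} (hpt : PT κ)
    (hκ : ∀ n, s ≤ n → κ n ≤ n + 1)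
    (hd : ∀ h : ℕ → ℕ, Primrec h → ∀ n₀, ∃ n, n₀ ≤ n ∧ s ≤ n ∧
      ∀ i < κ n, oneZero n i ∈ L ↔ (h n).testBit i = false)
    (hg : ∀ n, s ≤ n → 1 ≤ κ n ∧ ∀ m ≤ n + 1, g m ≤ κ n) : L ∉ PMc g := by
  rintro ⟨f, hf, hmc⟩
  obtain ⟨n, -, hs, hn⟩ := hd _ (primrec_complBits.comp
    ((PT.of_polyTimeComputable_word hf).comp hpt.level).primrec) 0
  obtain ⟨h1, hg⟩ := hg n hs
  obtain ⟨hlen, hne⟩ := hmc (level κ n) (by rwa [length_level]) (by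
    rw [length_level]
    refine hg _ (Finset.sup_le fun x hx => ?_)
    exact (length_of_mem_level (hκ n hs) (List.mem_toFinset.1 hx)).le)
  rw [length_level] at hlen
  exact hne (charString_level_eq hlen fun i hi => by
    rw [hn i (hlen ▸ hi), testBit_complBits _ hi]
    simp)

theorem exists_mem_selLevel_not_mem_PMc {k : ℕ} (hk : 1 ≤ k) :
    ∃ L ∈ SelLevel k, L ∉ PMc fun _ => k := by
  have hκ : ∀ n, k ≤ n → k ≤ n + 1 := fun n hn => by omega
  obtain ⟨L, A, N, hA, hN, hAL, -, -, hL, -, hd⟩ :=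
    exists_diagonal_language (PT.const k) (s := k) hκ Primrec.id
  refine ⟨L, ⟨_, (PT.sparseSelect (hA.comp PT.id.size)
    ((PT.const k).level.comp (hN.comp PT.id.size)) PT.id).polyTimeComputable, fun ys _ _ => ?_⟩,
    not_mem_PMc (PT.const k) hκ hd fun n _ => ⟨hk, fun _ _ => le_rfl⟩⟩
  exact selectsFor_sparseSelect (hAL _) (fun x hx hy => hL x hx _ (length_le_of_mem hy)) hk
    fun _ _ _ => (length_level _ _).le

theorem exists_mem_fairSelPred_not_mem_PMc : ∃ L ∈ FairSelPred, L ∉ PMc thrPred := by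
  have hκ : ∀ n, 1 ≤ n → n ≤ n + 1 := fun n _ => by omega
  obtain ⟨L, A, N, hA, hN, hAL, -, hs, hL, -, hd⟩ :=
    exists_diagonal_language (κ := fun n => n) PT.id (s := 1) hκ Primrec.id
  refine ⟨L, ⟨_, (PT.sparseSelect (hA.comp PT.id.size)
    (PT.id.level.comp (hN.comp PT.id.size)) PT.id).polyTimeComputable, fun ys _ _ hf => ?_⟩,
    not_mem_PMc PT.id hκ hd fun n hn => ⟨hn, fun m hm => ?_⟩⟩
  · refine selectsFor_sparseSelect (hAL _) (fun x hx hy => hL x hx _ (length_le_of_mem hy))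
      (le_max_right _ _) fun x hy hx => ?_
    have h₁ := length_of_mem_level (hκ _ (hs _)) hx
    have h₂ := hf x hy
    rw [length_level, thrPred]
    omega
  · rw [thrPred]
    omega

/-- The membership comparison for a language with few missing words, where `A` lists words in the
language, and of two words in `B` at least one is in the language. -/
def compareTwo (A B : List Word) : List Word → Word
  | [] => []
  | [_] => [true]
  | x :: y :: zs =>
    (!decide (x ∈ B) && !decide (x ∈ A)) ::
      (bif decide (x ∈ B) then bif decide (y ∈ B) then x == y else !decide (y ∈ A) else false) ::
        zs.map fun _ => false

theorem PT.compareTwo {α : Type} [Enc α] {A B zs : α → List Word} (hA : PT A) (hB : PT B)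
    (hz : PT zs) : PT fun a => _root_.compareTwo (A a) (B a) (zs a) := by
  have hx : PT fun p : (α × Word × List Word) × Word × List Word => p.1.2.1 :=
    fst' (snd' fst)
  have hy : PT fun p : (α × Word × List Word) × Word × List Word => p.2.1 := fst' snd
  have ht : PT fun p : (α × Word × List Word) × Word × List Word => p.2.2 := snd' snd
  have hA' : PT fun p : (α × Word × List Word) × Word × List Word => A p.1.1 :=
    hA.comp (fst' fst)
  have hB' : PT fun p : (α × Word × List Word) × Word × List Word => B p.1.1 :=
    hB.comp (fst' fst)
  have h₂ := wordConsB ((PTB.mem hx hB').not.and (PTB.mem hx hA').not)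
    (wordConsB (PTB.cond (PTB.mem hx hB') (PTB.cond (PTB.mem hy hB') (PTB.wordEq hx hy)
      (PTB.mem hy hA').not) (PTB.const false))
      (wordMap (c := fun _ _ => false) ht (PTB.const false)))
  have h₁ := listCases (snd' (snd' (id (α := α × Word × List Word))))
    (const ([true] : Word)) h₂
  refine (listCases hz (const ([] : Word)) h₁).congr fun a => ?_
  rcases zs a with _ | ⟨x, _ | ⟨y, t⟩⟩ <;> rfl

theorem length_compareTwo (A B zs : List Word) : (compareTwo A B zs).length = zs.length := by
  rcases zs with _ | ⟨x, _ | ⟨y, t⟩⟩ <;> simp [compareTwo]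

theorem charString_ne_compareTwo {L : Set Word} {A B : List Word} {x y : Word} {zs : List Word}
    (hA : ∀ x ∈ A, x ∈ L) (hx : x ∈ L → x ∈ A ∨ x ∈ B) (hy : y ∈ L → y ∈ A ∨ y ∈ B)
    (hB : ∀ x ∈ B, ∀ y ∈ B, x ≠ y → x ∈ L ∨ y ∈ L) :
    charString L (x :: y :: zs) ≠ compareTwo A B (x :: y :: zs) := by
  intro h
  simp only [charString, List.map_cons, compareTwo, List.cons.injEq] at h
  obtain ⟨h₁, h₂, -⟩ := h
  have hA₁ := hA x
  have hA₂ := hA y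
  by_cases hxB : x ∈ B
  · by_cases hyB : y ∈ B
    · rcases eq_or_ne x y with rfl | hne
      · simp_all
      · have := hB x hxB y hyB hne
        simp_all
    · by_cases hyL : y ∈ L <;> simp_all
  · by_cases hxL : x ∈ L <;> simp_all

/-- There is a language in all classes `P-mc(g)` with reasonable `g ≥ 2` for which selection fails
on infinitely many levels, even though each level misses at most one word. -/
theorem exists_mem_PMc_not_selectsFor : ∃ L : Set Word,
    (∀ g : ℕ → ℕ, (∀ n, g n ≤ 1 → n ≤ 1) → L ∈ PMc g) ∧
      ∀ f : List Word → List Word, PolyTimeComputable tupleCode tupleCode f → ∀ n₀, ∃ n, n₀ ≤ n ∧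
        ∀ i j, i ≤ n → 1 ≤ j →
          ¬ SelectsFor L i j (level (fun n => n + 1) n) (f (level (fun n => n + 1) n)) := by
  have hpt : PT fun n => n + 1 := PT.id.succ
  obtain ⟨L, A, N, hA, hN, hAL, hlen, hs, hL, hmiss, hd⟩ :=
    exists_diagonal_language hpt (s := 1) (fun n _ => le_rfl) primrec_two_pow
  refine ⟨L, fun g hg => ⟨_, (PT.compareTwo (hA.comp PT.id.size)
    (hpt.level.comp (hN.comp PT.id.size)) PT.id).polyTimeComputable_word, fun zs h1 hgz =>
      ⟨length_compareTwo _ _ _, ?_⟩⟩, fun f hf n₀ => ?_⟩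
  · rcases zs with _ | ⟨x, _ | ⟨y, t⟩⟩
    · cases h1
    · have hx : x ∉ L := fun hx => by
        have h₁ := hg _ hgz
        have h₂ := hlen x hx
        simp at h₁
        omega
      simp [charString, compareTwo, hx]
    · refine charString_ne_compareTwo (hAL _)
        (fun hx => hL x hx _ (length_le_of_mem (by simp)))
        (fun hy => hL y hy _ (length_le_of_mem (by simp))) fun u hu v hv hne => ?_
      obtain ⟨e, he⟩ := hmiss (enc (x :: y :: t)).length
      simp only [level, List.mem_map, List.mem_range] at hu hv
      obtain ⟨i, hi, rfl⟩ := hu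
      obtain ⟨i', hi', rfl⟩ := hv
      rw [he i hi, he i' hi', Nat.testBit_two_pow, Nat.testBit_two_pow]
      by_contra! h
      simp at h
      exact hne (by rw [← h.1, ← h.2])
  · have hf' := (PT.of_polyTimeComputable hf).comparison.comp hpt.level
    obtain ⟨n, hn, -, h⟩ := hd _ ((Primrec.list_idxOf.comp (.const false) hf'.primrec)) n₀
    refine ⟨n, hn, fun i j hi hj hsel => ?_⟩
    have hnd := nodup_level (fun n => n + 1) n
    have hl := length_level (fun n => n + 1) n
    refine charString_ne_comparison (fun _ => ⟨i, j, hsel, hj, by rw [hl]; omega⟩)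
      (charString_level_eq (by rw [length_comparison, hl]) fun i hi => ?_)
    have hi' : i < n + 1 := by rwa [length_comparison, hl] at hi
    rw [h i hi', Nat.testBit_two_pow]
    simp only [decide_eq_false_iff_not]
    constructor
    · intro hne
      by_contra hfalse
      rw [Bool.not_eq_true] at hfalse
      have hmem : false ∈ comparison f (level (fun n => n + 1) n) := hfalse ▸ List.getElem_mem hi
      have hlt := List.idxOf_lt_length_of_mem hmem
      have hget := List.getElem_idxOf hlt
      apply hne
      have hinj : ∀ a b (ha : a < (comparison f (level (fun n => n + 1) n)).length)
          (hb : b < (comparison f (level (fun n => n + 1) n)).length),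
          (comparison f (level (fun n => n + 1) n))[a] = false →
          (comparison f (level (fun n => n + 1) n))[b] = false → a = b := by
        simp only [comparison_eq_of_nodup f hnd, List.getElem_map, getElem_level]
        intro a b _ _ ha hb
        cases hfl : f (level (fun n => n + 1) n) with
        | nil => simp [hfl] at ha
        | cons x t =>
          simp [hfl] at ha hb
          exact oneZero_injective n (ha.trans hb.symm)
      exact hinj _ _ hlt hi hget hfalse
    · rintro ht rfl
      rw [List.getElem_idxOf hi] at ht
      cases ht

theorem mainTheorem4 :
    (¬ PMc (fun _ => 2) ⊆ FairSelPred) ∧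
    (∀ k : ℕ, 1 ≤ k →
      SelLevel k ⊂ PMc (fun _ => k + 1) ∧ ¬ SelLevel k ⊆ PMc (fun _ => k)) ∧
    SelPred ⊂ PMc (fun _ => 2) ∧
    (FairSelPred ⊂ PMc thrN ∧ ¬ FairSelPred ⊆ PMc thrPred) := by
  obtain ⟨L, hmem, hsel⟩ := exists_mem_PMc_not_selectsFor
  have hlen := length_level fun n => n + 1
  have hnot : ∀ {g : ℕ → ℕ} {n₀ : ℕ}, (∀ n, n₀ ≤ n → g (n + 1) ≤ n) → L ∉ SelClass g fun _ => 1 := by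
    rintro g n₀ hg ⟨f, hf, h⟩
    obtain ⟨n, hn, hno⟩ := hsel f hf n₀
    have := h _ (by rw [hlen]; omega) (nodup_level (fun n => n + 1) n)
    rw [hlen] at this
    exact hno _ _ (hg n hn) le_rfl this
  have hpred : ∀ n, 1 ≤ n → thrPred (n + 1) ≤ n := fun n hn => by
    rw [thrPred]
    omega
  have hfair : L ∉ FairSelPred := by
    rintro ⟨f, hf, h⟩
    obtain ⟨n, hn, hno⟩ := hsel f hf 1
    have := h _ (by rw [hlen]; omega) (nodup_level (fun n => n + 1) n) fun x hx => by
      rw [hlen, length_of_mem_level (κ := fun n => n + 1) le_rfl hx]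
    rw [hlen] at this
    exact hno _ _ (hpred n hn) le_rfl this
  have hconst : ∀ k, 1 ≤ k → L ∈ PMc fun _ => k + 1 := fun k hk => hmem _ fun n hn => by omega
  refine ⟨fun h => hfair (h (hconst 1 le_rfl)), fun k hk => ⟨?_, fun h => ?_⟩, ?_, ?_, fun h => ?_⟩
  · refine ⟨selClass_subset_PMc (fun _ => le_rfl) fun m _ hm => hm, fun h => ?_⟩
    exact hnot (fun n hn => hn) (h (hconst k hk))
  · obtain ⟨L', h₁, h₂⟩ := exists_mem_selLevel_not_mem_PMc hk
    exact h₂ (h h₁)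
  · refine ⟨selClass_subset_PMc (fun _ => le_rfl) fun m _ hm => ?_, fun h => ?_⟩
    · rw [thrPred]
      omega
    · exact hnot hpred (h (hconst 1 le_rfl))
  · refine ⟨fairSelPred_subset_PMc, fun h => hfair (h (hmem _ fun n hn => ?_))⟩
    exact (le_max_left _ _).trans hn
  · obtain ⟨L', h₁, h₂⟩ := exists_mem_fairSelPred_not_mem_PMc
    exact h₂ (h h₁)
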